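/- Let $k$ be an imaginary quadratic field with discriminant $\Delta$, ring of integers $O$ and different $\partial$. Let $\mathfrak a$ be a nonzero fractional ideal, $\lambda\in\partial^{-1}\mathfrak a$ and $r\in\partial^{-1}$. Let $\partial_\lambda\mid\partial$ be the ideal with $\partial_\lambda^{-1}\mathfrak a=\mathfrak a+(\lambda)$, and put $\Delta(\lambda)=N(\partial_\lambda)$. For a rational number $m>0$ put $\mathbf m=m/\Delta(\lambda)$. For a prime $p$ put $k_p=k\otimes\mathbb Q_p$, $O_p=O\otimes\mathbb Z_p$, $\chi_p=(\Delta,\cdot)_p$ (Hilbert symbol), and let $\lambda_p,r_p$ be the images of $\lambda,r$ in $k_p$. *Whittaker functions.* Let $\psi_p$ be the $p$-component of the additive character of $\mathbb A/\mathbb Q$ whose archimedean component is $x\mapsto e^{2\pi i x}$. For a quadratic space $V_p=(k_p,\,t\,x\bar x)$ with $t\in\mathbb Q_p^\times$ and a locally constant, compactly supported function $\varphi$ on it, let $\Phi(g,s)$ be the standard section of the representation of $\mathrm{SL}_2(\mathbb Q_p)$ induced from $\chi_p|\cdot|^{s+1}$ with $\Phi(g,0)=(\omega(g)\varphi)(0)$,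 where $\omega$ is the Weil representation attached to $V_p$ and $\psi_p$. For $n\in\mathbb Q^\times$ let $W_{n,p}(s,\varphi)$ be the entire continuation of $$\int_{\mathbb Q_p}\Phi(w^{-1}n(b),s)\,\psi_p(-nb)\,db\quad(\mathrm{Re}\,s>0),\qquad w=\begin{pmatrix}0&1\\-1&0\end{pmatrix},\quad n(b)=\begin{pmatrix}1&b\\0&1\end{pmatrix},$$ and put $W^*_{n,p}(s,\varphi)=|\Delta|_p^{-\frac{s+1}2}\,L_p(s+1,\chi)\,W_{n,p}(s,\varphi)$, where $L_p(s,\chi)$ is the Euler factor at $p$ of the quadratic character $\chi$ of $k/\mathbb Q$. A prime denotes $d/ds$. *Local data at $p$.* Let $\mathcal V_p=(k_p,\,-N(\partial_\lambda^{-1}\mathfrak a)\,x\bar x)$, and say that $p\in\mathrm{Diff}(\mathcal V,\mathbf m)$ if $\mathcal V_p$ does not represent $\mathbf m$. Let $V^{(p)}_p=(k_p,\,-\kappa_pN(\partial_\lambda^{-1}\mathfrak a)\,x\bar x)$, where $\kappa_p\in\mathbb Z_p$ satisfies $\chi_p(\kappa_p)=-1$ and $\mathrm{ord}_p\kappa_p=1$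 if $p$ is inert and $0$ if $p$ is ramified in $k$. If $p\nmid\Delta$, let $\varphi_p=\varphi^{(p)}_p=\mathrm{char}(\mathfrak a_p^{-1})$, regarded as functions on $\mathcal V_p$ and on $V^{(p)}_p$ respectively. If $p\mid\Delta$, let $$\varphi_p(x)=\mathrm{char}(\mathfrak a_p^{-1})(x)\,\mathrm{char}(-\bar r_p+O_p)(x\lambda_p),$$ $$\varphi^{(p)}_p(x)=\mathrm{char}(\mathfrak a_p^{-1})(x)\,\mathrm{char}(\varpi_p\partial_p^{-1})(x\lambda_p)\,\mathrm{char}(-\bar r_p+O_p)(\mu_px\lambda_p),$$ where $\varpi_p$ is a uniformizer of $k_p$ and $\mu_p\in O_p$ satisfies $\mu_p\bar\mu_p-\kappa_p\in p^{-1}\Delta\mathbb Z_p$. **Proposition.** Let $m>0$ be rational, and let $p$ be a prime with $p\in\mathrm{Diff}(\mathcal V,\mathbf m)$ and with $p\ne2$ if $p$ is ramified in $k$. Then both continuations $W_{\mathbf m,p}(s,\varphi_p)$ and $W_{\mathbf m,p}(s,\varphi_p^{(p)})$ exist, both normalized functions are differentiable at $s=0$, and the following hold. (1) Suppose that $p$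 is inert in $k$. If $m\notin\mathbb Z_p$, then $W^*_{\mathbf m,p}(s,\varphi^{(p)}_p)=0$ for all $s$. If $m\in\mathbb Z_p$, then $W^*_{\mathbf m,p}(0,\varphi^{(p)}_p)\ne0$ and $$\frac{W^{*,\prime}_{\mathbf m,p}(0,\varphi_p)}{W^*_{\mathbf m,p}(0,\varphi^{(p)}_p)}=-\frac12\,(1+\mathrm{ord}_p m)\log p.$$ (2) If $p$ is ramified in $k$ and $r_p\notin O_p$, then $W^*_{\mathbf m,p}(s,\varphi^{(p)}_p)=0$ and $W^*_{\mathbf m,p}(s,\varphi_p)=0$ for all $s$. (3) Suppose that $p$ is ramified in $k$ and $r_p\in O_p$. If $\mathbf m\notin\mathbb Z_p$, then $W^*_{\mathbf m,p}(s,\varphi^{(p)}_p)=0$ for all $s$. If $\mathbf m\in\mathbb Z_p$, then $W^*_{\mathbf m,p}(0,\varphi^{(p)}_p)\ne0$ and $$\frac{W^{*,\prime}_{\mathbf m,p}(0,\varphi_p)}{W^*_{\mathbf m,p}(0,\varphi^{(p)}_p)}=-\frac12\,\mathrm{ord}_p\bigl(m\,N(\partial\,\partial_\lambda^{-1})\bigr)\log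 p.$$ (4) In all cases, $$W^{*,\prime}_{\mathbf m,p}(0,\varphi_p)=-\frac12\,c_p(m)\,\log p\cdot W^*_{\mathbf m,p}(0,\varphi^{(p)}_p),$$ where $c_p(m)=\mathrm{ord}_p(m)+1$ if $p\nmid\Delta$ and $c_p(m)=\mathrm{ord}_p\bigl(m\,\Delta\,\Delta(\lambda)^{-1}\bigr)$ if $p\mid\Delta$. -/

import Mathlib

open scoped TensorProduct nonZeroDivisors NumberField MatrixGroups
open MeasureTheory Filter

noncomputable section

namespace LocalWhittaker

/-! ### The field of `p`-adic numbers: Haar measure, additive character, Hilbert symbol -/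

section Padic

variable (p : ℕ) [Fact p.Prime]

instance instMeasurableSpacePadic : MeasurableSpace ℚ_[p] := borel ℚ_[p]

instance instBorelSpacePadic : BorelSpace ℚ_[p] := ⟨rfl⟩

/-- The ring of `p`-adic integers as a compact subset of `ℚ_[p]` with non-empty interior. -/
def unitBall : TopologicalSpace.PositiveCompacts ℚ_[p] where
  carrier := Metric.closedBall 0 1
  isCompact' := isCompact_closedBall 0 1
  interior_nonempty' :=
    ⟨0, mem_interior_iff_mem_nhds.mpr (Metric.closedBall_mem_nhds 0 one_pos)⟩

/-- `ℚ_[p]` carries the Haar measure for which `ℤ_[p]` has volume `1`. -/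
instance instMeasureSpacePadic : MeasureSpace ℚ_[p] where
  volume := Measure.addHaarMeasure (unitBall p)

variable {p}

/-- `max (0, -ord_p x)`. -/
def poleOrder (x : ℚ_[p]) : ℕ := (-x.valuation).toNat

theorem norm_mul_pow_poleOrder_le_one (x : ℚ_[p]) :
    ‖x * (p : ℚ_[p]) ^ poleOrder x‖ ≤ 1 := by
  have hp1 : (1 : ℝ) < p := by exact_mod_cast (Fact.out : p.Prime).one_lt
  have hp0 : (p : ℝ) ≠ 0 := by positivity
  by_cases hx : x = 0
  · simp [hx]
  · rw [norm_mul, norm_pow, Padic.norm_p, Padic.norm_eq_zpow_neg_valuation hx, inv_pow,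
      ← zpow_natCast, ← zpow_neg, ← zpow_add₀ hp0]
    apply zpow_le_one_of_nonpos₀ hp1.le
    unfold poleOrder
    omega

/-- The fractional part `{x} ∈ ℤ[1/p] ∩ [0, 1)`: with `n = poleOrder x`, it is `N / p ^ n` where
`0 ≤ N < p ^ n` and `N ≡ p ^ n x` modulo `p ^ n ℤ_[p]`. -/
def fracPart (x : ℚ_[p]) : ℚ :=
  (PadicInt.appr ⟨x * (p : ℚ_[p]) ^ poleOrder x, norm_mul_pow_poleOrder_le_one x⟩ (poleOrder x) : ℚ)
    / (p : ℚ) ^ poleOrder x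

/-- The `p`-component `ψ_p(x) = e(-{x})` of the canonical unramified additive character of `𝔸 / ℚ`
whose archimedean component is `x ↦ e(x) = exp (2 π i x)`. -/
def psi (x : ℚ_[p]) : ℂ :=
  Complex.exp (-(2 * Real.pi * Complex.I * (fracPart x : ℂ)))

open Classical in
/-- The Hilbert symbol `(a, b)_p`. -/
def hilbertSymbol (a b : ℚ_[p]) : ℤ :=
  if ∃ x y z : ℚ_[p], (x, y, z) ≠ (0, 0, 0) ∧ z ^ 2 = a * x ^ 2 + b * y ^ 2 then 1 else -1

/-- `n(b)`. -/
def nMat (b : ℚ_[p]) : SL(2, ℚ_[p]) := ⟨!![1, b; 0, 1], by simp [Matrix.det_fin_two]⟩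

/-- `w`. -/
def wMat : SL(2, ℚ_[p]) := ⟨!![0, 1; -1, 0], by simp [Matrix.det_fin_two]⟩

end Padic

/-! ### The quadratic algebra `k_p` -/

section LocalAlgebra

variable (p : ℕ) [Fact p.Prime] (K : Type*) [Field K] [NumberField K]

/-- `k_p = ℚ_p ⊗ k`. -/
abbrev LocalAlg : Type _ := ℚ_[p] ⊗[ℚ] K

variable {K}

/-- The image in `k_p` of an element of `k`. -/
def toLocal (x : K) : LocalAlg p K := (1 : ℚ_[p]) ⊗ₜ[ℚ] x

/-- The completion `I_p = ℤ_p I ⊆ k_p` of a fractional ideal `I`. -/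
def localIdeal (I : FractionalIdeal (𝓞 K)⁰ K) : Submodule ℤ_[p] (LocalAlg p K) :=
  Submodule.span ℤ_[p] (toLocal p '' (I : Set K))

variable (K) in
/-- `O_{k,p}`. -/
def localInt : Submodule ℤ_[p] (LocalAlg p K) := localIdeal p (1 : FractionalIdeal (𝓞 K)⁰ K)

variable {p}

/-- The nontrivial automorphism `x ↦ x̄ = Tr(x) - x` of the quadratic algebra `k_p`. -/
def conj (x : LocalAlg p K) : LocalAlg p K :=
  algebraMap ℚ_[p] (LocalAlg p K) (Algebra.trace ℚ_[p] (LocalAlg p K) x) - x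

/-- The quadratic form `Q(x) = t x x̄`. -/
def quadForm (t : ℚ_[p]) (x : LocalAlg p K) : ℚ_[p] := t * Algebra.norm ℚ_[p] x

/-- The bilinear form `(x, y) = Q(x + y) - Q(x) - Q(y) = t Tr(x ȳ)`. -/
def bilin (t : ℚ_[p]) (x y : LocalAlg p K) : ℚ_[p] :=
  quadForm t (x + y) - quadForm t x - quadForm t y

variable (p K) in
/-- The `ℚ_p`-basis of `k_p` given by a `ℤ`-basis of the ring of integers of `k`. -/
def localBasis :
    Module.Basis (Module.Free.ChooseBasisIndex ℤ (𝓞 K)) ℚ_[p] (LocalAlg p K) :=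
  Algebra.TensorProduct.basis ℚ_[p] (NumberField.integralBasis K)

/-- The integral over `V_p = (k_p, t x x̄)` for the Haar measure that is self-dual with respect to
`ψ_p((x, y))`. In coordinates with respect to a basis `(e_i)`, this measure is
`|det (e_i, e_j)|_p ^ (1/2) ∏ dx_i`. -/
def selfDualIntegral (t : ℚ_[p]) (f : LocalAlg p K → ℂ) : ℂ :=
  (Real.sqrt ‖(Matrix.of fun i j => bilin t (localBasis p K i) (localBasis p K j)).det‖ : ℂ) *
    ∫ x : Module.Free.ChooseBasisIndex ℤ (𝓞 K) → ℚ_[p], f (∑ i, x i • localBasis p K i)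

open Classical in
variable (K) in
/-- The local Weil index `γ(V_p) = ∫_{V_p} ψ_p(-Q(y)) dy` of `V_p = (k_p, t x x̄)`, where the
conditionally convergent integral is the (eventually constant) limit of the integrals over the
lattices `p ^ (-n) O_{k,p}`. -/
def weilIndex (t : ℚ_[p]) : ℂ :=
  limUnder atTop fun n : ℕ => selfDualIntegral t fun y : LocalAlg p K =>
    if (p : ℚ_[p]) ^ n • y ∈ localInt p K then psi (-quadForm t y) else 0

/-- The quadratic character `χ_p(x) = (Δ, x)_p` attached to `k / ℚ`. -/
def chi (K : Type*) [Field K] [NumberField K] (x : ℚ_[p]) : ℤ :=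
  hilbertSymbol (NumberField.discr K : ℚ_[p]) x

/-! ### The Weil representation of `SL₂(ℚ_p)` on functions on `V_p = (k_p, t x x̄)` -/

/-- The action of `n(b)`. -/
def weilN (t b : ℚ_[p]) (φ : LocalAlg p K → ℂ) : LocalAlg p K → ℂ :=
  fun x => psi (b * quadForm t x) * φ x

/-- The action of `m(a) = diag (a, a⁻¹)`. -/
def weilM (a : ℚ_[p]) (φ : LocalAlg p K → ℂ) : LocalAlg p K → ℂ :=
  fun x => (chi K a : ℂ) * (‖a‖ : ℂ) * φ (a • x)

/-- The action of `w⁻¹`. -/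
def weilWInv (t : ℚ_[p]) (φ : LocalAlg p K → ℂ) : LocalAlg p K → ℂ :=
  fun x => weilIndex K t * selfDualIntegral t fun y => φ y * psi (-bilin t x y)

open Classical in
/-- The action of `g = (a, b; c, d)`, through the Bruhat decomposition: `g = m(a) n(b / a)` if
`c = 0`, and `g = n(a / c) m(c⁻¹) w⁻¹ n(d / c)` if `c ≠ 0`. -/
def weil (t : ℚ_[p]) (g : SL(2, ℚ_[p])) (φ : LocalAlg p K → ℂ) : LocalAlg p K → ℂ :=
  if g 1 0 = 0 then weilM (g 0 0) (weilN t (g 0 1 / g 0 0) φ)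
  else weilN t (g 0 0 / g 1 0) (weilM (g 1 0)⁻¹ (weilWInv t (weilN t (g 1 1 / g 1 0) φ)))

/-- The standard section `Φ(g, s)` of the induced representation `I(s, χ_p)` with
`Φ(g, 0) = (ω(g) φ)(0)`: one has `Φ(g, s) = (ω(g) φ)(0) |a(g)| ^ s`, where `g = n(x) m(a(g)) k` with
`k ∈ SL₂(ℤ_p)`, so that `|a(g)| = 1 / max (|c|, |d|)` for the bottom row `(c, d)` of `g`. -/
def standardSection (t : ℚ_[p]) (φ : LocalAlg p K → ℂ) (g : SL(2, ℚ_[p])) (s : ℂ) : ℂ :=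
  weil t g φ 0 * ((max ‖g 1 0‖ ‖g 1 1‖ : ℝ) : ℂ) ^ (-s)

/-! ### Whittaker functions -/

/-- The integrand of the local Whittaker integral at the identity,
`b ↦ Φ(w⁻¹ n(b), s) ψ_p(-n b)`. -/
def whittakerIntegrand (t : ℚ_[p]) (φ : LocalAlg p K → ℂ) (n : ℚ) (s : ℂ) (b : ℚ_[p]) : ℂ :=
  standardSection t φ (wMat⁻¹ * nMat b) s * psi (-((n : ℚ_[p]) * b))

/-- `W` is the local Whittaker function `s ↦ W_{n,p}(s, φ)`: it is entire, and for `Re s > 0` it is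
given by the absolutely convergent integral `∫_{ℚ_p} Φ(w⁻¹ n(b), s) ψ_p(-n b) db`. -/
structure IsWhittaker (t : ℚ_[p]) (φ : LocalAlg p K → ℂ) (n : ℚ) (W : ℂ → ℂ) : Prop where
  differentiable : Differentiable ℂ W
  integrable : ∀ s : ℂ, 0 < s.re → Integrable (whittakerIntegrand t φ n s)
  eq_integral : ∀ s : ℂ, 0 < s.re → W s = ∫ b : ℚ_[p], whittakerIntegrand t φ n s b

/-- There is at most one such function. -/
theorem IsWhittaker.unique {t : ℚ_[p]} {φ : LocalAlg p K → ℂ} {n : ℚ} {W W' : ℂ → ℂ}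
    (h : IsWhittaker t φ n W) (h' : IsWhittaker t φ n W') : W = W' := by
  have hW : AnalyticOnNhd ℂ W Set.univ := fun z _ => h.differentiable.analyticAt z
  have hW' : AnalyticOnNhd ℂ W' Set.univ := fun z _ => h'.differentiable.analyticAt z
  refine hW.eq_of_eventuallyEq hW' (z₀ := 1) ?_
  have ho : IsOpen {s : ℂ | 0 < s.re} := isOpen_lt continuous_const Complex.continuous_re
  filter_upwards [ho.mem_nhds (show (1 : ℂ) ∈ {s : ℂ | 0 < s.re} by simp)] with s hs
  rw [h.eq_integral s hs, h'.eq_integral s hs]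

/-- The local Whittaker function `W_{n,p}(s, φ)`, as a function of `s`. -/
def whittaker (t : ℚ_[p]) (φ : LocalAlg p K → ℂ) (n : ℚ) : ℂ → ℂ :=
  Classical.epsilon fun W : ℂ → ℂ => IsWhittaker t φ n W

variable (p) in
open Classical in
/-- The local factor `L_p(s, χ) = (1 - χ(p) p ^ (-s))⁻¹`, where `χ(p) = 0` if `p` is ramified. -/
def localL (K : Type*) [Field K] [NumberField K] (s : ℂ) : ℂ :=
  if (p : ℤ) ∣ NumberField.discr K then 1
  else (1 - (chi K (p : ℚ_[p]) : ℂ) * (p : ℂ) ^ (-s))⁻¹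

/-- The normalized Whittaker function
`W*_{n,p}(s, φ) = |Δ|_p ^ (-(s + 1) / 2) L_p(s + 1, χ) W_{n,p}(s, φ)`. -/
def normalizedWhittaker (t : ℚ_[p]) (φ : LocalAlg p K → ℂ) (n : ℚ) (s : ℂ) : ℂ :=
  (‖(NumberField.discr K : ℚ_[p])‖ : ℂ) ^ (-(s + 1) / 2) * localL p K (s + 1) * whittaker t φ n s

end LocalAlgebra

/-! ### The data attached to `𝔞`, `λ`, `r` -/

section GlobalData

variable {K : Type*} [Field K] [NumberField K]

variable (K) in
/-- The different `∂` of `k / ℚ`. -/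
def different : FractionalIdeal (𝓞 K)⁰ K :=
  (differentIdeal ℤ (𝓞 K) : FractionalIdeal (𝓞 K)⁰ K)

/-- `∂_λ`, the divisor of `∂` such that `λ` generates `∂_λ⁻¹ 𝔞 / 𝔞`, that is, such that
`∂_λ⁻¹ 𝔞 = 𝔞 + (λ)`. -/
def differentAt (𝔞 : FractionalIdeal (𝓞 K)⁰ K) (lam : K) : FractionalIdeal (𝓞 K)⁰ K :=
  ((𝔞 + FractionalIdeal.spanSingleton (𝓞 K)⁰ lam) * 𝔞⁻¹)⁻¹

/-- `Δ(λ) = N(∂_λ)`. -/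
def discrAt (𝔞 : FractionalIdeal (𝓞 K)⁰ K) (lam : K) : ℚ :=
  FractionalIdeal.absNorm (differentAt 𝔞 lam)

/-- The coefficient `-N(∂_λ⁻¹ 𝔞)` of the quadratic form `Q(x) = -N(∂_λ⁻¹ 𝔞) x x̄` on `k`. -/
def formCoeff (𝔞 : FractionalIdeal (𝓞 K)⁰ K) (lam : K) : ℚ :=
  -FractionalIdeal.absNorm ((differentAt 𝔞 lam)⁻¹ * 𝔞)

/-- `p ∈ Diff(𝒱, n)` for a prime number `p`: the space `𝒱_p = (k_p, -N(∂_λ⁻¹ 𝔞) x x̄)` does not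
represent `n`. -/
def MemDiff (p : ℕ) [Fact p.Prime] (𝔞 : FractionalIdeal (𝓞 K)⁰ K) (lam : K) (n : ℚ) : Prop :=
  ¬ ∃ x : LocalAlg p K, quadForm (formCoeff 𝔞 lam : ℚ_[p]) x = (n : ℚ_[p])

variable (K) in
/-- `p` is ramified in `k`. -/
def IsRamified (p : ℕ) : Prop := (p : ℤ) ∣ NumberField.discr K

variable (K) in
/-- `p` is inert in `k`. -/
def IsInert (p : ℕ) : Prop := (Ideal.span {(p : 𝓞 K)}).IsPrime

variable (K) in
/-- `κ ∈ ℤ_p` with `(Δ, κ)_p = -1`, of order `0` if `p` is ramified and of order `1` otherwise. -/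
structure IsKappa (p : ℕ) [Fact p.Prime] (κ : ℚ_[p]) : Prop where
  ne_zero : κ ≠ 0
  symbol : hilbertSymbol (NumberField.discr K : ℚ_[p]) κ = -1
  ord_ramified : IsRamified K p → κ.valuation = 0
  ord_unramified : ¬ IsRamified K p → κ.valuation = 1

/-- `ϖ` is a uniformizer of `k_p`: it lies in `O_{k,p}`, and its multiples are exactly the
non-units of `O_{k,p}`. -/
def IsUniformizer {p : ℕ} [Fact p.Prime] (ϖ : LocalAlg p K) : Prop :=
  ϖ ∈ localInt p K ∧ ∀ x ∈ localInt p K,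
    (∃ y ∈ localInt p K, x = ϖ * y) ↔ ¬ ∃ y ∈ localInt p K, x * y = 1

/-- `μ ∈ O_{k,p}` with `μ μ̄ - κ ∈ p⁻¹ Δ ℤ_p`. -/
def IsMu {p : ℕ} [Fact p.Prime] (κ : ℚ_[p]) (μ : LocalAlg p K) : Prop :=
  μ ∈ localInt p K ∧ ∃ z : ℤ_[p],
    Algebra.norm ℚ_[p] μ - κ = (p : ℚ_[p])⁻¹ * (NumberField.discr K : ℚ_[p]) * (z : ℚ_[p])

open Classical in
/-- The local component `φ_p`: the function `char(𝔞_p⁻¹)(x)` if `p` is unramified, and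
`char(𝔞_p⁻¹)(x) char(-r̄_p + O_{k,p})(x λ_p)` if `p` is ramified. -/
def phi (p : ℕ) [Fact p.Prime] (𝔞 : FractionalIdeal (𝓞 K)⁰ K) (lam r : K) :
    LocalAlg p K → ℂ := fun x =>
  if x ∈ localIdeal p 𝔞⁻¹ ∧
      (IsRamified K p → x * toLocal p lam + conj (toLocal p r) ∈ localInt p K)
  then 1 else 0

open Classical in
/-- The local component `φ^{(p)}_p`: the function `char(𝔞_p⁻¹)(x)` if `p` is unramified, and
`char(𝔞_p⁻¹)(x) char(ϖ_p ∂_p⁻¹)(x λ_p) char(-r̄_p + O_{k,p})(μ_p x λ_p)` if `p` is ramified. -/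
def phiCoh (p : ℕ) [Fact p.Prime] (𝔞 : FractionalIdeal (𝓞 K)⁰ K) (lam r : K)
    (ϖ μ : LocalAlg p K) : LocalAlg p K → ℂ := fun x =>
  if x ∈ localIdeal p 𝔞⁻¹ ∧
      (IsRamified K p →
        (∃ y ∈ localIdeal p (different K)⁻¹, x * toLocal p lam = ϖ * y) ∧
        μ * x * toLocal p lam + conj (toLocal p r) ∈ localInt p K)
  then 1 else 0

/-- `W*_{n,p}(s, φ_p)`, for the space `𝒱_p = (k_p, -N(∂_λ⁻¹ 𝔞) x x̄)`. -/
def incoherentW (p : ℕ) [Fact p.Prime] (𝔞 : FractionalIdeal (𝓞 K)⁰ K) (lam r : K) (n : ℚ) :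
    ℂ → ℂ :=
  normalizedWhittaker (formCoeff 𝔞 lam : ℚ_[p]) (phi p 𝔞 lam r) n

/-- `W*_{n,p}(s, φ^{(p)}_p)`, for the space `V^{(p)}_p = (k_p, -κ N(∂_λ⁻¹ 𝔞) x x̄)`. -/
def coherentW (p : ℕ) [Fact p.Prime] (𝔞 : FractionalIdeal (𝓞 K)⁰ K) (lam r : K) (κ : ℚ_[p])
    (ϖ μ : LocalAlg p K) (n : ℚ) : ℂ → ℂ :=
  normalizedWhittaker (κ * (formCoeff 𝔞 lam : ℚ_[p])) (phiCoh p 𝔞 lam r ϖ μ) n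

open Classical in
/-- `c_p(m)`, equal to `ord_p(m) + 1` if `p ∤ Δ` and to `ord_p(m Δ / Δ(λ))` if `p ∣ Δ`. -/
def cCoeff (p : ℕ) (𝔞 : FractionalIdeal (𝓞 K)⁰ K) (lam : K) (m : ℚ) : ℤ :=
  if IsRamified K p then padicValRat p (m * NumberField.discr K * (discrAt 𝔞 lam)⁻¹)
  else padicValRat p m + 1

end GlobalData

end LocalWhittaker

end

noncomputable section

namespace LocalWhittaker

/-! ### The additive character `ψ_p`. -/

section AdditiveCharacter

variable {p : ℕ} [Fact p.Prime]

/-! Since `p` lies in Diff, the norm form of `k_p`, up to a scalar, misses a value; an isotropic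
form would represent everything. So `k_p` is a field, `|N x|` satisfies the ultrametric inequality,
and each localized ideal is a ball for it (`Anisotropic.mem_localIdeal_iff`). Put `t = -N(∂_λ⁻¹ 𝔞) =
-N(𝔞 + (λ))`. If `p` is unramified, or `r` is integral at `p`, both test functions are the indicator
of the lattice `|t N(x)| ≤ 1`.

Let `f` be the density of the image of Haar measure on the support under `x ↦ t N(x)`. Every element
of `1 + p ℤ_p` is the norm of a multiplier preserving the support, so `f` is constant on the cosets
of `1 + p ℤ_p`. Up to a Weil index and a measure factor, the Whittaker integrand is the Fourier
transform of `f` times `ψ_p(-n b) max(1, |b|) ^ (-s)`. Integrating the case `s = 0` over `|b| ≤ p ^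
k` gives the mean `D_k` of `f` on `n + p ^ k ℤ_p`, so the integral is `D_0 + ∑ p ^ (-k s) (D_k -
D_{k-1})`. The sum is finite because `D_k = f(n)` for `k > ord n`, and this is the continuation
(`IsShellConstant.integral_whittaker`). Its value at `0` is `f(n)`, which vanishes as `n` is not
represented by `t N`; summation by parts makes the derivative `log p · ∑_{k ≤ ord n} D_k`
(`deriv_whittakerSum`).

The norm group has index two and `κ` represents the other coset (`isLocalNorm_or_mul`). For the
lattice, `f` is a constant `C` at the represented `z` with `0 < |z| ≤ 1` and `0` at the others,
whence `f(z) + f(κ⁻¹ z) = C` for `0 < |z| ≤ |κ|`, and `D_k + D_{k+e} = C` for `k + e ≤ ord n`, where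
`e = ord κ` (`ballMean_add`). If `e = 1`, then `ord n` is odd and the means pair off, so in all
cases they add up to `(ord n + 1) C / 2`. The form `κ t N` does represent `n`, so its value at `s =
0` is the full density `C / |κ|`, and the self-dual measure absorbs `|κ|`. The Weil indices of `t`
and `κ t` are opposite, since the two norm classes together fill `ℚ_p^×` and `ψ_p` has integral zero
over `p⁻¹ ℤ_p` (`weilIndex_kappa`); they are nonzero by `classIntegral_ne_zero`. The ratio is thus
`-(ord n + 1) / 2 · log p` for `n = m / Δ(λ)`. The stated exponents follow because `Δ(λ)` is a
`p`-unit for unramified `p`, and `p` exactly divides `Δ` for odd ramified `p`.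

If `p` is ramified and `r` is not integral, then `φ^{(p)} = 0`, and `φ` lives on `|t N(x)| > 1`. A
represented `z ∈ n + ℤ_p` with `|z| > 1` would have `n / z ∈ 1 + p ℤ_p`, making `n` represented. So
the density vanishes on `n + ℤ_p`, and with it all the means. -/

theorem prime_cast_pos : (0 : ℝ) < p := by exact_mod_cast (Fact.out : p.Prime).pos

theorem one_lt_prime_cast : (1 : ℝ) < p := by exact_mod_cast (Fact.out : p.Prime).one_lt

theorem padic_norm_sub_le_max (x y : ℚ_[p]) : ‖x - y‖ ≤ max ‖x‖ ‖y‖ := by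
  simpa [sub_eq_add_neg] using IsUltrametricDist.norm_add_le_max x (-y)

theorem exists_int_eq_of_norm_le_one (a : ℤ) (k : ℕ)
    (h : ‖(((a : ℚ) / (p : ℚ) ^ k : ℚ) : ℚ_[p])‖ ≤ 1) : ∃ z : ℤ, (a : ℚ) / (p : ℚ) ^ k = z := by
  have hp := prime_cast_pos (p := p)
  have hp' : (p : ℚ) ≠ 0 := by exact_mod_cast (Fact.out : p.Prime).ne_zero
  push_cast at h
  rw [norm_div, norm_pow, Padic.norm_p, div_le_one (by positivity), inv_pow, ← zpow_natCast,
    ← zpow_neg, Padic.norm_int_le_pow_iff_dvd] at h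
  obtain ⟨z, rfl⟩ := h
  exact ⟨z, by push_cast; field_simp⟩

theorem norm_sub_fracPart_le_one (x : ℚ_[p]) : ‖x - (fracPart x : ℚ_[p])‖ ≤ 1 := by
  have hp := prime_cast_pos (p := p)
  have hp' : (p : ℚ_[p]) ≠ 0 := by exact_mod_cast (Fact.out : p.Prime).ne_zero
  set k := poleOrder x
  set y : ℤ_[p] := ⟨x * (p : ℚ_[p]) ^ k, norm_mul_pow_poleOrder_le_one x⟩ with hy
  have h := PadicInt.appr_spec k y
  obtain ⟨z, hz⟩ := Ideal.mem_span_singleton'.mp h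
  have h1 : x - (fracPart x : ℚ_[p]) = z := by
    have h2 := congrArg (fun w : ℤ_[p] => (w : ℚ_[p])) hz
    simp only [hy] at h2
    push_cast at h2
    have : (fracPart x : ℚ_[p]) = (PadicInt.appr y k : ℚ_[p]) / (p : ℚ_[p]) ^ k := by
      unfold fracPart
      push_cast
      rfl
    rw [this]
    field_simp
    exact h2.symm.trans (mul_comm _ _)
  rw [h1]
  exact z.2

/-- Two elements of `ℤ[1/p]` that are both congruent to `x` modulo `ℤ_p` differ by an element of
`ℤ[1/p] ∩ ℤ_p = ℤ`, which the exponential does not see. This frees `ψ_p` from the particular choice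
of fractional part and yields additivity. -/
theorem psi_eq_of_norm_sub_le (x : ℚ_[p]) (a : ℤ) (k : ℕ)
    (h : ‖x - (((a : ℚ) / (p : ℚ) ^ k : ℚ) : ℚ_[p])‖ ≤ 1) :
    psi x = Complex.exp (-(2 * Real.pi * Complex.I * (((a : ℚ) / (p : ℚ) ^ k : ℚ) : ℂ))) := by
  have hp' : (p : ℚ) ≠ 0 := by exact_mod_cast (Fact.out : p.Prime).ne_zero
  obtain ⟨b, l, hbl⟩ : ∃ (b : ℤ) (l : ℕ), fracPart x = (b : ℚ) / (p : ℚ) ^ l :=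
    ⟨PadicInt.appr ⟨x * (p : ℚ_[p]) ^ poleOrder x, norm_mul_pow_poleOrder_le_one x⟩
      (poleOrder x), poleOrder x, by simp [fracPart]⟩
  have h2 := norm_sub_fracPart_le_one x
  have key : ((a : ℚ) / (p : ℚ) ^ k) - fracPart x =
      ((a * p ^ l - b * p ^ k : ℤ) : ℚ) / (p : ℚ) ^ (k + l) := by
    rw [hbl, pow_add]
    push_cast
    field_simp
  obtain ⟨z, hz⟩ := exists_int_eq_of_norm_le_one (p := p) (a * p ^ l - b * p ^ k) (k + l) (by
    rw [← key]
    have := (padic_norm_sub_le_max (x - (fracPart x : ℚ_[p]))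
      (x - (((a : ℚ) / (p : ℚ) ^ k : ℚ) : ℚ_[p]))).trans (max_le h2 h)
    have e : (((a : ℚ) / (p : ℚ) ^ k - fracPart x : ℚ) : ℚ_[p]) = x - (fracPart x : ℚ_[p]) -
        (x - (((a : ℚ) / (p : ℚ) ^ k : ℚ) : ℚ_[p])) := by push_cast; ring
    rwa [e])
  rw [hz] at key
  have h3 : (a : ℚ) / (p : ℚ) ^ k = fracPart x + z := by linarith
  rw [psi, h3, Complex.exp_eq_exp_iff_exists_int]
  exact ⟨z, by push_cast; ring⟩

theorem exists_int_div_pow_near (x : ℚ_[p]) :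
    ∃ (b : ℤ) (l : ℕ), ‖x - (((b : ℚ) / (p : ℚ) ^ l : ℚ) : ℚ_[p])‖ ≤ 1 :=
  ⟨PadicInt.appr ⟨x * (p : ℚ_[p]) ^ poleOrder x, norm_mul_pow_poleOrder_le_one x⟩
      (poleOrder x), poleOrder x, by simpa [fracPart] using norm_sub_fracPart_le_one x⟩

theorem psi_add (x y : ℚ_[p]) : psi (x + y) = psi x * psi y := by
  have hp' : (p : ℚ) ≠ 0 := by exact_mod_cast (Fact.out : p.Prime).ne_zero
  obtain ⟨a, k, h1⟩ := exists_int_div_pow_near x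
  obtain ⟨b, l, h2⟩ := exists_int_div_pow_near y
  have e : ((a * p ^ l + b * p ^ k : ℤ) : ℚ) / (p : ℚ) ^ (k + l) =
      (a : ℚ) / (p : ℚ) ^ k + (b : ℚ) / (p : ℚ) ^ l := by
    rw [pow_add]; push_cast; field_simp
  rw [psi_eq_of_norm_sub_le x a k h1, psi_eq_of_norm_sub_le y b l h2,
    psi_eq_of_norm_sub_le (x + y) (a * p ^ l + b * p ^ k) (k + l), e, ← Complex.exp_add]
  · congr 1; push_cast; ring
  · rw [e]
    refine le_trans (le_of_eq ?_) ((IsUltrametricDist.norm_add_le_max _ _).trans (max_le h1 h2))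
    congr 1; push_cast; ring

theorem psi_eq_one_iff (x : ℚ_[p]) : psi x = 1 ↔ ‖x‖ ≤ 1 := by
  constructor
  · intro h
    rw [psi, Complex.exp_eq_one_iff] at h
    obtain ⟨n, hn⟩ := h
    have h0 : (2 * Real.pi * Complex.I : ℂ) ≠ 0 := Complex.two_pi_I_ne_zero
    have h1 : (fracPart x : ℂ) = ((-n : ℤ) : ℂ) := by
      apply mul_left_cancel₀ h0
      push_cast
      linear_combination -hn
    have h2 : fracPart x = ((-n : ℤ) : ℚ) := by exact_mod_cast h1
    have h3 := norm_sub_fracPart_le_one x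
    rw [h2] at h3
    have h4 : ‖((((-n : ℤ) : ℚ)) : ℚ_[p])‖ ≤ 1 := by
      simpa using Padic.norm_int_le_one (p := p) n
    have := (IsUltrametricDist.norm_add_le_max _ _).trans (max_le h3 h4)
    simpa using this
  · intro h
    rw [psi_eq_of_norm_sub_le x 0 0 (by simpa using h)]
    simp

@[simp] theorem psi_zero : psi (0 : ℚ_[p]) = 1 := (psi_eq_one_iff 0).2 (by simp)

theorem norm_psi (x : ℚ_[p]) : ‖psi x‖ = 1 := by
  rw [psi, Complex.norm_exp]
  simp

theorem psi_add_of_norm_le (x y : ℚ_[p]) (h : ‖y‖ ≤ 1) : psi (x + y) = psi x := by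
  rw [psi_add, (psi_eq_one_iff y).2 h, mul_one]

theorem continuous_psi : Continuous (psi : ℚ_[p] → ℂ) := by
  rw [continuous_iff_continuousAt]
  intro x
  have : (fun _ => psi x) =ᶠ[nhds x] (psi : ℚ_[p] → ℂ) := by
    filter_upwards [Metric.closedBall_mem_nhds x one_pos] with y hy
    rw [Metric.mem_closedBall, dist_eq_norm] at hy
    rw [← psi_add_of_norm_le x (y - x) hy]
    congr 1; ring
  exact continuousAt_const.congr this

@[fun_prop] theorem measurable_psi : Measurable (psi : ℚ_[p] → ℂ) := continuous_psi.measurable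

end AdditiveCharacter

/-! ### Haar measure on `ℚ_p` and its scaling. -/

section Volume

variable {p : ℕ} [Fact p.Prime]

instance : (volume : Measure ℚ_[p]).IsAddHaarMeasure :=
  Measure.isAddHaarMeasure_addHaarMeasure _

theorem volume_closedBall_one (x : ℚ_[p]) : volume (Metric.closedBall x 1) = 1 := by
  have h : volume (Metric.closedBall (0 : ℚ_[p]) 1) = 1 :=
    Measure.addHaarMeasure_self (K₀ := unitBall p)
  rw [← h]
  exact Measure.addHaar_closedBall_center volume x 1

theorem closedBall_zero_one_eq_biUnion :
    Metric.closedBall (0 : ℚ_[p]) 1 =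
      ⋃ i ∈ Finset.range p, Metric.closedBall (i : ℚ_[p]) (p : ℝ)⁻¹ := by
  have hp := one_lt_prime_cast (p := p)
  ext x
  simp only [Set.mem_iUnion, Finset.mem_range, exists_prop, Metric.mem_closedBall, dist_eq_norm,
    sub_zero]
  constructor
  · intro hx
    obtain ⟨n, hn, h⟩ := PadicInt.exists_mem_range (⟨x, hx⟩ : ℤ_[p])
    refine ⟨n, hn, ?_⟩
    rw [PadicInt.maximalIdeal_eq_span_p, ← pow_one (p : ℤ_[p]),
      ← PadicInt.norm_le_pow_iff_mem_span_pow] at h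
    rw [PadicInt.norm_def] at h
    push_cast at h
    refine h.trans (le_of_eq ?_)
    norm_num
  · rintro ⟨n, -, h⟩
    have h1 : ‖(n : ℚ_[p])‖ ≤ 1 := by simpa using Padic.norm_int_le_one (p := p) n
    have := (IsUltrametricDist.norm_add_le_max (x - n) (n : ℚ_[p])).trans
      (max_le (h.trans (inv_le_one_of_one_le₀ hp.le)) h1)
    simpa using this

theorem volume_closedBall_inv_prime :
    volume (Metric.closedBall (0 : ℚ_[p]) (p : ℝ)⁻¹) = (p : ENNReal)⁻¹ := by
  have hp := one_lt_prime_cast (p := p)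
  have h := volume_closedBall_one (0 : ℚ_[p])
  rw [closedBall_zero_one_eq_biUnion, measure_biUnion_finset] at h
  · simp only [Measure.addHaar_closedBall_center volume (_ : ℚ_[p]) (p : ℝ)⁻¹, Finset.sum_const,
      Finset.card_range, nsmul_eq_mul] at h
    exact ENNReal.eq_inv_of_mul_eq_one_left (by rwa [mul_comm])
  · intro i hi j hj hij
    rw [Function.onFun, Set.disjoint_left]
    intro x hx hy
    rw [Metric.mem_closedBall, dist_eq_norm] at hx hy
    have h1 : ‖(((i : ℤ) - (j : ℤ) : ℤ) : ℚ_[p])‖ ≤ (p : ℝ) ^ (-(1 : ℕ) : ℤ) := by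
      have := (padic_norm_sub_le_max (x - (j : ℚ_[p])) (x - (i : ℚ_[p]))).trans (max_le hy hx)
      simpa using this
    rw [Padic.norm_int_le_pow_iff_dvd] at h1
    simp only [Finset.coe_range, Set.mem_Iio] at hi hj
    rw [pow_one] at h1
    apply hij
    have := Int.eq_zero_of_abs_lt_dvd h1 (by rw [abs_lt]; constructor <;> omega)
    omega
  · intro i _
    exact Metric.isClosed_closedBall.measurableSet

/-- Multiplication by a non-zero element as an automorphism of the additive group. -/
def mulEquivAdd (a : ℚ_[p]) (ha : a ≠ 0) : ℚ_[p] ≃ₜ+ ℚ_[p] where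
  toFun x := a * x
  invFun x := a⁻¹ * x
  left_inv x := by field_simp
  right_inv x := by field_simp
  map_add' x y := mul_add _ _ _
  continuous_toFun := by fun_prop
  continuous_invFun := by fun_prop

theorem preimage_mul_closedBall (a : ℚ_[p]) (ha : a ≠ 0) (r : ℝ) :
    (fun x => a * x) ⁻¹' Metric.closedBall 0 r = Metric.closedBall 0 (‖a‖⁻¹ * r) := by
  ext x
  simp only [Set.mem_preimage, Metric.mem_closedBall, dist_zero_right, norm_mul]
  rw [le_inv_mul_iff₀ (norm_pos_iff.2 ha)]

theorem addHaarChar_mulEquivAdd_unit (a : ℚ_[p]) (ha : a ≠ 0) (h : ‖a‖ = 1) :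
    addEquivAddHaarChar (mulEquivAdd a ha) = 1 := by
  have := addEquivAddHaarChar_smul_preimage (volume : Measure ℚ_[p])
    (X := Metric.closedBall 0 1) (mulEquivAdd a ha)
  rw [show (⇑(mulEquivAdd a ha)) = fun x => a * x from rfl, preimage_mul_closedBall a ha, h,
    inv_one, one_mul, volume_closedBall_one, ENNReal.smul_def, smul_eq_mul, mul_one] at this
  exact_mod_cast this

theorem addHaarChar_mulEquivAdd_prime (hp0 : (p : ℚ_[p]) ≠ 0) :
    addEquivAddHaarChar (mulEquivAdd (p : ℚ_[p]) hp0) = (p : NNReal)⁻¹ := by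
  have hp := prime_cast_pos (p := p)
  have := addEquivAddHaarChar_smul_preimage (volume : Measure ℚ_[p])
    (X := Metric.closedBall 0 (p : ℝ)⁻¹) (mulEquivAdd (p : ℚ_[p]) hp0)
  rw [show (⇑(mulEquivAdd (p : ℚ_[p]) hp0)) = fun x => (p : ℚ_[p]) * x from rfl,
    preimage_mul_closedBall _ hp0, Padic.norm_p, inv_inv, mul_inv_cancel₀ hp.ne',
    volume_closedBall_one, volume_closedBall_inv_prime, ENNReal.smul_def, smul_eq_mul,
    mul_one] at this
  have h2 : ((p : NNReal)⁻¹ : NNReal) = (p : ENNReal)⁻¹ := by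
    rw [ENNReal.coe_inv (by exact_mod_cast (Fact.out : p.Prime).ne_zero)]; simp
  rw [← h2] at this
  exact_mod_cast this

theorem addHaarChar_mulEquivAdd_mul (a b : ℚ_[p]) (ha : a ≠ 0) (hb : b ≠ 0) :
    addEquivAddHaarChar (mulEquivAdd (a * b) (mul_ne_zero ha hb)) =
      addEquivAddHaarChar (mulEquivAdd a ha) * addEquivAddHaarChar (mulEquivAdd b hb) := by
  rw [mul_comm (addEquivAddHaarChar _), ← addEquivAddHaarChar_trans]
  congr 1
  ext x
  exact mul_assoc a b x

theorem addHaarChar_mulEquivAdd_prime_pow (n : ℕ) (hp0 : (p : ℚ_[p]) ^ n ≠ 0) :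
    addEquivAddHaarChar (mulEquivAdd ((p : ℚ_[p]) ^ n) hp0) = (p : NNReal)⁻¹ ^ n := by
  have hp1 : (p : ℚ_[p]) ≠ 0 := by exact_mod_cast (Fact.out : p.Prime).ne_zero
  induction n with
  | zero => simpa using addHaarChar_mulEquivAdd_unit (1 : ℚ_[p]) one_ne_zero norm_one
  | succ n ih =>
    simp only [pow_succ]
    rw [addHaarChar_mulEquivAdd_mul _ _ (pow_ne_zero n hp1) hp1, ih,
      addHaarChar_mulEquivAdd_prime]

/-- Both sides are multiplicative in `a`, so it is enough to know units, which preserve `ℤ_p`, and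
`p`, which carries `ℤ_p` onto a ball of volume `1 / p`. -/
theorem addHaarChar_mulEquivAdd (a : ℚ_[p]) (ha : a ≠ 0) :
    addEquivAddHaarChar (mulEquivAdd a ha) = ‖a‖₊ := by
  have hp1 : (p : ℚ_[p]) ≠ 0 := by exact_mod_cast (Fact.out : p.Prime).ne_zero
  have hp := prime_cast_pos (p := p)
  have key : ∀ (b c : ℚ_[p]) (hb : b ≠ 0) (hc : c ≠ 0) (n : ℕ), b = c * (p : ℚ_[p]) ^ n →
      ‖c‖ = 1 → addEquivAddHaarChar (mulEquivAdd b hb) = (p : NNReal)⁻¹ ^ n := by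
    rintro b c hb hc n rfl h
    rw [addHaarChar_mulEquivAdd_mul _ _ hc (pow_ne_zero n hp1),
      addHaarChar_mulEquivAdd_unit c hc h, one_mul, addHaarChar_mulEquivAdd_prime_pow]
  have hn : ‖a‖ = (p : ℝ) ^ (-a.valuation) := Padic.norm_eq_zpow_neg_valuation ha
  have hpn : (p : NNReal) ≠ 0 := by exact_mod_cast (Fact.out : p.Prime).ne_zero
  have hna : ‖a‖₊ = (p : NNReal) ^ (-a.valuation) := by
    apply NNReal.coe_injective; push_cast; exact hn
  have hnp : ‖(p : ℚ_[p])‖ = (p : ℝ)⁻¹ := Padic.norm_p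
  rcases le_total 0 a.valuation with h | h
  · obtain ⟨n, hv⟩ := Int.eq_ofNat_of_zero_le h
    rw [hv] at hna hn
    rw [key a (a / (p : ℚ_[p]) ^ n) ha (div_ne_zero ha (pow_ne_zero n hp1)) n
      (by field_simp) (by rw [norm_div, norm_pow, hnp, hn]; simp [field]), hna]
    simp
  · obtain ⟨n, hv⟩ := Int.eq_ofNat_of_zero_le (neg_nonneg.2 h)
    rw [hv] at hna hn
    -- For negative valuation `-n`, the product `a p ^ n` is a unit, so the modulus of `a` is the
    -- inverse of that of `p ^ n`.
    have h1 := key ((p : ℚ_[p]) ^ n) 1 (pow_ne_zero n hp1) one_ne_zero n (by simp) norm_one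
    have h2 := addHaarChar_mulEquivAdd_mul a ((p : ℚ_[p]) ^ n) ha (pow_ne_zero n hp1)
    rw [h1, addHaarChar_mulEquivAdd_unit _ _ (by
      rw [norm_mul, norm_pow, hnp, hn]; simp [field])] at h2
    rw [hna]
    have h3 : (p : NNReal)⁻¹ ^ n ≠ 0 := pow_ne_zero _ (inv_ne_zero hpn)
    apply mul_right_cancel₀ h3
    rw [← h2, zpow_natCast, inv_pow, mul_inv_cancel₀ (pow_ne_zero _ hpn)]

theorem map_mul_volume (a : ℚ_[p]) (ha : a ≠ 0) :
    (volume : Measure ℚ_[p]).map (fun x => a * x) = ‖a‖₊⁻¹ • volume := by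
  have h := addEquivAddHaarChar_smul_map (volume : Measure ℚ_[p]) (mulEquivAdd a ha)
  rw [addHaarChar_mulEquivAdd] at h
  conv_rhs => rw [← h]
  rw [smul_smul, inv_mul_cancel₀ (by simpa using ha), one_smul]
  rfl

end Volume

/-! ### Fourier transforms of functions constant on the cosets of `1 + p ℤ_p`. -/

section Fourier

variable {p : ℕ} [Fact p.Prime]

theorem volume_closedBall_norm (a : ℚ_[p]) (ha : a ≠ 0) :
    volume (Metric.closedBall (0 : ℚ_[p]) ‖a‖) = ‖a‖₊ := by
  have h := congrArg (fun m => m (Metric.closedBall (0 : ℚ_[p]) ‖a‖)) (map_mul_volume a ha)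
  have hm : Measurable (fun x : ℚ_[p] => a * x) := by fun_prop
  simp only [Measure.smul_apply] at h
  rw [Measure.map_apply hm Metric.isClosed_closedBall.measurableSet, preimage_mul_closedBall a ha,
    inv_mul_cancel₀ (norm_ne_zero_iff.2 ha), volume_closedBall_one, ENNReal.smul_def, smul_eq_mul,
    ENNReal.coe_inv (by simpa using ha)] at h
  have h2 := (mul_comm _ _).trans h.symm
  rw [ENNReal.eq_inv_of_mul_eq_one_left h2, inv_inv]

theorem norm_prime_zpow (k : ℤ) : ‖(p : ℚ_[p]) ^ (-k)‖ = (p : ℝ) ^ k := by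
  rw [norm_zpow, Padic.norm_p, inv_zpow, zpow_neg, inv_inv]

theorem prime_cast_ne_zero : (p : ℚ_[p]) ≠ 0 := by
  exact_mod_cast (Fact.out : p.Prime).ne_zero

theorem volume_real_closedBall_zpow (c : ℚ_[p]) (k : ℤ) :
    volume.real (Metric.closedBall c ((p : ℝ) ^ k)) = (p : ℝ) ^ k := by
  rw [measureReal_def, Measure.addHaar_closedBall_center, ← norm_prime_zpow,
    volume_closedBall_norm _ (zpow_ne_zero _ prime_cast_ne_zero)]
  simp

theorem integral_eq_zero_of_translate {f : ℚ_[p] → ℂ} {c : ℂ} (hc : c ≠ 1) (b : ℚ_[p])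
    (h : ∀ x, f (x + b) = c * f x) : ∫ x, f x = 0 := by
  have h1 := integral_add_right_eq_self (μ := (volume : Measure ℚ_[p])) f b
  simp_rw [h] at h1
  rw [integral_const_mul] at h1
  have : (c - 1) * ∫ x, f x = 0 := by rw [sub_mul, h1, one_mul, sub_self]
  exact (mul_eq_zero.1 this).resolve_left (sub_ne_zero.2 hc)

theorem psi_prime_inv_ne_one : psi ((p : ℚ_[p])⁻¹) ≠ 1 := by
  rw [Ne, psi_eq_one_iff, norm_inv, Padic.norm_p, inv_inv, not_le]
  exact one_lt_prime_cast

theorem norm_add_eq_of_lt {z x : ℚ_[p]} (h : ‖x‖ < ‖z‖) : ‖z + x‖ = ‖z‖ := by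
  rw [Padic.add_eq_max_of_ne h.ne', max_eq_left h.le]

theorem norm_lt_iff_le_zpow {x : ℚ_[p]} {k : ℤ} :
    ‖x‖ < (p : ℝ) ^ k ↔ ‖x‖ ≤ (p : ℝ) ^ (k - 1) := by
  have := Padic.norm_le_pow_iff_norm_lt_pow_add_one x (k - 1)
  rw [sub_add_cancel] at this
  exact this.symm

open Classical in
-- Orthogonality of characters: if `ψ_p(b x)` is not trivial on the ball, translation by `1 / (p x)`
-- preserves the ball and multiplies the integrand by `ψ_p(1 / p) ≠ 1`.
theorem integral_psi_closedBall (k : ℤ) (x : ℚ_[p]) :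
    ∫ b in Metric.closedBall (0 : ℚ_[p]) ((p : ℝ) ^ k), psi (b * x) =
      if ‖x‖ ≤ (p : ℝ) ^ (-k) then (p : ℂ) ^ k else 0 := by
  have hp := prime_cast_pos (p := p)
  split_ifs with h
  · have : ∀ b ∈ Metric.closedBall (0 : ℚ_[p]) ((p : ℝ) ^ k), psi (b * x) = 1 := by
      intro b hb
      rw [psi_eq_one_iff, norm_mul]
      rw [mem_closedBall_zero_iff] at hb
      calc ‖b‖ * ‖x‖ ≤ (p : ℝ) ^ k * (p : ℝ) ^ (-k) := by gcongr
        _ = 1 := by rw [← zpow_add₀ hp.ne']; simp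
    rw [setIntegral_congr_fun Metric.isClosed_closedBall.measurableSet this, setIntegral_const,
      volume_real_closedBall_zpow]
    simp
  · have hx : x ≠ 0 := by
      rintro rfl
      exact h (by simp; positivity)
    have hx' : 0 < ‖x‖ := norm_pos_iff.2 hx
    rw [← integral_indicator Metric.isClosed_closedBall.measurableSet]
    refine integral_eq_zero_of_translate (psi_prime_inv_ne_one (p := p)) ((p : ℚ_[p])⁻¹ * x⁻¹) fun b => ?_
    have hb : ‖(p : ℚ_[p])⁻¹ * x⁻¹‖ ≤ (p : ℝ) ^ k := by
      rw [norm_mul, norm_inv, norm_inv, Padic.norm_p, inv_inv, ← div_eq_mul_inv,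
        div_le_iff₀ hx']
      have h3 : (p : ℝ) ^ (-k + 1) ≤ ‖x‖ := by
        by_contra h4
        rw [not_le, norm_lt_iff_le_zpow, add_sub_cancel_right] at h4
        exact h h4
      calc (p : ℝ) = (p : ℝ) ^ k * (p : ℝ) ^ (-k + 1) := by
            rw [← zpow_add₀ hp.ne']; simp
        _ ≤ _ := by gcongr
    have hmem : b + (p : ℚ_[p])⁻¹ * x⁻¹ ∈ Metric.closedBall (0 : ℚ_[p]) ((p : ℝ) ^ k) ↔
        b ∈ Metric.closedBall (0 : ℚ_[p]) ((p : ℝ) ^ k) := by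
      simp only [mem_closedBall_zero_iff]
      constructor
      · intro h1
        simpa using (padic_norm_sub_le_max _ _).trans (max_le h1 hb)
      · intro h1
        exact (IsUltrametricDist.norm_add_le_max _ _).trans (max_le h1 hb)
    have hpsi : psi ((b + (p : ℚ_[p])⁻¹ * x⁻¹) * x) = psi (p : ℚ_[p])⁻¹ * psi (b * x) := by
      rw [← psi_add]; congr 1; field_simp; ring
    by_cases hb1 : b ∈ Metric.closedBall (0 : ℚ_[p]) ((p : ℝ) ^ k)
    · rw [Set.indicator_of_mem hb1, Set.indicator_of_mem (hmem.2 hb1), hpsi]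
    · rw [Set.indicator_of_notMem hb1, Set.indicator_of_notMem (fun h => hb1 (hmem.1 h)), mul_zero]

/-- Bounded measurable functions on `ℚ_p` with bounded support that are constant on the balls
`z (1 + p ℤ_p)`. -/
structure IsShellConstant (h : ℚ_[p] → ℂ) (R C : ℝ) : Prop where
  measurable : Measurable h
  bound : ∀ z, ‖h z‖ ≤ C
  support : ∀ z, R < ‖z‖ → h z = 0
  add_eq : ∀ z x : ℚ_[p], ‖x‖ < ‖z‖ → h (z + x) = h z

/-- The Fourier transform with respect to `ψ_p`. -/
def fourier (h : ℚ_[p] → ℂ) (b : ℚ_[p]) : ℂ := ∫ z, h z * psi (b * z)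

namespace IsShellConstant

variable {h : ℚ_[p] → ℂ} {R C : ℝ}

theorem integrable (H : IsShellConstant h R C) : Integrable h := by
  have hs : h = (Metric.closedBall 0 R).indicator h := by
    ext z
    by_cases hz : z ∈ Metric.closedBall 0 R
    · rw [Set.indicator_of_mem hz]
    · rw [Set.indicator_of_notMem hz]
      exact H.support z (by simpa using hz)
  rw [hs, integrable_indicator_iff Metric.isClosed_closedBall.measurableSet]
  exact Measure.integrableOn_of_bounded (M := C)
    (isCompact_closedBall (0 : ℚ_[p]) R).measure_lt_top.ne H.measurable.aestronglyMeasurable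
    (Filter.Eventually.of_forall H.bound)

theorem continuous_fourier (H : IsShellConstant h R C) : Continuous (fourier h) := by
  unfold fourier
  refine continuous_of_dominated (bound := fun z => ‖h z‖) ?_ ?_ H.integrable.norm ?_
  · intro b
    exact (H.measurable.mul (measurable_psi.comp (by fun_prop))).aestronglyMeasurable
  · intro b
    exact Filter.Eventually.of_forall fun z => by rw [norm_mul, norm_psi, mul_one]
  · exact Filter.Eventually.of_forall fun z =>
      continuous_const.mul (continuous_psi.comp (by fun_prop))

/-- Outside the ball of radius `p / |b|`, translation by `1 / (p b)` leaves `h` unchanged because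
the shift is smaller than `|z|`, and it multiplies the character by `ψ_p(1 / p) ≠ 1`. That region
therefore contributes nothing. -/
theorem fourier_eq_setIntegral (H : IsShellConstant h R C) {b : ℚ_[p]} (hb : b ≠ 0) :
    fourier h b =
      ∫ z in Metric.closedBall (0 : ℚ_[p]) ‖(p : ℚ_[p])⁻¹ * b⁻¹‖, h z * psi (b * z) := by
  have hint : Integrable fun z => h z * psi (b * z) :=
    H.integrable.mul_bdd (c := 1) ((measurable_psi.comp (by fun_prop)).aestronglyMeasurable)
      (Filter.Eventually.of_forall fun z => (norm_psi _).le)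
  set B := Metric.closedBall (0 : ℚ_[p]) ‖(p : ℚ_[p])⁻¹ * b⁻¹‖ with hB
  have hBm : MeasurableSet B := Metric.isClosed_closedBall.measurableSet
  rw [fourier, ← integral_add_compl hBm hint, add_eq_left, ← integral_indicator hBm.compl]
  refine integral_eq_zero_of_translate (psi_prime_inv_ne_one (p := p)) ((p : ℚ_[p])⁻¹ * b⁻¹) fun z => ?_
  have hmem : z + (p : ℚ_[p])⁻¹ * b⁻¹ ∈ B ↔ z ∈ B := by
    simp only [hB, mem_closedBall_zero_iff]
    constructor
    · intro h1
      simpa using (padic_norm_sub_le_max _ _).trans (max_le h1 le_rfl)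
    · intro h1
      exact (IsUltrametricDist.norm_add_le_max _ _).trans (max_le h1 le_rfl)
  by_cases hz : z ∈ B
  · rw [Set.indicator_of_notMem (by simpa using hmem.2 hz),
      Set.indicator_of_notMem (by simpa using hz), mul_zero]
  · rw [Set.indicator_of_mem (by simpa using fun h => hz (hmem.1 h)),
      Set.indicator_of_mem (by simpa using hz)]
    rw [H.add_eq z _ (by simpa [hB] using hz), mul_add, psi_add]
    rw [show b * ((p : ℚ_[p])⁻¹ * b⁻¹) = (p : ℚ_[p])⁻¹ by field_simp]
    ring

/-- The trivial estimate on a ball of volume `p / |b|`. This decay is what makes the Whittaker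
integral converge absolutely for `Re s > 0`. -/
theorem norm_fourier_le (H : IsShellConstant h R C) {b : ℚ_[p]} (hb : b ≠ 0) :
    ‖fourier h b‖ ≤ C * (p / ‖b‖) := by
  have hne : (p : ℚ_[p])⁻¹ * b⁻¹ ≠ 0 :=
    mul_ne_zero (inv_ne_zero prime_cast_ne_zero) (inv_ne_zero hb)
  rw [H.fourier_eq_setIntegral hb]
  refine (norm_setIntegral_le_of_norm_le_const (C := C)
    (isCompact_closedBall _ _).measure_lt_top fun z _ => ?_).trans (le_of_eq ?_)
  · rw [norm_mul, norm_psi, mul_one]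
    exact H.bound z
  · rw [measureReal_def, volume_closedBall_norm _ hne]
    simp [div_eq_mul_inv]

open Classical in
-- Fubini and orthogonality: integrating `ψ_p(b (z - n))` over `|b| ≤ p ^ k` gives `p ^ k` times the
-- indicator of `n + p ^ k ℤ_p`.
theorem integral_fourier_closedBall (H : IsShellConstant h R C) (k : ℤ) (n : ℚ_[p]) :
    ∫ b in Metric.closedBall (0 : ℚ_[p]) ((p : ℝ) ^ k), fourier h b * psi (-(n * b)) =
      (p : ℂ) ^ k * ∫ z in Metric.closedBall n ((p : ℝ) ^ (-k)), h z := by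
  set B := Metric.closedBall (0 : ℚ_[p]) ((p : ℝ) ^ k)
  have hfin : IsFiniteMeasure (volume.restrict B) :=
    ⟨by rw [Measure.restrict_apply_univ]; exact (isCompact_closedBall _ _).measure_lt_top⟩
  have h1 : ∀ b, fourier h b * psi (-(n * b)) = ∫ z, h z * psi (b * (z - n)) := by
    intro b
    rw [fourier, ← integral_mul_const]
    congr 1
    ext z
    rw [mul_assoc, ← psi_add]
    congr 2; ring
  simp_rw [h1]
  rw [integral_integral_swap]
  · have h2 : ∀ z, ∫ b in B, h z * psi (b * (z - n)) =
        (Metric.closedBall n ((p : ℝ) ^ (-k))).indicator (fun z => (p : ℂ) ^ k * h z) z := by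
      intro z
      rw [integral_const_mul, integral_psi_closedBall]
      by_cases hz : z ∈ Metric.closedBall n ((p : ℝ) ^ (-k))
      · rw [Set.indicator_of_mem hz, if_pos (by simpa [dist_eq_norm] using hz), mul_comm]
      · rw [Set.indicator_of_notMem hz, if_neg (by simpa [dist_eq_norm] using hz), mul_zero]
    simp_rw [h2]
    rw [integral_indicator Metric.isClosed_closedBall.measurableSet, integral_const_mul]
  · have := (H.integrable.comp_snd (volume.restrict B)).mul_bdd (c := 1)
      (g := fun x : ℚ_[p] × ℚ_[p] => psi (x.1 * (x.2 - n)))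
      ((measurable_psi.comp (by fun_prop)).aestronglyMeasurable)
      (Filter.Eventually.of_forall fun z => (norm_psi _).le)
    exact this

/-- A ball about `n` of radius less than `|n|` lies in `n (1 + p ℤ_p)`, where `h` is constant. -/
theorem setIntegral_closedBall_eq (H : IsShellConstant h R C) {k : ℤ} {n : ℚ_[p]}
    (hk : (p : ℝ) ^ (-k) < ‖n‖) :
    (p : ℂ) ^ k * ∫ z in Metric.closedBall n ((p : ℝ) ^ (-k)), h z = h n := by
  have hp := prime_cast_pos (p := p)
  have hc : ∀ z ∈ Metric.closedBall n ((p : ℝ) ^ (-k)), h z = h n := by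
    intro z hz
    rw [Metric.mem_closedBall, dist_eq_norm] at hz
    rw [← H.add_eq n (z - n) (hz.trans_lt hk)]
    congr 1; ring
  rw [setIntegral_congr_fun Metric.isClosed_closedBall.measurableSet hc, setIntegral_const,
    volume_real_closedBall_zpow, Complex.real_smul, ← mul_assoc]
  have hpc : (p : ℂ) ≠ 0 := by exact_mod_cast hp.ne'
  push_cast
  rw [← zpow_add₀ hpc]
  simp

end IsShellConstant

end Fourier

/-! ### The Whittaker integral as a finite sum of ball means. -/

section WhittakerEvaluation

variable {p : ℕ} [Fact p.Prime]

/-- The mean value `p ^ k ∫_{n + p ^ k ℤ_p} h`. -/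
def ballMean (h : ℚ_[p] → ℂ) (n : ℚ_[p]) (k : ℕ) : ℂ :=
  (p : ℂ) ^ (k : ℤ) * ∫ z in Metric.closedBall n ((p : ℝ) ^ (-(k : ℤ))), h z

/-- `D₀ + ∑_{1 ≤ k ≤ M} p ^ (-k s) (D_k - D_{k-1})` for the mean values `D_k` of `h` on the balls
`n + p ^ k ℤ_p`. -/
def whittakerSum (h : ℚ_[p] → ℂ) (n : ℚ_[p]) (M : ℕ) (s : ℂ) : ℂ :=
  ballMean h n 0 + ∑ k ∈ Finset.range M,
    (((p : ℝ) ^ (k + 1) : ℝ) : ℂ) ^ (-s) * (ballMean h n (k + 1) - ballMean h n k)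

theorem differentiable_whittakerSum (h : ℚ_[p] → ℂ) (n : ℚ_[p]) (M : ℕ) :
    Differentiable ℂ (whittakerSum h n M) := by
  have hp := prime_cast_pos (p := p)
  unfold whittakerSum
  refine (differentiable_const _).add (Differentiable.fun_sum fun k _ => ?_)
  refine Differentiable.mul_const ?_ _
  refine Differentiable.const_cpow differentiable_neg (Or.inl ?_)
  exact_mod_cast (pow_pos hp (k + 1)).ne'

theorem whittakerSum_zero (h : ℚ_[p] → ℂ) (n : ℚ_[p]) (M : ℕ) :
    whittakerSum h n M 0 = ballMean h n M := by
  simp only [whittakerSum, neg_zero, Complex.cpow_zero, one_mul]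
  rw [Finset.sum_range_sub (ballMean h n)]
  ring

theorem deriv_whittakerSum (h : ℚ_[p] → ℂ) (n : ℚ_[p]) (M : ℕ) (hM : ballMean h n M = 0) :
    deriv (whittakerSum h n M) 0 =
      (Real.log p : ℂ) * ∑ k ∈ Finset.range M, ballMean h n k := by
  have hp := prime_cast_pos (p := p)
  have hd : HasDerivAt (whittakerSum h n M)
      (0 + ∑ k ∈ Finset.range M, (-(((k + 1 : ℕ) : ℂ) * (Real.log p : ℂ))) *
        (ballMean h n (k + 1) - ballMean h n k)) 0 := by
    unfold whittakerSum
    refine (hasDerivAt_const _ _).add (HasDerivAt.fun_sum fun k _ => ?_)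
    refine HasDerivAt.mul_const ?_ _
    have hk : (((p : ℝ) ^ (k + 1) : ℝ) : ℂ) ≠ 0 := by exact_mod_cast (pow_pos hp (k + 1)).ne'
    have := (hasDerivAt_neg (0 : ℂ)).const_cpow (c := (((p : ℝ) ^ (k + 1) : ℝ) : ℂ)) (Or.inl hk)
    refine this.congr_deriv ?_
    rw [neg_zero, Complex.cpow_zero, ← Complex.ofReal_log (pow_pos hp _).le, Real.log_pow]
    push_cast
    ring
  rw [hd.deriv, zero_add]
  -- Summation by parts; the boundary term is a multiple of `D_M`, which is zero by hypothesis.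
  have key : ∀ M : ℕ, ∑ k ∈ Finset.range M, (-(((k + 1 : ℕ) : ℂ) * (Real.log p : ℂ))) *
        (ballMean h n (k + 1) - ballMean h n k) =
      (Real.log p : ℂ) * ∑ k ∈ Finset.range M, ballMean h n k -
        M * (Real.log p : ℂ) * ballMean h n M := by
    intro M
    induction M with
    | zero => simp
    | succ M ih =>
      rw [Finset.sum_range_succ, ih, Finset.sum_range_succ]
      push_cast
      ring
  rw [key, hM]
  ring

/-- The balls `p ^ (-k) ℤ_p`. -/
def bigBall (p : ℕ) [Fact p.Prime] (k : ℕ) : Set ℚ_[p] :=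
  Metric.closedBall (0 : ℚ_[p]) ((p : ℝ) ^ (k : ℤ))

theorem monotone_bigBall : Monotone (bigBall p) := by
  intro k l hkl
  refine Metric.closedBall_subset_closedBall ?_
  exact zpow_le_zpow_right₀ one_lt_prime_cast.le (by exact_mod_cast hkl)

theorem measurableSet_bigBall (k : ℕ) : MeasurableSet (bigBall p k) :=
  Metric.isClosed_closedBall.measurableSet

theorem iUnion_bigBall : ⋃ k, bigBall p k = Set.univ := by
  rw [Set.eq_univ_iff_forall]
  intro x
  obtain ⟨k, hk⟩ := pow_unbounded_of_one_lt ‖x‖ (one_lt_prime_cast (p := p))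
  rw [Set.mem_iUnion]
  refine ⟨k, ?_⟩
  rw [bigBall, mem_closedBall_zero_iff, zpow_natCast]
  exact hk.le

theorem norm_of_mem_disjointed {k : ℕ} {b : ℚ_[p]} (hb : b ∈ disjointed (bigBall p) (k + 1)) :
    ‖b‖ = (p : ℝ) ^ (k + 1) := by
  rw [monotone_bigBall.disjointed_add_one] at hb
  obtain ⟨h1, h2⟩ := hb
  rw [bigBall, mem_closedBall_zero_iff] at h1 h2
  have h3 : ¬ ‖b‖ < (p : ℝ) ^ ((k + 1 : ℕ) : ℤ) := by
    rw [norm_lt_iff_le_zpow]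
    simpa using h2
  have := le_antisymm h1 (not_lt.1 h3)
  rwa [zpow_natCast] at this

namespace IsShellConstant

variable {h : ℚ_[p] → ℂ} {R C : ℝ}

/-- On each shell `|b| = p ^ (k + 1)` the factor `max(1, |b|) ^ (-s)` is constant, and the rest
integrates to the difference of two consecutive ball means. The differences vanish from `M` on, so
only finitely many shells contribute. -/
theorem integral_whittaker (H : IsShellConstant h R C) (n : ℚ_[p]) {M : ℕ}
    (hM : ∀ k, M ≤ k → ballMean h n k = ballMean h n M) {s : ℂ} (hs : 0 < s.re) :
    Integrable (fun b : ℚ_[p] =>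
      fourier h b * psi (-(n * b)) * ((max 1 ‖b‖ : ℝ) : ℂ) ^ (-s)) ∧
    ∫ b : ℚ_[p], fourier h b * psi (-(n * b)) * ((max 1 ‖b‖ : ℝ) : ℂ) ^ (-s) =
      whittakerSum h n M s := by
  have hp := prime_cast_pos (p := p)
  have hp1 := one_lt_prime_cast (p := p)
  have hC : 0 ≤ C := (norm_nonneg _).trans (H.bound 0)
  set G : ℚ_[p] → ℂ := fun b => fourier h b * psi (-(n * b)) with hG
  set F : ℚ_[p] → ℂ := fun b => G b * ((max 1 ‖b‖ : ℝ) : ℂ) ^ (-s) with hF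
  have hGc : Continuous G := H.continuous_fourier.mul (continuous_psi.comp (by fun_prop))
  have hFc : Continuous F := by
    refine hGc.mul (Continuous.cpow (by fun_prop) continuous_const fun b => Or.inl ?_)
    rw [Complex.ofReal_re]
    exact lt_max_of_lt_left one_pos
  set S := disjointed (bigBall p) with hS
  have hSm : ∀ k, MeasurableSet (S k) := fun k => MeasurableSet.disjointed measurableSet_bigBall k
  have hSsub : ∀ k, S k ⊆ bigBall p k := disjointed_subset _
  have hSfin : ∀ k, volume (bigBall p k) < ⊤ := fun k => (isCompact_closedBall _ _).measure_lt_top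
  have hGi : ∀ k, IntegrableOn G (bigBall p k) := fun k =>
    hGc.continuousOn.integrableOn_compact (isCompact_closedBall _ _)
  have hFi : ∀ k, IntegrableOn F (S k) := fun k =>
    (hFc.continuousOn.integrableOn_compact (isCompact_closedBall _ _)).mono_set (hSsub k)
  have hFG : ∀ k, ∀ b ∈ S (k + 1), F b = (((p : ℝ) ^ (k + 1) : ℝ) : ℂ) ^ (-s) * G b := by
    intro k b hb
    simp only [hF]
    rw [norm_of_mem_disjointed hb, max_eq_right (one_le_pow₀ hp1.le), mul_comm]
  have hF0 : ∀ b ∈ S 0, F b = G b := by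
    intro b hb
    have := hSsub 0 hb
    rw [bigBall, mem_closedBall_zero_iff] at this
    simp only [hF]
    rw [max_eq_left (by simpa using this)]
    simp
  have hsum : Summable fun k => ∫ b in S k, ‖F b‖ := by
    rw [← summable_nat_add_iff 1]
    have hr : ((p : ℝ) ^ (-s.re)) < 1 := Real.rpow_lt_one_of_one_lt_of_neg hp1 (by simpa using hs)
    have hg : Summable fun k : ℕ => C * p * (((p : ℝ) ^ (-s.re)) ^ (k + 1)) :=
      ((summable_nat_add_iff 1).2
        (summable_geometric_of_lt_one (Real.rpow_nonneg hp.le _) hr)).mul_left _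
    refine Summable.of_nonneg_of_le (fun k => integral_nonneg fun _ => norm_nonneg _)
      (fun k => ?_) hg
    -- The decay `p / |b|` of the Fourier transform cancels the volume of the shell up to a
    -- constant, leaving a geometric series of ratio `p ^ (-Re s)`.
    have hb : ∀ b ∈ S (k + 1), ‖F b‖ ≤
        C * (p / (p : ℝ) ^ (k + 1)) * ((p : ℝ) ^ (-s.re)) ^ (k + 1) := by
      intro b hb
      have hn := norm_of_mem_disjointed hb
      have hb0 : b ≠ 0 := by
        rintro rfl
        rw [norm_zero] at hn
        exact (pow_pos hp (k + 1)).ne hn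
      rw [hFG k b hb, norm_mul, Complex.norm_cpow_eq_rpow_re_of_pos (pow_pos hp _), mul_comm]
      have e1 : ((p : ℝ) ^ (k + 1)) ^ (-s).re = ((p : ℝ) ^ (-s.re)) ^ (k + 1) := by
        rw [← Real.rpow_natCast, ← Real.rpow_mul hp.le, ← Real.rpow_natCast, ← Real.rpow_mul hp.le,
          mul_comm, Complex.neg_re]
      rw [e1]
      gcongr
      simp only [hG]
      rw [norm_mul, norm_psi, mul_one, ← hn]
      exact H.norm_fourier_le hb0
    calc ∫ b in S (k + 1), ‖F b‖
        ≤ ∫ b in S (k + 1), C * (p / (p : ℝ) ^ (k + 1)) * ((p : ℝ) ^ (-s.re)) ^ (k + 1) :=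
          setIntegral_mono_on (hFi _).norm (integrableOn_const
            ((measure_mono (hSsub _)).trans_lt (hSfin _)).ne) (hSm _) hb
      _ = volume.real (S (k + 1)) *
            (C * (p / (p : ℝ) ^ (k + 1)) * ((p : ℝ) ^ (-s.re)) ^ (k + 1)) := by
          rw [setIntegral_const, smul_eq_mul]
      _ ≤ (p : ℝ) ^ (k + 1) *
            (C * (p / (p : ℝ) ^ (k + 1)) * ((p : ℝ) ^ (-s.re)) ^ (k + 1)) := by
          gcongr
          have := measureReal_mono (μ := volume) (hSsub (k + 1)) (hSfin _).ne
          rw [bigBall, volume_real_closedBall_zpow, zpow_natCast] at this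
          exact this
      _ = C * p * (((p : ℝ) ^ (-s.re)) ^ (k + 1)) := by field_simp
  have hU : ⋃ k, S k = Set.univ := by rw [hS, iUnion_disjointed, iUnion_bigBall]
  have hint : IntegrableOn F (⋃ k, S k) := integrableOn_iUnion_of_summable_integral_norm hFi hsum
  have hball : ∀ k : ℕ, ∫ b in bigBall p k, G b = ballMean h n k := fun k =>
    H.integral_fourier_closedBall k n
  have hshell : ∀ k : ℕ, ∫ b in S (k + 1), F b =
      (((p : ℝ) ^ (k + 1) : ℝ) : ℂ) ^ (-s) * (ballMean h n (k + 1) - ballMean h n k) := by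
    intro k
    rw [setIntegral_congr_fun (hSm _) (hFG k), integral_const_mul, ← hball, ← hball, hS,
      monotone_bigBall.disjointed_add_one, setIntegral_sdiff (measurableSet_bigBall k) (hGi _)
        (monotone_bigBall (Nat.le_add_right k 1))]
  have hshell0 : ∫ b in S 0, F b = ballMean h n 0 := by
    rw [setIntegral_congr_fun (hSm _) hF0, ← hball, hS, disjointed_zero]
  have hhs := hasSum_integral_iUnion hSm (disjoint_disjointed _) hint
  rw [hU] at hint hhs
  rw [integrableOn_univ] at hint
  rw [Measure.restrict_univ] at hhs
  refine ⟨hint, hhs.unique ?_⟩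
  have hfin := hasSum_sum_of_ne_finset_zero (L := .unconditional ℕ) (f := fun k => ∫ b in S k, F b)
    (s := Finset.range (M + 1)) (by
      intro k hk
      rw [Finset.mem_range, not_lt] at hk
      obtain ⟨j, rfl⟩ : ∃ j, k = j + 1 := ⟨k - 1, by omega⟩
      rw [hshell, hM (j + 1) (by omega), hM j (by omega), sub_self, mul_zero])
  rw [Finset.sum_range_succ', hshell0] at hfin
  simp only [hshell] at hfin
  rw [whittakerSum, add_comm (ballMean h n 0)]
  exact hfin

end IsShellConstant

end WhittakerEvaluation

/-! ### The density of a measure invariant under `1 + p ℤ_p`. -/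

section Density

variable {p : ℕ} [Fact p.Prime]

/-- For `z ≠ 0` the open ball of radius `|z|` about `z` is the coset `z (1 + p ℤ_p)`, so the
relation is an equivalence on nonzero elements; for `z = 0` the ball is empty. -/
theorem mem_ball_norm_comm {y z : ℚ_[p]} :
    y ∈ Metric.ball z ‖z‖ ↔ z ∈ Metric.ball y ‖y‖ := by
  have key : ∀ a b : ℚ_[p], a ∈ Metric.ball b ‖b‖ → b ∈ Metric.ball a ‖a‖ := by
    intro a b h
    rw [Metric.mem_ball, dist_eq_norm] at h ⊢
    have := norm_add_eq_of_lt h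
    rw [add_sub_cancel] at this
    rwa [this, norm_sub_rev]
  exact ⟨key y z, key z y⟩

theorem norm_eq_of_mem_ball_norm {y z : ℚ_[p]} (h : y ∈ Metric.ball z ‖z‖) : ‖y‖ = ‖z‖ := by
  rw [Metric.mem_ball, dist_eq_norm] at h
  have := norm_add_eq_of_lt h
  rwa [add_sub_cancel] at this

theorem mul_mem_ball_norm_iff {y w : ℚ_[p]} (hy : y ≠ 0) :
    y * w ∈ Metric.ball y ‖y‖ ↔ w ∈ Metric.ball (1 : ℚ_[p]) 1 := by
  rw [Metric.mem_ball, Metric.mem_ball, dist_eq_norm, dist_eq_norm,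
    show y * w - y = y * (w - 1) by ring, norm_mul]
  exact mul_lt_iff_lt_one_right (norm_pos_iff.2 hy)

theorem ball_eq_closedBall (z : ℚ_[p]) (k : ℤ) :
    Metric.ball z ((p : ℝ) ^ k) = Metric.closedBall z ((p : ℝ) ^ (k - 1)) := by
  ext x
  rw [Metric.mem_ball, Metric.mem_closedBall, dist_eq_norm, norm_lt_iff_le_zpow]

theorem volume_ball_one_one : volume (Metric.ball (1 : ℚ_[p]) 1) = (p : ENNReal)⁻¹ := by
  have := ball_eq_closedBall (1 : ℚ_[p]) 0
  rw [zpow_zero] at this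
  rw [this, Measure.addHaar_closedBall_center, ← volume_closedBall_inv_prime]
  norm_num

theorem lintegral_eq_mul_lintegral_mul {y : ℚ_[p]} (hy : y ≠ 0) {f : ℚ_[p] → ENNReal}
    (hf : Measurable f) : ∫⁻ z, f z = ‖y‖₊ * ∫⁻ w, f (y * w) := by
  have h1 : ∫⁻ w, f (y * w) = ∫⁻ z, f z ∂((volume : Measure ℚ_[p]).map (fun x => y * x)) :=
    (lintegral_map hf (by fun_prop)).symm
  have hy' : ‖y‖₊ ≠ 0 := by simpa using hy
  rw [h1, map_mul_volume y hy, lintegral_smul_measure, ENNReal.smul_def, smul_eq_mul, ← mul_assoc,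
    ← ENNReal.coe_mul, mul_inv_cancel₀ hy', ENNReal.coe_one, one_mul]

theorem integral_mul_left_eq {y : ℚ_[p]} (hy : y ≠ 0) (f : ℚ_[p] → ℂ) :
    ∫ w, f (y * w) = (‖y‖⁻¹ : ℝ) * ∫ z, f z := by
  have e : MeasurableEmbedding (fun x : ℚ_[p] => y * x) :=
    (Homeomorph.mulLeft₀ y hy).measurableEmbedding
  rw [← e.integral_map, map_mul_volume y hy, integral_smul_nnreal_measure]
  simp [NNReal.smul_def]

/-- The density of a measure on `ℚ_p` that is invariant under multiplication by `1 + p ℤ_p`. -/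
def shellDensity (ρ : Measure ℚ_[p]) (z : ℚ_[p]) : ENNReal :=
  p * (‖z‖₊ : ENNReal)⁻¹ * ρ (Metric.ball z ‖z‖)

theorem measurableSet_shellRel :
    MeasurableSet {x : ℚ_[p] × ℚ_[p] | x.2 ∈ Metric.ball x.1 ‖x.1‖} := by
  simp only [Metric.mem_ball]
  exact measurableSet_lt (by fun_prop) (by fun_prop)

theorem measurable_shellDensity (ρ : Measure ℚ_[p]) [SFinite ρ] : Measurable (shellDensity ρ) := by
  refine (measurable_const.mul (by fun_prop)).mul ?_
  exact measurable_measure_prodMk_left (ν := ρ) measurableSet_shellRel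

/-- Averaging `ρ(S)` over multiplications by `w ∈ 1 + p ℤ_p` does not change it. Exchanging the two
integrations and substituting `z = y w` turns this average into the integral of `shellDensity` over
`S`. -/
theorem withDensity_shellDensity (ρ : Measure ℚ_[p]) [IsFiniteMeasure ρ] (h0 : ρ {0} = 0)
    (hinv : ∀ w ∈ Metric.ball (1 : ℚ_[p]) 1, ρ.map (fun x => w * x) = ρ) :
    volume.withDensity (shellDensity ρ) = ρ := by
  ext S hS
  rw [withDensity_apply _ hS, ← lintegral_indicator hS]
  set T : Set (ℚ_[p] × ℚ_[p]) := {x | x.2 ∈ Metric.ball x.1 ‖x.1‖} with hT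
  have hTm : MeasurableSet T := measurableSet_shellRel
  have h1 : ∀ z, S.indicator (shellDensity ρ) z =
      ∫⁻ y, S.indicator (fun z => p * (‖z‖₊ : ENNReal)⁻¹) z * T.indicator 1 (z, y) ∂ρ := by
    intro z
    rw [lintegral_const_mul _ (by
      exact (measurable_one.indicator hTm).comp measurable_prodMk_left)]
    have : ∫⁻ y, T.indicator 1 (z, y) ∂ρ = ρ (Metric.ball z ‖z‖) := by
      rw [← lintegral_indicator_one measurableSet_ball]
      rfl
    rw [this]
    by_cases hz : z ∈ S
    · rw [Set.indicator_of_mem hz, Set.indicator_of_mem hz]; rfl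
    · rw [Set.indicator_of_notMem hz, Set.indicator_of_notMem hz, zero_mul]
  have hSd : Measurable (S.indicator (fun z : ℚ_[p] => (p : ENNReal) * (‖z‖₊ : ENNReal)⁻¹)) :=
    (measurable_const.mul (by fun_prop)).indicator hS
  have hmeas : Measurable (Function.uncurry fun z y : ℚ_[p] =>
      S.indicator (fun z => (p : ENNReal) * (‖z‖₊ : ENNReal)⁻¹) z * T.indicator 1 (z, y)) :=
    (hSd.comp measurable_fst).mul (measurable_one.indicator hTm)
  simp_rw [h1]
  rw [lintegral_lintegral_swap hmeas.aemeasurable]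
  -- For fixed `y ≠ 0` substitute `z = y w`: the coset condition becomes `w ∈ 1 + p ℤ_p`, and there
  -- `|z| = |y|` cancels the Jacobian. The point `y = 0` is negligible by `h0`.
  have h2 : ∀ᵐ y ∂ρ, ∫⁻ z, S.indicator (fun z => p * (‖z‖₊ : ENNReal)⁻¹) z * T.indicator 1 (z, y) =
      ∫⁻ w, p * ((Metric.ball (1 : ℚ_[p]) 1).indicator 1 w * S.indicator 1 (w * y)) := by
    have : ∀ᵐ y ∂ρ, y ≠ 0 := by
      rw [ae_iff]; simpa using h0
    filter_upwards [this] with y hy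
    rw [lintegral_eq_mul_lintegral_mul hy (by
      exact hSd.mul ((measurable_one.indicator hTm).comp measurable_prodMk_right)),
      ← lintegral_const_mul]
    · congr 1
      ext w
      by_cases hw : w ∈ Metric.ball (1 : ℚ_[p]) 1
      · have hm := (mul_mem_ball_norm_iff hy).2 hw
        have hnorm := norm_eq_of_mem_ball_norm hm
        rw [Set.indicator_of_mem hw, Set.indicator_of_mem (show (y * w, y) ∈ T from
          mem_ball_norm_comm.1 hm), mul_comm w y]
        by_cases hs : y * w ∈ S
        · rw [Set.indicator_of_mem hs, Set.indicator_of_mem hs]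
          have : ‖y * w‖₊ = ‖y‖₊ := NNReal.eq hnorm
          rw [this]
          simp only [Pi.one_apply, mul_one]
          rw [mul_comm, mul_assoc, ENNReal.inv_mul_cancel (by simpa using hy) (by simp), mul_one]
        · rw [Set.indicator_of_notMem hs, Set.indicator_of_notMem hs]
          simp
      · rw [Set.indicator_of_notMem hw, Set.indicator_of_notMem (show (y * w, y) ∉ T from fun hm =>
          hw ((mul_mem_ball_norm_iff hy).1 (mem_ball_norm_comm.1 hm)))]
        simp
    · exact (hSd.mul ((measurable_one.indicator hTm).comp measurable_prodMk_right)).comp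
        (by fun_prop)
  rw [lintegral_congr_ae h2, lintegral_lintegral_swap]
  · have h3 : ∀ w, ∫⁻ y, p * ((Metric.ball (1 : ℚ_[p]) 1).indicator 1 w *
        S.indicator 1 (w * y)) ∂ρ =
        (Metric.ball (1 : ℚ_[p]) 1).indicator (fun _ => p * ρ S) w := by
      intro w
      have hmS : Measurable (S.indicator (1 : ℚ_[p] → ENNReal)) := measurable_one.indicator hS
      have hmw : Measurable (fun y : ℚ_[p] => w * y) := by fun_prop
      rw [lintegral_const_mul _ (by exact measurable_const.mul (hmS.comp hmw)),
        lintegral_const_mul _ (by exact hmS.comp hmw)]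
      by_cases hw : w ∈ Metric.ball (1 : ℚ_[p]) 1
      · rw [Set.indicator_of_mem hw, Set.indicator_of_mem hw, ← lintegral_map hmS hmw,
          hinv w hw, lintegral_indicator_one hS]
        simp
      · rw [Set.indicator_of_notMem hw, Set.indicator_of_notMem hw]
        simp
    simp_rw [h3]
    rw [lintegral_indicator measurableSet_ball, setLIntegral_const, volume_ball_one_one]
    rw [mul_comm (p : ENNReal), mul_assoc, ENNReal.mul_inv_cancel
      (by exact_mod_cast (Fact.out : p.Prime).ne_zero) (by simp), mul_one]
  · refine Measurable.aemeasurable ?_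
    refine measurable_const.mul (Measurable.mul ?_ ?_)
    · exact (measurable_one.indicator measurableSet_ball).comp measurable_snd
    · exact (measurable_one.indicator hS).comp (by fun_prop)

theorem integral_eq_integral_shellDensity (ρ : Measure ℚ_[p]) [IsFiniteMeasure ρ] (h0 : ρ {0} = 0)
    (hinv : ∀ w ∈ Metric.ball (1 : ℚ_[p]) 1, ρ.map (fun x => w * x) = ρ) (f : ℚ_[p] → ℂ) :
    ∫ z, f z ∂ρ = ∫ z, ((shellDensity ρ z).toReal : ℂ) * f z := by
  conv_lhs => rw [← withDensity_shellDensity ρ h0 hinv]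
  rw [integral_withDensity_eq_integral_toReal_smul (measurable_shellDensity ρ)]
  · simp
  · have : ∀ᵐ z : ℚ_[p], z ≠ 0 := by
      rw [ae_iff]; simp
    filter_upwards [this] with z hz
    refine ENNReal.mul_lt_top (ENNReal.mul_lt_top (by simp) ?_) (measure_lt_top _ _)
    rw [ENNReal.inv_lt_top]
    simpa using hz

end Density

/-! ### Norm and trace in algebras of rank two. -/

section QuadraticAlgebra

variable {k A : Type*} [Field k] [CommRing A] [Algebra k A]

theorem norm_algebraMap_add_of_finrank_two (hA : Module.finrank k A = 2) (a : k) (x : A) :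
    Algebra.norm k (algebraMap k A a + x) =
      a ^ 2 + a * Algebra.trace k A x + Algebra.norm k x := by
  have : Module.Finite k A := Module.finite_of_finrank_pos (by omega)
  let b := Module.finBasisOfFinrankEq k A hA
  rw [Algebra.norm_eq_matrix_det b, Algebra.norm_eq_matrix_det b, Algebra.trace_eq_matrix_trace b,
    map_add, AlgHom.commutes, Matrix.det_fin_two, Matrix.det_fin_two, Matrix.trace_fin_two]
  simp [Matrix.algebraMap_matrix_apply]
  ring

/-- Cayley–Hamilton for the matrix of multiplication by `x`. -/
theorem sq_eq_of_finrank_two (hA : Module.finrank k A = 2) (x : A) :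
    x ^ 2 = algebraMap k A (Algebra.trace k A x) * x - algebraMap k A (Algebra.norm k x) := by
  have : Module.Finite k A := Module.finite_of_finrank_pos (by omega)
  let b := Module.finBasisOfFinrankEq k A hA
  apply Algebra.leftMulMatrix_injective b
  rw [map_sub, map_mul, AlgHom.commutes, AlgHom.commutes, Algebra.norm_eq_matrix_det b,
    Algebra.trace_eq_matrix_trace b, map_pow, Matrix.det_fin_two, Matrix.trace_fin_two, pow_two]
  ext i j
  fin_cases i <;> fin_cases j <;>
    simp [Matrix.algebraMap_matrix_apply, Matrix.mul_apply, Fin.sum_univ_two] <;> ring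

theorem trace_one_of_finrank_two (hA : Module.finrank k A = 2) : Algebra.trace k A 1 = 2 := by
  have : Module.Finite k A := Module.finite_of_finrank_pos (by omega)
  have := Algebra.trace_algebraMap (S := A) (1 : k)
  rw [map_one, hA] at this
  simpa using this

theorem norm_smul_of_finrank_two (hA : Module.finrank k A = 2) (a : k) (x : A) :
    Algebra.norm k (a • x) = a ^ 2 * Algebra.norm k x := by
  have : Module.Finite k A := Module.finite_of_finrank_pos (by omega)
  rw [Algebra.smul_def, map_mul, Algebra.norm_algebraMap, hA]

/-- Polarization of `2 N(z) = Tr(z)² - Tr(z²)`, which is the trace of the characteristic equation.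
-/
theorem norm_add_of_finrank_two (hA : Module.finrank k A = 2) (h2 : (2 : k) ≠ 0) (x y : A) :
    Algebra.norm k (x + y) = Algebra.norm k x + Algebra.norm k y +
      (Algebra.trace k A x * Algebra.trace k A y - Algebra.trace k A (x * y)) := by
  have key : ∀ z : A, 2 * Algebra.norm k z =
      Algebra.trace k A z ^ 2 - Algebra.trace k A (z ^ 2) := by
    intro z
    have := congrArg (Algebra.trace k A) (sq_eq_of_finrank_two hA z)
    rw [map_sub, ← Algebra.smul_def, map_smul, ← mul_one (algebraMap k A _), ← Algebra.smul_def,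
      map_smul, trace_one_of_finrank_two hA, smul_eq_mul, smul_eq_mul] at this
    linear_combination this
  apply mul_left_cancel₀ h2
  rw [key, mul_add, mul_add, key, key, add_sq]
  simp only [map_add, mul_assoc]
  rw [show (2 : A) * (x * y) = (2 : k) • (x * y) by rw [Algebra.smul_def, map_ofNat], map_smul,
    smul_eq_mul]
  ring

end QuadraticAlgebra

/-! ### The norm form of `k_p` in coordinates, and the Hilbert symbol. -/

section LocalNorm

variable {p : ℕ} [Fact p.Prime] {K : Type*} [Field K] [NumberField K]

theorem finrank_localAlg (hK : Module.finrank ℚ K = 2) :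
    Module.finrank ℚ_[p] (LocalAlg p K) = 2 := by
  rw [Module.finrank_baseChange, hK]

theorem lmul_toLocal (x : K) :
    Algebra.lmul ℚ_[p] (LocalAlg p K) (toLocal p x) =
      LinearMap.baseChange ℚ_[p] (Algebra.lmul ℚ K x) := by
  apply TensorProduct.AlgebraTensorModule.ext
  intro a y
  simp [toLocal]

theorem norm_toLocal (x : K) :
    Algebra.norm ℚ_[p] (toLocal p x) = ((Algebra.norm ℚ x : ℚ) : ℚ_[p]) := by
  rw [Algebra.norm_apply, Algebra.norm_apply, lmul_toLocal, LinearMap.det_baseChange]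
  rfl

theorem trace_toLocal (x : K) :
    Algebra.trace ℚ_[p] (LocalAlg p K) (toLocal p x) = ((Algebra.trace ℚ K x : ℚ) : ℚ_[p]) := by
  rw [Algebra.trace_apply, Algebra.trace_apply, lmul_toLocal, LinearMap.trace_baseChange]
  rfl

variable (p) in
/-- The embedding of `k` into `k_p`. -/
def toLocalHom : K →ₐ[ℚ] LocalAlg p K := Algebra.TensorProduct.includeRight

theorem toLocalHom_apply (x : K) : toLocalHom p x = toLocal p x := rfl

theorem toLocal_add (x y : K) : toLocal p (x + y) = toLocal p x + toLocal p y :=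
  map_add (toLocalHom p) x y

theorem toLocal_mul (x y : K) : toLocal p (x * y) = toLocal p x * toLocal p y :=
  map_mul (toLocalHom p) x y

theorem toLocal_one : toLocal p (1 : K) = 1 := rfl

theorem toLocal_algebraMap (q : ℚ) :
    toLocal p (algebraMap ℚ K q) = algebraMap ℚ_[p] (LocalAlg p K) (q : ℚ_[p]) := by
  rw [← toLocalHom_apply, AlgHom.commutes, IsScalarTower.algebraMap_apply ℚ ℚ_[p] (LocalAlg p K)]
  rfl

theorem toLocal_smul (q : ℚ) (x : K) : toLocal p (q • x) = (q : ℚ_[p]) • toLocal p x := by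
  rw [Algebra.smul_def, toLocal_mul, toLocal_algebraMap, ← Algebra.smul_def]

/-- A quadratic field is generated by a square root of a rational number, which agrees with the
discriminant up to squares. -/
theorem exists_sqrt (hK : Module.finrank ℚ K = 2) :
    ∃ (d q : ℚ) (θ : K), d ≠ 0 ∧ q ≠ 0 ∧ (NumberField.discr K : ℚ) = d * q ^ 2 ∧
      Algebra.trace ℚ K θ = 0 ∧ Algebra.norm ℚ θ = -d ∧
      ∀ x : LocalAlg p K, ∃ a b : ℚ_[p],
        x = algebraMap ℚ_[p] (LocalAlg p K) a + b • toLocal p θ := by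
  obtain ⟨x, hx⟩ : ∃ x : K, x ∉ (algebraMap ℚ K).range := by
    by_contra! h
    have h1 : (⊤ : Subalgebra ℚ K) = ⊥ := by
      rw [eq_comm, eq_top_iff]
      intro x _
      obtain ⟨q, hq⟩ := h x
      exact ⟨q, hq⟩
    have h2 := Subalgebra.bot_eq_top_iff_finrank_eq_one.1 h1.symm
    omega
  set θ : K := x - algebraMap ℚ K (Algebra.trace ℚ K x / 2) with hθ
  have hθr : θ ∉ (algebraMap ℚ K).range := by
    intro h
    apply hx
    have := add_mem h (⟨Algebra.trace ℚ K x / 2, rfl⟩ :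
      algebraMap ℚ K (Algebra.trace ℚ K x / 2) ∈ (algebraMap ℚ K).range)
    simpa [hθ] using this
  have hθ0 : θ ≠ 0 := fun h => hθr (h ▸ zero_mem _)
  have htr : Algebra.trace ℚ K θ = 0 := by
    rw [hθ, map_sub, Algebra.trace_algebraMap, hK]
    simp
    ring
  have hN : Algebra.norm ℚ θ ≠ 0 := by
    rwa [Ne, Algebra.norm_eq_zero_iff]
  have hsq := sq_eq_of_finrank_two hK θ
  rw [htr, map_zero, zero_mul, zero_sub] at hsq
  have hli : LinearIndependent ℚ ![(1 : K), θ] := by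
    rw [LinearIndependent.pair_iff]
    intro s t hst
    have ht : t = 0 := by
      by_contra ht
      apply hθr
      refine ⟨-(s / t), ?_⟩
      have ht' : algebraMap ℚ K t ≠ 0 := by simpa using ht
      rw [Algebra.smul_def, Algebra.smul_def, mul_one] at hst
      rw [map_neg, map_div₀]
      field_simp
      linear_combination -hst
    subst ht
    simp only [zero_smul, add_zero, smul_eq_zero, one_ne_zero, or_false] at hst
    exact ⟨hst, rfl⟩
  let B : Module.Basis (Fin 2) ℚ K :=
    basisOfLinearIndependentOfCardEqFinrank hli (by rw [hK]; rfl)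
  have hB : ⇑B = ![(1 : K), θ] := coe_basisOfLinearIndependentOfCardEqFinrank _ _
  refine ⟨-Algebra.norm ℚ θ, ?_⟩
  have hdisc : Algebra.discr ℚ B = 4 * -Algebra.norm ℚ θ := by
    rw [hB, Algebra.discr_def, Matrix.det_fin_two]
    simp only [Algebra.traceMatrix_apply, Algebra.traceForm_apply, Matrix.cons_val_zero,
      Matrix.cons_val_one, mul_one, one_mul, htr]
    rw [← pow_two θ, hsq, trace_one_of_finrank_two hK, map_neg, Algebra.trace_algebraMap, hK]
    simp
    ring
  have hcard : Fintype.card (Module.Free.ChooseBasisIndex ℤ (𝓞 K)) = 2 := by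
    rw [← Module.finrank_eq_card_basis (NumberField.integralBasis K), hK]
  let e : Module.Free.ChooseBasisIndex ℤ (𝓞 K) ≃ Fin 2 := Fintype.equivFinOfCardEq hcard
  let B' := (NumberField.integralBasis K).reindex e
  have hd' : (NumberField.discr K : ℚ) = Algebra.discr ℚ B' := by
    rw [NumberField.coe_discr, Module.Basis.coe_reindex, Algebra.discr_reindex]
  -- The basis `1, θ` has discriminant `4 d` with `d = -N θ`, and passing to an integral basis
  -- multiplies it by the square of the determinant. Hence `q = 2 det`.
  have hcb := Algebra.discr_of_matrix_vecMul (A := ℚ) (⇑B) (B.toMatrix B')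
  have hB' : Matrix.vecMul (⇑B) ((B.toMatrix B').map (algebraMap ℚ K)) = B' :=
    Module.Basis.toMatrix_map_vecMul B B'
  rw [hB', ← hd', hdisc] at hcb
  have hdet : (B.toMatrix B').det ≠ 0 := by
    intro h
    rw [h] at hcb
    have : (NumberField.discr K : ℚ) ≠ 0 := by exact_mod_cast NumberField.discr_ne_zero K
    apply this
    rw [hcb]; ring
  refine ⟨(B.toMatrix B').det * 2, θ, neg_ne_zero.2 hN, mul_ne_zero hdet two_ne_zero, ?_, htr,
    by rw [neg_neg], ?_⟩
  · rw [hcb]; ring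
  · intro y
    let BL := Algebra.TensorProduct.basis ℚ_[p] B
    refine ⟨BL.repr y 0, BL.repr y 1, ?_⟩
    conv_lhs => rw [← BL.sum_repr y]
    rw [Fin.sum_univ_two, Algebra.TensorProduct.basis_apply, Algebra.TensorProduct.basis_apply, hB]
    simp only [Matrix.cons_val_zero, Matrix.cons_val_one]
    rw [Algebra.algebraMap_eq_smul_one]
    rfl

theorem norm_coords (hK : Module.finrank ℚ K = 2) {d : ℚ} {θ : K}
    (htr : Algebra.trace ℚ K θ = 0) (hN : Algebra.norm ℚ θ = -d) (a b : ℚ_[p]) :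
    Algebra.norm ℚ_[p] (algebraMap ℚ_[p] (LocalAlg p K) a + b • toLocal p θ) =
      a ^ 2 - d * b ^ 2 := by
  rw [norm_algebraMap_add_of_finrank_two (finrank_localAlg hK), map_smul, trace_toLocal, htr,
    norm_smul_of_finrank_two (finrank_localAlg hK), norm_toLocal, hN]
  push_cast
  simp
  ring

/-- A quadratic form `t x x̄` that does not represent every number is anisotropic. -/
theorem eq_zero_of_norm_eq_zero (hK : Module.finrank ℚ K = 2) {a : ℚ_[p]}
    (ha : ¬ ∃ x : LocalAlg p K, Algebra.norm ℚ_[p] x = a) (x : LocalAlg p K)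
    (hx : Algebra.norm ℚ_[p] x = 0) : x = 0 := by
  obtain ⟨d, q, θ, hd, hq, hdisc, htr, hN, hco⟩ := exists_sqrt (p := p) hK
  obtain ⟨u, v, rfl⟩ := hco x
  rw [norm_coords hK htr hN] at hx
  have hdp : (d : ℚ_[p]) ≠ 0 := by exact_mod_cast hd
  by_cases hv : v = 0
  · subst hv
    have : u = 0 := by simpa using hx
    simp [this]
  · exfalso
    apply ha
    have hu : u ≠ 0 := by
      rintro rfl
      have : (d : ℚ_[p]) * v ^ 2 = 0 := by linear_combination -hx
      exact mul_ne_zero hdp (pow_ne_zero 2 hv) this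
    -- With `d = (u / v)²`, the form factors as `(A - (u/v) B) (A + (u/v) B)`. The witness makes the
    -- two factors equal to `1` and `a`.
    refine ⟨algebraMap ℚ_[p] (LocalAlg p K) ((1 + a) / 2) + ((a - 1) / 2 * v / u) • toLocal p θ, ?_⟩
    rw [norm_coords hK htr hN]
    have : (d : ℚ_[p]) = (u / v) ^ 2 := by
      field_simp
      linear_combination -hx
    rw [this]
    field_simp
    ring

theorem hilbertSymbol_norm (hK : Module.finrank ℚ K = 2) (x : LocalAlg p K) :
    hilbertSymbol (NumberField.discr K : ℚ_[p]) (Algebra.norm ℚ_[p] x) = 1 := by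
  obtain ⟨d, q, θ, hd, hq, hdisc, htr, hN, hco⟩ := exists_sqrt (p := p) hK
  obtain ⟨u, v, rfl⟩ := hco x
  rw [norm_coords hK htr hN, hilbertSymbol, if_pos]
  have hqp : (q : ℚ_[p]) ≠ 0 := by exact_mod_cast hq
  have hdp : (NumberField.discr K : ℚ_[p]) = d * q ^ 2 := by
    have := congrArg (fun y : ℚ => (y : ℚ_[p])) hdisc
    push_cast at this
    exact this
  -- The equation `u² = Δ (v / q)² + N` is the coordinate formula `N = u² - d v²` with `Δ = d q²`.
  refine ⟨v / q, 1, u, by simp, ?_⟩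
  rw [hdp]
  field_simp
  ring

end LocalNorm

/-! ### The ultrametric inequality for `|N x|` when `k_p` is a field. -/

section Anisotropic

variable {p : ℕ} [Fact p.Prime] {K : Type*} [Field K] [NumberField K]

theorem exists_root_quadratic (b c a : ℤ_[p]) (h : ‖a ^ 2 + b * a + c‖ < ‖2 * a + b‖ ^ 2) :
    ∃ z : ℤ_[p], z ^ 2 + b * z + c = 0 := by
  have := hensels_lemma (p := p) (R := ℤ_[p])
    (F := (Polynomial.X ^ 2 + Polynomial.C b * Polynomial.X + Polynomial.C c : Polynomial ℤ_[p]))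
    (a := a) (by
      simp only [map_add, map_mul, map_pow, Polynomial.aeval_X, Polynomial.aeval_C,
        Polynomial.derivative_mul, Polynomial.derivative_C,
        Polynomial.derivative_X, Polynomial.derivative_X_pow]
      simpa using h)
  obtain ⟨z, hz, -⟩ := this
  refine ⟨z, ?_⟩
  simpa using hz

variable (p K) in
/-- The norm form of `k_p` is anisotropic, that is, `k_p` is a field. -/
def Anisotropic : Prop := ∀ x : LocalAlg p K, Algebra.norm ℚ_[p] x = 0 → x = 0

theorem mul_conj (hK : Module.finrank ℚ K = 2) (x : LocalAlg p K) :
    x * conj x = algebraMap ℚ_[p] (LocalAlg p K) (Algebra.norm ℚ_[p] x) := by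
  have := sq_eq_of_finrank_two (finrank_localAlg (p := p) hK) x
  rw [conj]
  linear_combination -this

theorem norm_conj (hK : Module.finrank ℚ K = 2) (x : LocalAlg p K) :
    Algebra.norm ℚ_[p] (conj x) = Algebra.norm ℚ_[p] x := by
  have hF := finrank_localAlg (p := p) hK
  rw [conj, sub_eq_add_neg, norm_algebraMap_add_of_finrank_two hF, map_neg,
    show (-x : LocalAlg p K) = (-1 : ℚ_[p]) • x by simp, norm_smul_of_finrank_two hF]
  ring

namespace Anisotropic

theorem exists_mul_eq_one (h : Anisotropic p K) (hK : Module.finrank ℚ K = 2)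
    {x : LocalAlg p K} (hx : x ≠ 0) : ∃ y, x * y = 1 := by
  have hN : Algebra.norm ℚ_[p] x ≠ 0 := fun h0 => hx (h x h0)
  refine ⟨(Algebra.norm ℚ_[p] x)⁻¹ • conj x, ?_⟩
  rw [mul_smul_comm, mul_conj hK, Algebra.smul_def, ← map_mul, inv_mul_cancel₀ hN, map_one]

theorem norm_mul_norm_eq_one {x y : LocalAlg p K} (hxy : x * y = 1) :
    ‖Algebra.norm ℚ_[p] x‖ * ‖Algebra.norm ℚ_[p] y‖ = 1 := by
  rw [← norm_mul, ← map_mul, hxy, map_one, norm_one]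

/-- If `|Tr x|² > |N x|`, Hensel's lemma splits the characteristic polynomial of `x` over `ℚ_p`.
Anisotropy then makes `x` a scalar, for which the inequality holds since `|2| ≤ 1`. -/
theorem norm_trace_sq_le (h : Anisotropic p K) (hK : Module.finrank ℚ K = 2)
    (x : LocalAlg p K) :
    ‖Algebra.trace ℚ_[p] (LocalAlg p K) x‖ ^ 2 ≤ ‖Algebra.norm ℚ_[p] x‖ := by
  by_contra! hlt
  have hF := finrank_localAlg (p := p) hK
  have : Module.Finite ℚ_[p] (LocalAlg p K) := Module.finite_of_finrank_pos (by omega)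
  set T := Algebra.trace ℚ_[p] (LocalAlg p K) x with hT
  set N := Algebra.norm ℚ_[p] x with hN
  have hT0 : T ≠ 0 := by
    rintro h0
    rw [h0, norm_zero] at hlt
    have := norm_nonneg N
    norm_num at hlt
    linarith
  have hu : ‖N / T ^ 2‖ < 1 := by
    rw [norm_div, norm_pow, div_lt_one (by positivity)]
    exact hlt
  obtain ⟨u, hu'⟩ : ∃ u : ℤ_[p], (u : ℚ_[p]) = N / T ^ 2 := ⟨⟨_, hu.le⟩, rfl⟩
  rw [← hu', ← PadicInt.norm_def] at hu
  -- The substitution `X = T z` turns `X² - T X + N` into `T² (z² - z + N / T²)`. At `z = 1` the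
  -- bracket is small and its derivative is `1`, so the argument includes `p = 2`.
  obtain ⟨z, hz⟩ := exists_root_quadratic (-1) u 1 (by
    rw [show (1 : ℤ_[p]) ^ 2 + -1 * 1 + u = u by ring, show (2 : ℤ_[p]) * 1 + -1 = 1 by ring,
      norm_one, one_pow]
    exact hu)
  have hz' : (z : ℚ_[p]) ^ 2 + -1 * z + N / T ^ 2 = 0 := by
    have := congrArg (fun y : ℤ_[p] => (y : ℚ_[p])) hz
    rw [← hu']
    exact_mod_cast this
  have hx : x = algebraMap ℚ_[p] (LocalAlg p K) (T * z) := by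
    have h0 := h (algebraMap ℚ_[p] (LocalAlg p K) (-(T * z)) + x) (by
      rw [norm_algebraMap_add_of_finrank_two hF, ← hT, ← hN]
      field_simp at hz'
      linear_combination hz')
    rw [map_neg] at h0
    linear_combination h0
  have h1 : N = (T * z) ^ 2 := by rw [hN, hx, Algebra.norm_algebraMap, hF]
  have h2 : T = 2 * (T * z) := by
    conv_lhs => rw [hT, hx, Algebra.trace_algebraMap, hF]
    simp
  apply absurd hlt
  rw [not_lt, h1, norm_pow]
  conv_lhs => rw [h2, norm_mul]
  have h22 : ‖(2 : ℚ_[p])‖ ≤ 1 := by simpa using Padic.norm_int_le_one (p := p) 2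
  gcongr
  exact mul_le_of_le_one_left (norm_nonneg _) h22

theorem norm_trace_le_one (h : Anisotropic p K) (hK : Module.finrank ℚ K = 2)
    {x : LocalAlg p K} (hx : ‖Algebra.norm ℚ_[p] x‖ ≤ 1) :
    ‖Algebra.trace ℚ_[p] (LocalAlg p K) x‖ ≤ 1 := by
  have := (h.norm_trace_sq_le hK x).trans hx
  exact (sq_le_one_iff₀ (norm_nonneg _)).1 this

/-- After division by the larger of the two elements, it remains to bound `N(1 + y) = 1 + Tr y + N
y` for `|N y| ≤ 1`, and the trace is integral by `norm_trace_le_one`. -/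
theorem norm_add_le_max (h : Anisotropic p K) (hK : Module.finrank ℚ K = 2)
    (x y : LocalAlg p K) :
    ‖Algebra.norm ℚ_[p] (x + y)‖ ≤
      max ‖Algebra.norm ℚ_[p] x‖ ‖Algebra.norm ℚ_[p] y‖ := by
  wlog hxy : ‖Algebra.norm ℚ_[p] y‖ ≤ ‖Algebra.norm ℚ_[p] x‖ generalizing x y
  · rw [add_comm, max_comm]
    exact this y x (le_of_not_ge hxy)
  rw [max_eq_left hxy]
  by_cases hx : x = 0
  · subst hx
    rwa [zero_add]
  obtain ⟨w, hw⟩ := h.exists_mul_eq_one hK hx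
  have hxw := norm_mul_norm_eq_one hw
  have e : x + y = x * (algebraMap ℚ_[p] (LocalAlg p K) 1 + w * y) := by
    rw [map_one, mul_add, mul_one, ← mul_assoc, hw, one_mul]
  have hwy : ‖Algebra.norm ℚ_[p] (w * y)‖ ≤ 1 := by
    rw [map_mul, norm_mul, ← hxw, mul_comm]
    gcongr
  rw [e, map_mul, norm_mul]
  refine mul_le_of_le_one_right (norm_nonneg _) ?_
  rw [norm_algebraMap_add_of_finrank_two (finrank_localAlg hK), one_pow, one_mul]
  exact (IsUltrametricDist.norm_add_le_max _ _).trans (max_le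
    ((IsUltrametricDist.norm_add_le_max _ _).trans (max_le norm_one.le
      (h.norm_trace_le_one hK hwy))) hwy)

theorem norm_le_of_mem_localIdeal (h : Anisotropic p K) (hK : Module.finrank ℚ K = 2)
    {I : FractionalIdeal (𝓞 K)⁰ K} {c : ℝ}
    (hI : ∀ x ∈ I, ‖((Algebra.norm ℚ x : ℚ) : ℚ_[p])‖ ≤ c) {x : LocalAlg p K}
    (hx : x ∈ localIdeal p I) : ‖Algebra.norm ℚ_[p] x‖ ≤ c := by
  have hF := finrank_localAlg (p := p) hK
  induction hx using Submodule.span_induction with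
  | mem x hx =>
    obtain ⟨y, hy, rfl⟩ := hx
    rw [norm_toLocal]
    exact hI y hy
  | zero =>
    have := hI 0 (I : Submodule (𝓞 K) K).zero_mem
    rw [← norm_toLocal, show toLocal p (0 : K) = 0 from map_zero (toLocalHom p)] at this
    exact this
  | add x y _ _ hx hy => exact (h.norm_add_le_max hK x y).trans (max_le hx hy)
  | smul a x _ hx =>
    rw [show a • x = (a : ℚ_[p]) • x from (algebraMap_smul ℚ_[p] a x).symm,
      norm_smul_of_finrank_two hF, norm_mul, norm_pow]
    exact (mul_le_of_le_one_left (norm_nonneg _) (pow_le_one₀ (norm_nonneg _) a.2)).trans hx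

end Anisotropic

theorem localBasis_apply (i : Module.Free.ChooseBasisIndex ℤ (𝓞 K)) :
    localBasis p K i = toLocal p (NumberField.integralBasis K i) := by
  rw [localBasis, Algebra.TensorProduct.basis_apply]
  rfl

theorem toLocal_mem_localInt (x : 𝓞 K) : toLocal p (x : K) ∈ localInt p K :=
  Submodule.subset_span ⟨x, (FractionalIdeal.mem_one_iff _).2 ⟨x, rfl⟩, rfl⟩

theorem mem_localInt_iff_repr (x : LocalAlg p K) :
    x ∈ localInt p K ↔ ∀ i, ‖(localBasis p K).repr x i‖ ≤ 1 := by
  constructor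
  · intro hx i
    induction hx using Submodule.span_induction with
    | mem x hx =>
      obtain ⟨y, hy, rfl⟩ := hx
      obtain ⟨z, rfl⟩ := (FractionalIdeal.mem_one_iff _).1 hy
      have : (localBasis p K).repr (toLocal p (algebraMap (𝓞 K) K z)) i =
          (((NumberField.RingOfIntegers.basis K).repr z i : ℤ) : ℚ_[p]) := by
        rw [localBasis, toLocal, Algebra.TensorProduct.basis_repr_tmul]
        simp only [Finsupp.mapRange_apply, one_smul]
        rw [NumberField.integralBasis_repr_apply]
        simp
      rw [this]
      exact Padic.norm_int_le_one _
    | zero => simp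
    | add x y _ _ hx hy =>
      rw [map_add, Finsupp.add_apply]
      exact (IsUltrametricDist.norm_add_le_max _ _).trans (max_le hx hy)
    | smul a x _ hx =>
      rw [show a • x = (a : ℚ_[p]) • x from (algebraMap_smul ℚ_[p] a x).symm, map_smul,
        Finsupp.smul_apply, norm_smul]
      exact mul_le_one₀ a.2 (norm_nonneg _) hx
  · intro h
    rw [← (localBasis p K).sum_repr x]
    refine Submodule.sum_mem _ fun i _ => ?_
    obtain ⟨z, hz⟩ : ∃ z : ℤ_[p], (z : ℚ_[p]) = (localBasis p K).repr x i := ⟨⟨_, h i⟩, rfl⟩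
    rw [← hz, show (z : ℚ_[p]) • localBasis p K i = z • localBasis p K i from
      algebraMap_smul ℚ_[p] z _]
    refine Submodule.smul_mem _ _ ?_
    rw [localBasis_apply, NumberField.integralBasis_apply]
    exact toLocal_mem_localInt _

/-- Every element of `k_p` is the sum of an element of `O_{k,p}` and an element of `O_k[1/p]`. -/
theorem exists_near (x : LocalAlg p K) :
    ∃ (β : K) (l : ℕ), x - toLocal p β ∈ localInt p K ∧
      ∃ c : 𝓞 K, (c : K) = ((p : ℚ) ^ l) • β := by
  choose a l hal using fun i => exists_int_div_pow_near ((localBasis p K).repr x i)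
  refine ⟨∑ i, ((a i : ℚ) / (p : ℚ) ^ l i) • NumberField.integralBasis K i, ∑ i, l i, ?_, ?_⟩
  · rw [mem_localInt_iff_repr]
    intro i
    have : toLocal p (∑ i, ((a i : ℚ) / (p : ℚ) ^ l i) • NumberField.integralBasis K i) =
        ∑ i, (((a i : ℚ) / (p : ℚ) ^ l i : ℚ) : ℚ_[p]) • localBasis p K i := by
      rw [← toLocalHom_apply, map_sum]
      refine Finset.sum_congr rfl fun i _ => ?_
      rw [toLocalHom_apply, toLocal_smul, localBasis_apply]
    rw [map_sub, Finsupp.sub_apply, this, Module.Basis.repr_sum_self]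
    exact hal i
  · have hp' : (p : ℚ) ≠ 0 := by exact_mod_cast (Fact.out : p.Prime).ne_zero
    refine ⟨∑ i, (a i * (p : ℤ) ^ (∑ j, l j - l i)) • NumberField.RingOfIntegers.basis K i, ?_⟩
    refine (map_sum (algebraMap (𝓞 K) K) _ _).trans ?_
    rw [Finset.smul_sum]
    refine Finset.sum_congr rfl fun i _ => ?_
    rw [NumberField.integralBasis_apply, smul_smul, map_zsmul, ← Int.cast_smul_eq_zsmul ℚ]
    congr 1
    have hle : l i ≤ ∑ j, l j := Finset.single_le_sum (fun _ _ => Nat.zero_le _) (Finset.mem_univ i)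
    push_cast
    -- The sum of the exponents `l i` serves as a common denominator exponent.
    rw [pow_sub₀ _ hp' hle]
    field_simp

end Anisotropic

/-! ### Localized ideals as balls for `|N x|`. -/

section LocalIdeals

variable {p : ℕ} [Fact p.Prime] {K : Type*} [Field K] [NumberField K]

/-- Elements of `O_k[1/p]` have norm in `ℤ[1/p]`, so integrality at `p` suffices. -/
theorem exists_int_norm_eq (hK : Module.finrank ℚ K = 2) {β : K} {l : ℕ} {c : 𝓞 K}
    (hc : (c : K) = ((p : ℚ) ^ l) • β) (h : ‖((Algebra.norm ℚ β : ℚ) : ℚ_[p])‖ ≤ 1) :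
    ∃ z : ℤ, Algebra.norm ℚ β = z := by
  have hp' : (p : ℚ) ≠ 0 := by exact_mod_cast (Fact.out : p.Prime).ne_zero
  have e : Algebra.norm ℚ β = (Algebra.norm ℤ c : ℚ) / (p : ℚ) ^ (2 * l) := by
    rw [Algebra.coe_norm_int, hc, norm_smul_of_finrank_two hK]
    field_simp
    ring
  rw [e] at h ⊢
  exact exists_int_eq_of_norm_le_one _ _ h

theorem exists_int_trace_eq {β : K} {l : ℕ} {c : 𝓞 K}
    (hc : (c : K) = ((p : ℚ) ^ l) • β) (h : ‖((Algebra.trace ℚ K β : ℚ) : ℚ_[p])‖ ≤ 1) :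
    ∃ z : ℤ, Algebra.trace ℚ K β = z := by
  have hp' : (p : ℚ) ≠ 0 := by exact_mod_cast (Fact.out : p.Prime).ne_zero
  have e : Algebra.trace ℚ K β = (Algebra.trace ℤ (𝓞 K) c : ℚ) / (p : ℚ) ^ l := by
    rw [Algebra.coe_trace_int, hc, map_smul, smul_eq_mul]
    field_simp
  rw [e] at h ⊢
  exact exists_int_eq_of_norm_le_one _ _ h

theorem norm_norm_ringOfIntegers_le_one (c : 𝓞 K) :
    ‖((Algebra.norm ℚ (c : K) : ℚ) : ℚ_[p])‖ ≤ 1 := by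
  rw [← Algebra.coe_norm_int]
  simpa using Padic.norm_int_le_one (p := p) (Algebra.norm ℤ c)

/-- For the converse, replace `x` modulo `O_{k,p}` by some `β ∈ O_k[1/p]`. Norm and trace of `β` lie
in `ℤ[1/p] ∩ ℤ_p = ℤ`, so `β` is an algebraic integer. -/
theorem Anisotropic.mem_localInt_iff (h : Anisotropic p K) (hK : Module.finrank ℚ K = 2)
    (x : LocalAlg p K) : x ∈ localInt p K ↔ ‖Algebra.norm ℚ_[p] x‖ ≤ 1 := by
  have key : ∀ x ∈ localInt p K, ‖Algebra.norm ℚ_[p] x‖ ≤ 1 := fun x hx =>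
    h.norm_le_of_mem_localIdeal hK (by
      intro y hy
      obtain ⟨z, rfl⟩ := (FractionalIdeal.mem_one_iff _).1 hy
      exact norm_norm_ringOfIntegers_le_one z) hx
  refine ⟨key x, fun hx => ?_⟩
  obtain ⟨β, l, hβ, c, hc⟩ := exists_near x
  have hN : ‖Algebra.norm ℚ_[p] (toLocal p β)‖ ≤ 1 := by
    have h1 : toLocal p β = x + (-1 : ℚ_[p]) • (x - toLocal p β) := by
      rw [neg_one_smul]; ring
    rw [h1]
    refine (h.norm_add_le_max hK _ _).trans (max_le hx ?_)
    rw [norm_smul_of_finrank_two (finrank_localAlg hK)]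
    simpa using key _ hβ
  have hT := h.norm_trace_le_one hK hN
  rw [norm_toLocal] at hN
  rw [trace_toLocal] at hT
  obtain ⟨n, hn⟩ := exists_int_norm_eq hK hc hN
  obtain ⟨t, ht⟩ := exists_int_trace_eq hc hT
  have hint : IsIntegral ℤ β := by
    refine ⟨Polynomial.X ^ 2 - Polynomial.C t * Polynomial.X + Polynomial.C n, ?_, ?_⟩
    · monicity!
    · have := sq_eq_of_finrank_two hK β
      rw [hn, ht] at this
      simp only [Polynomial.eval₂_add, Polynomial.eval₂_sub, Polynomial.eval₂_mul,
        Polynomial.eval₂_C, Polynomial.eval₂_X, Polynomial.eval₂_pow]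
      rw [this]
      simp
  have := Submodule.add_mem _ hβ (toLocal_mem_localInt (p := p) (⟨β, hint⟩ : 𝓞 K))
  change x - toLocal p β + toLocal p β ∈ localInt p K at this
  rwa [sub_add_cancel] at this

theorem norm_norm_le_absNorm {I : FractionalIdeal (𝓞 K)⁰ K} (hI : I ≠ 0) {x : K} (hx : x ∈ I) :
    ‖((Algebra.norm ℚ x : ℚ) : ℚ_[p])‖ ≤ ‖((FractionalIdeal.absNorm I : ℚ) : ℚ_[p])‖ := by
  have h1 : FractionalIdeal.spanSingleton (𝓞 K)⁰ x * I⁻¹ ≤ 1 := by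
    rw [← mul_inv_cancel₀ hI]
    gcongr
    rwa [FractionalIdeal.spanSingleton_le_iff_mem]
  obtain ⟨J, hJ⟩ := FractionalIdeal.le_one_iff_exists_coeIdeal.1 h1
  have h2 : FractionalIdeal.spanSingleton (𝓞 K)⁰ x = J * I := by
    rw [hJ, mul_assoc, inv_mul_cancel₀ hI, mul_one]
  have h3 := congrArg FractionalIdeal.absNorm h2
  rw [FractionalIdeal.absNorm_span_singleton, map_mul, FractionalIdeal.coeIdeal_absNorm] at h3
  have h4 : ‖((Algebra.norm ℚ x : ℚ) : ℚ_[p])‖ = ‖((|Algebra.norm ℚ x| : ℚ) : ℚ_[p])‖ := by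
    rcases abs_choice (Algebra.norm ℚ x) with h | h <;> rw [h]
    push_cast
    rw [norm_neg]
  rw [h4, h3]
  push_cast
  rw [norm_mul]
  refine mul_le_of_le_one_left (norm_nonneg _) ?_
  simpa using Padic.norm_int_le_one (p := p) J.absNorm

/-- The ideal of `ℤ` generated by the norms of the elements of `J` contains `N(J)`. Were all these
norms `p`-adically smaller than `N(J)`, the ultrametric inequality would make every element of the
ideal smaller. -/
theorem exists_mem_norm_norm_eq_ideal (J : Ideal (𝓞 K)) (hJ : J ≠ 0) :
    ∃ x ∈ J, ‖((Ideal.absNorm J : ℚ) : ℚ_[p])‖ ≤ ‖((Algebra.norm ℚ (x : K) : ℚ) : ℚ_[p])‖ := by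
  by_contra! hlt
  set c : ℝ := ‖((Ideal.absNorm J : ℚ) : ℚ_[p])‖ with hc
  have hc0 : 0 < c := by
    rw [hc, norm_pos_iff]
    have : Ideal.absNorm J ≠ 0 := by rwa [Ne, Ideal.absNorm_eq_zero_iff]
    exact_mod_cast this
  have hmem : (Ideal.absNorm J : ℤ) ∈ Ideal.relNorm ℤ J := by
    rw [Ideal.relNorm_int]
    exact Ideal.mem_span_singleton_self _
  have key : ∀ z ∈ Ideal.relNorm ℤ J, ‖((z : ℚ) : ℚ_[p])‖ < c := by
    intro z hz
    rw [Ideal.relNorm_apply] at hz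
    induction hz using Submodule.span_induction with
    | mem z hz =>
      obtain ⟨y, hy, rfl⟩ := hz
      rw [Algebra.intNorm_eq_norm, Algebra.coe_norm_int]
      exact hlt y hy
    | zero => simpa using hc0
    | add x y _ _ hx hy =>
      push_cast at hx hy ⊢
      exact (IsUltrametricDist.norm_add_le_max _ _).trans_lt (max_lt hx hy)
    | smul a x _ hx =>
      push_cast [smul_eq_mul] at hx ⊢
      rw [norm_mul]
      exact (mul_le_of_le_one_left (norm_nonneg _) (Padic.norm_int_le_one a)).trans_lt hx
  have := key _ hmem
  rw [hc] at this
  simp at this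

theorem exists_mem_norm_norm_eq {I : FractionalIdeal (𝓞 K)⁰ K} (hI : I ≠ 0) :
    ∃ x ∈ I, ‖((Algebra.norm ℚ x : ℚ) : ℚ_[p])‖ =
      ‖((FractionalIdeal.absNorm I : ℚ) : ℚ_[p])‖ := by
  obtain ⟨a, J, ha, hIJ⟩ := FractionalIdeal.exists_eq_spanSingleton_mul I
  have ha' : algebraMap (𝓞 K) K a ≠ 0 := by simpa using ha
  have hJ : J ≠ 0 := by
    rintro rfl
    apply hI
    rw [hIJ]
    simp
  obtain ⟨x, hx, hle⟩ := exists_mem_norm_norm_eq_ideal (p := p) J hJ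
  have hmem : (algebraMap (𝓞 K) K a)⁻¹ * x ∈ I := by
    rw [hIJ]
    exact FractionalIdeal.mul_mem_mul (FractionalIdeal.mem_spanSingleton_self _ _)
      ((FractionalIdeal.mem_coeIdeal _).2 ⟨x, hx, rfl⟩)
  refine ⟨_, hmem, le_antisymm (norm_norm_le_absNorm hI hmem) ?_⟩
  rw [hIJ, map_mul, FractionalIdeal.absNorm_span_singleton, FractionalIdeal.coeIdeal_absNorm,
    map_mul]
  push_cast at hle ⊢
  rw [norm_mul, norm_mul]
  refine mul_le_mul (le_of_eq ?_) hle (norm_nonneg _) (norm_nonneg _)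
  rcases abs_choice (Algebra.norm ℚ (algebraMap (𝓞 K) K a)⁻¹) with h | h <;> rw [h]
  push_cast
  rw [norm_neg]

/-- For the converse, divide `x` by an element `α ∈ I` with `|N α| = |N I|`; the quotient is
integral, and `α O_{k,p} ⊆ I_p`. -/
theorem Anisotropic.mem_localIdeal_iff (h : Anisotropic p K) (hK : Module.finrank ℚ K = 2)
    {I : FractionalIdeal (𝓞 K)⁰ K} (hI : I ≠ 0) (x : LocalAlg p K) :
    x ∈ localIdeal p I ↔
      ‖Algebra.norm ℚ_[p] x‖ ≤ ‖((FractionalIdeal.absNorm I : ℚ) : ℚ_[p])‖ := by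
  refine ⟨fun hx => h.norm_le_of_mem_localIdeal hK (fun y hy => norm_norm_le_absNorm hI hy) hx,
    fun hx => ?_⟩
  obtain ⟨α, hα, hαN⟩ := exists_mem_norm_norm_eq (p := p) hI
  have hα0 : α ≠ 0 := by
    rintro rfl
    rw [Algebra.norm_zero] at hαN
    have h0 : FractionalIdeal.absNorm I ≠ 0 := by rwa [Ne, FractionalIdeal.absNorm_eq_zero_iff]
    have : ((FractionalIdeal.absNorm I : ℚ) : ℚ_[p]) ≠ 0 := by exact_mod_cast h0
    rw [Rat.cast_zero, norm_zero] at hαN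
    exact norm_ne_zero_iff.2 this hαN.symm
  have hmul : toLocal p α * toLocal p α⁻¹ = 1 := by
    rw [← toLocal_mul, mul_inv_cancel₀ hα0, toLocal_one]
  have hy : toLocal p α⁻¹ * x ∈ localInt p K := by
    rw [h.mem_localInt_iff hK, map_mul, norm_mul,
      ← Anisotropic.norm_mul_norm_eq_one hmul, mul_comm, norm_toLocal α, hαN]
    gcongr
  have hx' : x = toLocal p α * (toLocal p α⁻¹ * x) := by rw [← mul_assoc, hmul, one_mul]
  rw [hx']
  generalize toLocal p α⁻¹ * x = y at hy
  induction hy using Submodule.span_induction with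
  | mem y hy =>
    obtain ⟨w, hw, rfl⟩ := hy
    obtain ⟨z, rfl⟩ := (FractionalIdeal.mem_one_iff _).1 hw
    refine Submodule.subset_span ⟨algebraMap (𝓞 K) K z * α, ?_, ?_⟩
    · rw [← Algebra.smul_def]
      exact (I : Submodule (𝓞 K) K).smul_mem z hα
    · rw [mul_comm, toLocal_mul]
  | zero => rw [mul_zero]; exact Submodule.zero_mem _
  | add x y _ _ hx hy => rw [mul_add]; exact Submodule.add_mem _ hx hy
  | smul a x _ hx => rw [mul_smul_comm]; exact Submodule.smul_mem _ _ hx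

/-- The norm of the sum ideal is attained at some element `u + v`, to which the ultrametric
inequality applies. With `I = 𝔞` and `x = λ`, this computes the absolute value of the coefficient of
the quadratic form. -/
theorem norm_absNorm_add_spanSingleton (h : Anisotropic p K) (hK : Module.finrank ℚ K = 2)
    {I : FractionalIdeal (𝓞 K)⁰ K} (hI : I ≠ 0) (x : K) :
    ‖((FractionalIdeal.absNorm (I + FractionalIdeal.spanSingleton (𝓞 K)⁰ x) : ℚ) : ℚ_[p])‖ =
      max ‖((FractionalIdeal.absNorm I : ℚ) : ℚ_[p])‖ ‖((Algebra.norm ℚ x : ℚ) : ℚ_[p])‖ := by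
  set J := I + FractionalIdeal.spanSingleton (𝓞 K)⁰ x with hJ
  have hIJ : I ≤ J := le_self_add
  have hxJ : x ∈ J := by
    rw [← FractionalIdeal.spanSingleton_le_iff_mem]
    exact le_add_self
  have hJ0 : J ≠ 0 := by
    intro h0
    rw [h0] at hIJ
    exact hI (le_antisymm hIJ zero_le)
  apply le_antisymm
  · obtain ⟨y, hy, hyN⟩ := exists_mem_norm_norm_eq (p := p) hJ0
    rw [← hyN, ← norm_toLocal]
    rw [hJ, FractionalIdeal.mem_add] at hy
    obtain ⟨u, hu, v, hv, rfl⟩ := hy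
    obtain ⟨z, rfl⟩ := (FractionalIdeal.mem_spanSingleton _).1 hv
    rw [toLocal_add]
    refine (h.norm_add_le_max hK _ _).trans (max_le_max ?_ ?_)
    · rw [norm_toLocal]
      exact norm_norm_le_absNorm hI hu
    · rw [norm_toLocal, Algebra.smul_def, map_mul]
      push_cast
      rw [norm_mul]
      exact mul_le_of_le_one_left (norm_nonneg _) (norm_norm_ringOfIntegers_le_one z)
  · refine max_le ?_ (norm_norm_le_absNorm hJ0 hxJ)
    obtain ⟨y, hy, hyN⟩ := exists_mem_norm_norm_eq (p := p) hI
    rw [← hyN]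
    exact norm_norm_le_absNorm hJ0 (hIJ hy)

theorem different_ne_zero : different K ≠ 0 := by
  rw [different, Ne, FractionalIdeal.coeIdeal_eq_zero]
  intro h
  have := NumberField.absNorm_differentIdeal K (𝒪 := 𝓞 K)
  rw [h, Ideal.absNorm_bot, eq_comm, Int.natAbs_eq_zero] at this
  exact NumberField.discr_ne_zero K this

theorem absNorm_different : FractionalIdeal.absNorm (different K) = |(NumberField.discr K : ℚ)| := by
  rw [different, FractionalIdeal.coeIdeal_absNorm, NumberField.absNorm_differentIdeal (K := K)]
  simp

theorem norm_absNorm_different : ‖((FractionalIdeal.absNorm (different K) : ℚ) : ℚ_[p])‖ =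
    ‖(NumberField.discr K : ℚ_[p])‖ := by
  rw [absNorm_different]
  rcases abs_choice (NumberField.discr K : ℚ) with h | h <;> rw [h] <;> push_cast
  · rfl
  · rw [norm_neg]

theorem mem_inv_different_iff (x : K) :
    x ∈ (different K)⁻¹ ↔ ∀ c : 𝓞 K, ∃ z : ℤ, Algebra.trace ℚ K (x * c) = z := by
  rw [different, coeIdeal_differentIdeal ℤ ℚ, inv_inv, FractionalIdeal.mem_dual
    (one_ne_zero : (1 : FractionalIdeal (𝓞 K)⁰ K) ≠ 0)]
  simp only [Algebra.traceForm_apply]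
  constructor
  · intro h c
    obtain ⟨z, hz⟩ := h c ((FractionalIdeal.mem_one_iff _).2 ⟨c, rfl⟩)
    exact ⟨z, by rw [← hz]; rfl⟩
  · intro h a ha
    obtain ⟨c, rfl⟩ := (FractionalIdeal.mem_one_iff _).1 ha
    obtain ⟨z, hz⟩ := h c
    exact ⟨z, by rw [hz]; rfl⟩

end LocalIdeals

/-! ### Valuations of norms, ramification and the different. -/

section NormGroup

variable {p : ℕ} [Fact p.Prime] {K : Type*} [Field K] [NumberField K]

theorem norm_eq_zpow {x : ℚ_[p]} (hx : x ≠ 0) : ∃ k : ℤ, ‖x‖ = (p : ℝ) ^ k :=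
  ⟨_, Padic.norm_eq_zpow_neg_valuation hx⟩

theorem norm_two_of_ne_two (hp2 : p ≠ 2) : ‖(2 : ℚ_[p])‖ = 1 := by
  have h : ‖((2 : ℤ) : ℚ_[p])‖ = 1 := by
    refine le_antisymm (Padic.norm_int_le_one 2) (not_lt.1 fun hlt => hp2 ?_)
    rw [Padic.norm_intCast_lt_one_iff] at hlt
    have : p ∣ 2 := by exact_mod_cast hlt
    exact (Nat.prime_dvd_prime_iff_eq Fact.out Nat.prime_two).1 this
  exact_mod_cast h

theorem exists_sq_eq (hp2 : p ≠ 2) {w : ℚ_[p]} (hw : w ∈ Metric.ball (1 : ℚ_[p]) 1) :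
    ∃ a : ℚ_[p], a ^ 2 = w := by
  rw [Metric.mem_ball, dist_eq_norm] at hw
  obtain ⟨u, hu⟩ : ∃ u : ℤ_[p], (u : ℚ_[p]) = w - 1 := ⟨⟨_, hw.le⟩, rfl⟩
  rw [← hu, ← PadicInt.norm_def] at hw
  have h2 : ‖(2 : ℤ_[p])‖ = 1 := by
    rw [PadicInt.norm_def]
    exact_mod_cast norm_two_of_ne_two hp2
  obtain ⟨z, hz⟩ := exists_root_quadratic 0 (-(1 + u)) 1 (by
    rw [show (1 : ℤ_[p]) ^ 2 + 0 * 1 + -(1 + u) = -u by ring, show (2 : ℤ_[p]) * 1 + 0 = 2 by ring,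
      h2, one_pow, norm_neg]
    exact hw)
  refine ⟨z, ?_⟩
  have := congrArg (fun y : ℤ_[p] => (y : ℚ_[p])) hz
  push_cast at this
  rw [hu] at this
  linear_combination this

variable (p K) in
/-- `a` is a norm from `k_p`. -/
def IsLocalNorm (a : ℚ_[p]) : Prop := ∃ x : LocalAlg p K, Algebra.norm ℚ_[p] x = a

theorem IsLocalNorm.mul {a b : ℚ_[p]} (ha : IsLocalNorm p K a) (hb : IsLocalNorm p K b) :
    IsLocalNorm p K (a * b) := by
  obtain ⟨x, rfl⟩ := ha
  obtain ⟨y, rfl⟩ := hb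
  exact ⟨x * y, map_mul _ _ _⟩

theorem isLocalNorm_sq (hK : Module.finrank ℚ K = 2) (a : ℚ_[p]) : IsLocalNorm p K (a ^ 2) := by
  have hF := finrank_localAlg (p := p) hK
  have : Module.Finite ℚ_[p] (LocalAlg p K) := Module.finite_of_finrank_pos (by omega)
  exact ⟨algebraMap _ _ a, by rw [Algebra.norm_algebraMap, hF]⟩

theorem IsLocalNorm.inv (hK : Module.finrank ℚ K = 2) {a : ℚ_[p]} (ha : IsLocalNorm p K a) :
    IsLocalNorm p K a⁻¹ := by
  by_cases h0 : a = 0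
  · rwa [h0, inv_zero, ← h0]
  have := ha.mul (isLocalNorm_sq hK a⁻¹)
  convert this using 1
  field_simp

theorem IsLocalNorm.div (hK : Module.finrank ℚ K = 2) {a b : ℚ_[p]} (ha : IsLocalNorm p K a)
    (hb : IsLocalNorm p K b) : IsLocalNorm p K (a / b) := by
  rw [div_eq_mul_inv]
  exact ha.mul (hb.inv hK)

theorem not_isLocalNorm_of_isKappa (hK : Module.finrank ℚ K = 2) {κ : ℚ_[p]}
    (hκ : IsKappa K p κ) : ¬ IsLocalNorm p K κ := by
  rintro ⟨x, hx⟩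
  have h1 := hilbertSymbol_norm hK x
  rw [hx, hκ.symbol] at h1
  norm_num at h1

theorem norm_discr_eq_one (h : ¬ IsRamified K p) : ‖(NumberField.discr K : ℚ_[p])‖ = 1 := by
  refine le_antisymm (Padic.norm_int_le_one _) (not_lt.1 fun hlt => h ?_)
  rwa [Padic.norm_intCast_lt_one_iff] at hlt

theorem norm_discr_lt_one (h : IsRamified K p) : ‖(NumberField.discr K : ℚ_[p])‖ < 1 := by
  rwa [Padic.norm_intCast_lt_one_iff]

theorem norm_absNorm_inv_different :
    ‖((FractionalIdeal.absNorm (different K)⁻¹ : ℚ) : ℚ_[p])‖ =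
      ‖(NumberField.discr K : ℚ_[p])‖⁻¹ := by
  rw [map_inv₀, Rat.cast_inv, norm_inv, norm_absNorm_different]

/-- An element of norm `p⁻¹` only exists if `p` is ramified. -/
theorem norm_norm_ne_inv_prime (h : Anisotropic p K) (hK : Module.finrank ℚ K = 2)
    (hram : ¬ IsRamified K p) (x : LocalAlg p K) : ‖Algebra.norm ℚ_[p] x‖ ≠ (p : ℝ)⁻¹ := by
  intro hx
  have hp1 := one_lt_prime_cast (p := p)
  have hp0 := prime_cast_pos (p := p)
  have hx0 : x ≠ 0 := by
    rintro rfl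
    have := norm_smul_of_finrank_two (finrank_localAlg (p := p) hK) (0 : ℚ_[p]) 0
    rw [zero_smul] at this
    rw [this] at hx
    simp at hx
    exact hp0.ne hx
  obtain ⟨y, hxy⟩ := h.exists_mul_eq_one hK hx0
  have hy := Anisotropic.norm_mul_norm_eq_one hxy
  rw [hx, inv_mul_eq_one₀ hp0.ne'] at hy
  obtain ⟨β, l, hβ, c, hc⟩ := exists_near y
  have hβN : ‖Algebra.norm ℚ_[p] (toLocal p β)‖ ≤ p := by
    have h1 : toLocal p β = y + (-1 : ℚ_[p]) • (y - toLocal p β) := by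
      rw [neg_one_smul]; ring
    rw [h1]
    refine (h.norm_add_le_max hK _ _).trans (max_le hy.ge ?_)
    rw [norm_smul_of_finrank_two (finrank_localAlg hK)]
    rw [h.mem_localInt_iff hK] at hβ
    simpa using hβ.trans hp1.le
  -- From `|Tr(β a)|² ≤ |N(β a)| ≤ p < p²` all these traces are integers. So `β` is in the inverse
  -- different, which for `p ∤ Δ` contains nothing of norm larger than `1`.
  have hβd : β ∈ (different K)⁻¹ := by
    rw [mem_inv_different_iff]
    intro a
    have hN : ‖Algebra.norm ℚ_[p] (toLocal p (β * a))‖ ≤ p := by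
      rw [toLocal_mul, map_mul, norm_mul, norm_toLocal (a : K)]
      exact (mul_le_of_le_one_right (norm_nonneg _) (norm_norm_ringOfIntegers_le_one a)).trans hβN
    have hT := (h.norm_trace_sq_le hK _).trans hN
    rw [trace_toLocal] at hT
    refine exists_int_trace_eq (p := p) (l := l) (c := c * a) ?_ ?_
    · rw [← smul_mul_assoc, ← hc]
      exact map_mul (algebraMap (𝓞 K) K) c a
    · by_contra! hlt
      have h0 : ((Algebra.trace ℚ K (β * a) : ℚ) : ℚ_[p]) ≠ 0 := by
        intro h0
        rw [h0, norm_zero] at hlt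
        linarith
      obtain ⟨k, hk⟩ := norm_eq_zpow h0
      rw [hk] at hlt hT
      have hk1 : 1 ≤ k := by
        have := (one_lt_zpow_iff_right₀ hp1).1 hlt
        omega
      have : (p : ℝ) ≤ (p : ℝ) ^ k := by
        simpa using zpow_le_zpow_right₀ hp1.le hk1
      nlinarith
  have hle := norm_norm_le_absNorm (p := p) (inv_ne_zero (different_ne_zero (K := K))) hβd
  rw [norm_absNorm_inv_different, norm_discr_eq_one hram, inv_one, ← norm_toLocal] at hle
  have : ‖Algebra.norm ℚ_[p] y‖ ≤ 1 := by
    rw [show y = (y - toLocal p β) + toLocal p β by ring]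
    exact (h.norm_add_le_max hK _ _).trans (max_le ((h.mem_localInt_iff hK _).1 hβ) hle)
  rw [← hy] at this
  linarith

theorem exists_norm_eq_zpow_two_mul (h : Anisotropic p K) (hK : Module.finrank ℚ K = 2)
    (hram : ¬ IsRamified K p) {a : ℚ_[p]} (ha : IsLocalNorm p K a) (ha0 : a ≠ 0) :
    ∃ j : ℤ, ‖a‖ = (p : ℝ) ^ (2 * j) := by
  have hp0 := prime_cast_pos (p := p)
  obtain ⟨x, rfl⟩ := ha
  obtain ⟨k, hk⟩ := norm_eq_zpow ha0
  rcases Int.even_or_odd' k with ⟨j, rfl | rfl⟩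
  · exact ⟨j, hk⟩
  · exfalso
    apply norm_norm_ne_inv_prime h hK hram ((p : ℚ_[p]) ^ (j + 1) • x)
    rw [norm_smul_of_finrank_two (finrank_localAlg hK), norm_mul, hk, norm_pow, norm_zpow,
      Padic.norm_p, inv_zpow', ← zpow_natCast, ← zpow_mul, ← zpow_add₀ hp0.ne', ← zpow_neg_one]
    congr 1
    push_cast
    ring

/-- If `p` is ramified and odd, then `p` exactly divides the discriminant, and the inverse
different contains an element whose norm has absolute value `p`. -/
theorem exists_mem_inv_different (h : Anisotropic p K) (hK : Module.finrank ℚ K = 2)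
    (hram : IsRamified K p) (hp2 : p ≠ 2) :
    ‖(NumberField.discr K : ℚ_[p])‖ = (p : ℝ)⁻¹ ∧
      ∃ α ∈ (different K)⁻¹, ‖((Algebra.norm ℚ α : ℚ) : ℚ_[p])‖ = p := by
  have hp1 := one_lt_prime_cast (p := p)
  have hp0 := prime_cast_pos (p := p)
  have hF := finrank_localAlg (p := p) hK
  obtain ⟨α, hα, hαN⟩ := exists_mem_norm_norm_eq (p := p)
    (inv_ne_zero (different_ne_zero (K := K)))
  rw [norm_absNorm_inv_different] at hαN
  have hΔ0 : (NumberField.discr K : ℚ_[p]) ≠ 0 := by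
    exact_mod_cast NumberField.discr_ne_zero K
  obtain ⟨k, hk⟩ := norm_eq_zpow hΔ0
  have hlt := norm_discr_lt_one hram
  rw [hk, zpow_lt_one_iff_right₀ hp1] at hlt
  have htr : ∀ y ∈ localInt p K,
      ‖Algebra.trace ℚ_[p] (LocalAlg p K) (toLocal p α * y)‖ ≤ 1 := by
    intro y hy
    induction hy using Submodule.span_induction with
    | mem y hy =>
      obtain ⟨w, hw, rfl⟩ := hy
      obtain ⟨z, rfl⟩ := (FractionalIdeal.mem_one_iff _).1 hw
      obtain ⟨n, hn⟩ := (mem_inv_different_iff α).1 hα z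
      rw [← toLocal_mul, trace_toLocal, hn]
      simpa using Padic.norm_int_le_one (p := p) n
    | zero => simp
    | add x y _ _ hx hy =>
      rw [mul_add, map_add]
      exact (IsUltrametricDist.norm_add_le_max _ _).trans (max_le hx hy)
    | smul a x _ hx =>
      rw [show a • x = (a : ℚ_[p]) • x from (algebraMap_smul ℚ_[p] a x).symm, mul_smul_comm,
        map_smul, norm_smul]
      exact mul_le_one₀ a.2 (norm_nonneg _) hx
  -- If `p² ∣ Δ`, then `p⁻¹ α⁻¹` is integral, and its product with `α` has trace `2 / p`. For odd
  -- `p` this contradicts `α ∈ ∂⁻¹`.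
  have hk1 : k = -1 := by
    by_contra hne
    have hk2 : k ≤ -2 := by omega
    have hα0 : toLocal p α ≠ 0 := by
      intro h0
      rw [← norm_toLocal, h0] at hαN
      have := norm_smul_of_finrank_two hF (0 : ℚ_[p]) 0
      rw [zero_smul] at this
      rw [this] at hαN
      simp at hαN
      exact hΔ0 (norm_eq_zero.1 hαN.symm)
    obtain ⟨γ, hγ⟩ := h.exists_mul_eq_one hK hα0
    have hγN := Anisotropic.norm_mul_norm_eq_one hγ
    rw [norm_toLocal, hαN, hk, inv_mul_eq_one₀ (zpow_ne_zero _ hp0.ne')] at hγN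
    have hmem : (p : ℚ_[p])⁻¹ • γ ∈ localInt p K := by
      rw [h.mem_localInt_iff hK, norm_smul_of_finrank_two hF, norm_mul, norm_pow, norm_inv,
        Padic.norm_p, inv_inv, ← hγN, ← zpow_natCast, ← zpow_add₀ hp0.ne']
      exact zpow_le_one_of_nonpos₀ hp1.le (by push_cast; omega)
    have := htr _ hmem
    rw [mul_smul_comm, hγ, map_smul, trace_one_of_finrank_two hF, norm_smul,
      norm_two_of_ne_two hp2, norm_inv, Padic.norm_p, inv_inv, mul_one] at this
    linarith
  subst hk1
  rw [hk, zpow_neg_one, inv_inv] at hαN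
  exact ⟨by rw [hk, zpow_neg_one], α, hα, hαN⟩

/-- For ramified `p` the integer `π = Δ α` has norm exactly divisible by `p`, so some prime above
`p` divides it. If `(p)` were prime, then `p ∣ π` and `p² ∣ N π`. -/
theorem not_isRamified_of_isInert (h : Anisotropic p K) (hK : Module.finrank ℚ K = 2)
    (hp2 : IsRamified K p → p ≠ 2) (hin : IsInert K p) : ¬ IsRamified K p := by
  intro hram
  have hp1 := one_lt_prime_cast (p := p)
  have hp0 := prime_cast_pos (p := p)
  have hpp : Prime (p : ℤ) := Nat.prime_iff_prime_int.1 Fact.out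
  obtain ⟨hΔ, α, hα, hαN⟩ := exists_mem_inv_different h hK hram (hp2 hram)
  have hΔα : algebraMap (𝓞 K) K (NumberField.discr K : 𝓞 K) * α ∈
      (1 : FractionalIdeal (𝓞 K)⁰ K) := by
    rw [← mul_inv_cancel₀ (different_ne_zero (K := K))]
    exact FractionalIdeal.mul_mem_mul ((FractionalIdeal.mem_coeIdeal _).2
      ⟨_, NumberField.discr_mem_differentIdeal K (𝓞 K), rfl⟩) hα
  obtain ⟨π, hπ⟩ := (FractionalIdeal.mem_one_iff _).1 hΔα
  have hNπ : ‖((Algebra.norm ℤ π : ℤ) : ℚ_[p])‖ = (p : ℝ)⁻¹ := by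
    have : ((Algebra.norm ℤ π : ℤ) : ℚ) = (NumberField.discr K : ℚ) ^ 2 * Algebra.norm ℚ α := by
      rw [Algebra.coe_norm_int, show (π : K) = algebraMap (𝓞 K) K π from rfl, hπ, map_intCast,
        ← norm_smul_of_finrank_two hK, Algebra.smul_def]
      simp
    have h2 := congrArg (fun q : ℚ => (q : ℚ_[p])) this
    push_cast at h2
    rw [h2, norm_mul, norm_pow, hΔ, hαN]
    field_simp
  have hdvd : (p : ℤ) ∣ (Ideal.absNorm (Ideal.span {π}) : ℤ) := by
    rw [Ideal.absNorm_span_singleton, Int.natCast_natAbs, dvd_abs,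
      ← Padic.norm_intCast_lt_one_iff, hNπ]
    exact inv_lt_one_of_one_lt₀ hp1
  obtain ⟨P, hP, hPp, hPd⟩ := Ideal.exists_isMaximal_dvd_of_dvd_absNorm hpp _ hdvd
  have hle : Ideal.span {(p : 𝓞 K)} ≤ P := by
    rw [Ideal.span_singleton_le_iff_mem]
    have : (p : ℤ) ∈ Ideal.under ℤ P := by
      rw [hPp]; exact Ideal.mem_span_singleton_self _
    simpa [Ideal.mem_comap] using this
  have hpne : Ideal.span {(p : 𝓞 K)} ≠ ⊥ := by
    rw [Ne, Ideal.span_singleton_eq_bot]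
    exact_mod_cast (Fact.out : p.Prime).ne_zero
  have hmax : (Ideal.span {(p : 𝓞 K)}).IsMaximal := Ideal.IsPrime.isMaximal hin hpne
  have hPe : Ideal.span {(p : 𝓞 K)} = P := hmax.eq_of_le hP.ne_top hle
  rw [← hPe, Ideal.dvd_span_singleton, Ideal.mem_span_singleton] at hPd
  obtain ⟨w, hw⟩ := hPd
  have : (Algebra.norm ℚ (π : K) : ℚ) = (p : ℚ) ^ 2 * Algebra.norm ℚ (w : K) := by
    rw [hw, ← norm_smul_of_finrank_two hK, Algebra.smul_def]
    simp
  rw [← Algebra.coe_norm_int, ← Algebra.coe_norm_int] at this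
  have h2 := congrArg (fun q : ℚ => (q : ℚ_[p])) this
  push_cast at h2
  rw [h2, norm_mul, norm_pow, Padic.norm_p] at hNπ
  have h3 := Padic.norm_int_le_one (p := p) (Algebra.norm ℤ w)
  have hpi : (0 : ℝ) < (p : ℝ)⁻¹ := by positivity
  have hpi1 : (p : ℝ)⁻¹ < 1 := inv_lt_one_of_one_lt₀ hp1
  nlinarith [mul_pos hpi hpi]

end NormGroup

/-! ### The norm group of `k_p` has index two. -/

section NormIndex

theorem zmod_two_eq_one : ∀ y : ZMod 2, y ≠ 0 → y = 1 := by decide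

theorem zmod_two_isSquare : ∀ y : ZMod 2, IsSquare y := by decide

variable {p : ℕ} [Fact p.Prime] {K : Type*} [Field K] [NumberField K]

theorem toZMod_eq_zero_iff (x : ℤ_[p]) : PadicInt.toZMod x = 0 ↔ ‖x‖ < 1 := by
  rw [← RingHom.mem_ker, PadicInt.ker_toZMod, IsLocalRing.mem_maximalIdeal, PadicInt.mem_nonunits]

theorem div_mem_ball_one {u v : ℤ_[p]} (hv : PadicInt.toZMod v ≠ 0)
    (huv : PadicInt.toZMod u = PadicInt.toZMod v) :
    (u : ℚ_[p]) / v ∈ Metric.ball (1 : ℚ_[p]) 1 := by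
  have hv1 : ‖v‖ = 1 := le_antisymm v.2 (not_lt.1 fun h => hv ((toZMod_eq_zero_iff v).2 h))
  have huv' : ‖u - v‖ < 1 := by rw [← toZMod_eq_zero_iff, map_sub, huv, sub_self]
  rw [PadicInt.norm_def] at hv1 huv'
  have hv0 : (v : ℚ_[p]) ≠ 0 := by
    rw [← norm_ne_zero_iff, hv1]; exact one_ne_zero
  rw [Metric.mem_ball, dist_eq_norm, show (u : ℚ_[p]) / v - 1 = (u - v) / v by field_simp,
    norm_div, hv1, div_one]
  exact_mod_cast huv'

/-- Otherwise all traces of integers are divisible by `p`, and `1 / p` lies in the inverse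
different, whose norm is a unit at an unramified `p`. -/
theorem exists_trace_norm_eq_one (h : Anisotropic p K) (hK : Module.finrank ℚ K = 2)
    (hram : ¬ IsRamified K p) :
    ∃ ω ∈ localInt p K, ‖Algebra.trace ℚ_[p] (LocalAlg p K) ω‖ = 1 := by
  by_contra! hne
  have hF := finrank_localAlg (p := p) hK
  have hlt : ∀ ω ∈ localInt p K, ‖Algebra.trace ℚ_[p] (LocalAlg p K) ω‖ < 1 := fun ω hω =>
    lt_of_le_of_ne (h.norm_trace_le_one hK ((h.mem_localInt_iff hK ω).1 hω)) (hne ω hω)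
  have h1 : (p : K)⁻¹ ∈ (different K)⁻¹ := by
    rw [mem_inv_different_iff]
    intro c
    have hc := hlt _ (toLocal_mem_localInt c)
    rw [trace_toLocal, ← Algebra.coe_trace_int] at hc
    have hc' : ‖((Algebra.trace ℤ (𝓞 K) c : ℤ) : ℚ_[p])‖ < 1 := by simpa using hc
    rw [Padic.norm_intCast_lt_one_iff] at hc'
    obtain ⟨z, hz⟩ := hc'
    refine ⟨z, ?_⟩
    have hp' : (p : ℚ) ≠ 0 := by exact_mod_cast (Fact.out : p.Prime).ne_zero
    have : (p : K)⁻¹ * c = ((p : ℚ)⁻¹) • (c : K) := by rw [Algebra.smul_def]; simp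
    rw [this, map_smul, ← Algebra.coe_trace_int, hz, smul_eq_mul]
    push_cast
    field_simp
  have hle := norm_norm_le_absNorm (p := p) (inv_ne_zero (different_ne_zero (K := K))) h1
  have hp1 := one_lt_prime_cast (p := p)
  rw [norm_absNorm_inv_different, norm_discr_eq_one hram, inv_one,
    show (p : K)⁻¹ = (p : ℚ)⁻¹ • (1 : K) by rw [Algebra.smul_def]; simp,
    norm_smul_of_finrank_two hK, map_one] at hle
  push_cast at hle
  rw [mul_one, norm_pow, norm_inv, Padic.norm_p, inv_inv] at hle
  nlinarith

/-- The elements of `1 + p ℤ_p` are norms. -/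
theorem isLocalNorm_of_mem_ball_one (h : Anisotropic p K) (hK : Module.finrank ℚ K = 2)
    (hp2 : IsRamified K p → p ≠ 2) {w : ℚ_[p]} (hw : w ∈ Metric.ball (1 : ℚ_[p]) 1) :
    IsLocalNorm p K w := by
  by_cases h2 : p = 2
  · have hram : ¬ IsRamified K p := fun hr => hp2 hr h2
    obtain ⟨ω, hω, hωT⟩ := exists_trace_norm_eq_one h hK hram
    have hωN := (h.mem_localInt_iff hK ω).1 hω
    have hωN1 : ‖Algebra.norm ℚ_[p] ω‖ = 1 := by
      refine le_antisymm hωN ?_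
      have := h.norm_trace_sq_le hK ω
      rwa [hωT, one_pow] at this
    obtain ⟨T, hT⟩ : ∃ T : ℤ_[p], (T : ℚ_[p]) = Algebra.trace ℚ_[p] (LocalAlg p K) ω :=
      ⟨⟨_, hωT.le⟩, rfl⟩
    obtain ⟨N, hN⟩ : ∃ N : ℤ_[p], (N : ℚ_[p]) = Algebra.norm ℚ_[p] ω := ⟨⟨_, hωN⟩, rfl⟩
    have hwn : ‖w‖ = 1 := by
      have := norm_eq_of_mem_ball_norm (y := w) (z := 1) (by rwa [norm_one])
      rw [this, norm_one]
    obtain ⟨u, hu⟩ : ∃ u : ℤ_[p], (u : ℚ_[p]) = w := ⟨⟨_, hwn.le⟩, rfl⟩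
    rw [← hT, ← PadicInt.norm_def] at hωT
    rw [← hN, ← PadicInt.norm_def] at hωN1
    rw [← hu, ← PadicInt.norm_def] at hwn
    have hunit : ∀ x : ℤ_[p], ‖x‖ = 1 → PadicInt.toZMod x = 1 := by
      intro x hx
      have h0 : PadicInt.toZMod x ≠ 0 := fun h0 => by
        rw [toZMod_eq_zero_iff, hx] at h0
        exact lt_irrefl _ h0
      subst h2
      revert h0
      exact zmod_two_eq_one _
    -- Solve `N(z + ω) = z² + T z + N = w` by Hensel at `z = 0`: the derivative `T` is a unit, and
    -- `N ≡ w` because all units are congruent modulo `2`.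
    obtain ⟨z, hz⟩ := exists_root_quadratic T (N - u) 0 (by
      rw [show (0 : ℤ_[p]) ^ 2 + T * 0 + (N - u) = N - u by ring,
        show (2 : ℤ_[p]) * 0 + T = T by ring, hωT, one_pow, ← toZMod_eq_zero_iff, map_sub,
        hunit N hωN1, hunit u hwn, sub_self])
    refine ⟨algebraMap ℚ_[p] (LocalAlg p K) z + ω, ?_⟩
    rw [norm_algebraMap_add_of_finrank_two (finrank_localAlg hK), ← hT, ← hN, ← hu]
    have := congrArg (fun y : ℤ_[p] => (y : ℚ_[p])) hz
    push_cast at this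
    linear_combination this
  · obtain ⟨a, rfl⟩ := exists_sq_eq h2 hw
    exact isLocalNorm_sq hK a

theorem isLocalNorm_of_toZMod_eq (h : Anisotropic p K) (hK : Module.finrank ℚ K = 2)
    (hp2 : IsRamified K p → p ≠ 2) {u v : ℤ_[p]} (hv : PadicInt.toZMod v ≠ 0)
    (huv : PadicInt.toZMod u = PadicInt.toZMod v) (hvn : IsLocalNorm p K v) :
    IsLocalNorm p K u := by
  have := hvn.mul (isLocalNorm_of_mem_ball_one h hK hp2 (div_mem_ball_one hv huv))
  have hv0 : (v : ℚ_[p]) ≠ 0 := by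
    intro h0
    apply hv
    rw [show v = 0 from Subtype.ext h0, map_zero]
  rwa [mul_div_cancel₀ _ hv0] at this

theorem isLocalNorm_of_isSquare (h : Anisotropic p K) (hK : Module.finrank ℚ K = 2)
    (hp2 : IsRamified K p → p ≠ 2) {u : ℤ_[p]} (hu : PadicInt.toZMod u ≠ 0)
    (hsq : IsSquare (PadicInt.toZMod u)) : IsLocalNorm p K u := by
  obtain ⟨s, hs⟩ := hsq
  obtain ⟨v, rfl⟩ := ZMod.ringHom_surjective (PadicInt.toZMod (p := p)) s
  rw [← map_mul] at hs
  refine isLocalNorm_of_toZMod_eq h hK hp2 (by rwa [← hs]) hs ?_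
  push_cast
  rw [← pow_two]
  exact isLocalNorm_sq hK _

/-- For `p = 2` every residue is a square. For odd `p`, `-d = N θ` has even valuation, so after
scaling `θ` the norm form is `a² - e b²` with `e` a unit, and this form takes every value in `𝔽_p`.
-/
theorem isLocalNorm_unit_of_not_isRamified (h : Anisotropic p K) (hK : Module.finrank ℚ K = 2)
    (hram : ¬ IsRamified K p) {u : ℤ_[p]} (hu : PadicInt.toZMod u ≠ 0) : IsLocalNorm p K u := by
  have hp2 : IsRamified K p → p ≠ 2 := fun hr => absurd hr hram
  by_cases h2 : p = 2
  · refine isLocalNorm_of_isSquare h hK hp2 hu ?_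
    subst h2
    exact zmod_two_isSquare _
  · obtain ⟨d, q, θ, hd, hq, hdisc, htr, hN, hco⟩ := exists_sqrt (p := p) hK
    have hp0 := prime_cast_pos (p := p)
    have hdp : (d : ℚ_[p]) ≠ 0 := by exact_mod_cast hd
    obtain ⟨j, hj⟩ := exists_norm_eq_zpow_two_mul h hK hram (a := -(d : ℚ_[p]))
      ⟨toLocal p θ, by rw [norm_toLocal, hN]; push_cast; rfl⟩ (neg_ne_zero.2 hdp)
    rw [norm_neg] at hj
    set s : ℚ_[p] := (p : ℚ_[p]) ^ j with hs
    have hd1 : ‖(d : ℚ_[p]) * s ^ 2‖ = 1 := by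
      rw [norm_mul, hj, norm_pow, hs, norm_zpow, Padic.norm_p, inv_zpow', ← zpow_natCast,
        ← zpow_mul, ← zpow_add₀ hp0.ne']
      norm_num
      rw [show 2 * j + -(j * 2) = 0 by ring, zpow_zero]
    obtain ⟨e, he⟩ : ∃ e : ℤ_[p], (e : ℚ_[p]) = d * s ^ 2 := ⟨⟨_, hd1.le⟩, rfl⟩
    have he0 : PadicInt.toZMod e ≠ 0 := by
      rw [Ne, toZMod_eq_zero_iff, PadicInt.norm_def, he, hd1]
      exact lt_irrefl _
    obtain ⟨a, b, hab⟩ := FiniteField.exists_root_sum_quadratic (R := ZMod p)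
      (f := Polynomial.X ^ 2 - Polynomial.C (PadicInt.toZMod u))
      (g := Polynomial.C (-(PadicInt.toZMod e)) * Polynomial.X ^ 2)
      (Polynomial.degree_X_pow_sub_C two_pos _)
      (Polynomial.degree_C_mul_X_pow 2 (neg_ne_zero.2 he0))
      (by
        rw [ZMod.card]
        exact Nat.odd_iff.1 ((Fact.out : p.Prime).odd_of_ne_two h2))
    obtain ⟨a, rfl⟩ := ZMod.ringHom_surjective (PadicInt.toZMod (p := p)) a
    obtain ⟨b, rfl⟩ := ZMod.ringHom_surjective (PadicInt.toZMod (p := p)) b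
    simp only [Polynomial.eval_sub, Polynomial.eval_pow, Polynomial.eval_X, Polynomial.eval_C,
      Polynomial.eval_mul] at hab
    have huv : PadicInt.toZMod u = PadicInt.toZMod (a ^ 2 - e * b ^ 2) := by
      rw [map_sub, map_mul, map_pow, map_pow]
      linear_combination -hab
    refine isLocalNorm_of_toZMod_eq h hK hp2 (huv ▸ hu) huv
      ⟨algebraMap ℚ_[p] (LocalAlg p K) a + (s * b) • toLocal p θ, ?_⟩
    rw [norm_coords hK htr hN]
    push_cast
    rw [he]
    ring

theorem exists_padicInt_unit {a : ℚ_[p]} (ha : ‖a‖ = 1) :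
    ∃ u : ℤ_[p], (u : ℚ_[p]) = a ∧ PadicInt.toZMod u ≠ 0 :=
  ⟨⟨a, ha.le⟩, rfl, fun h => absurd ((toZMod_eq_zero_iff _).1 h) (not_lt.2 ha.ge)⟩

theorem isLocalNorm_iff_of_not_isRamified (h : Anisotropic p K) (hK : Module.finrank ℚ K = 2)
    (hram : ¬ IsRamified K p) {a : ℚ_[p]} (ha0 : a ≠ 0) :
    IsLocalNorm p K a ↔ ∃ j : ℤ, ‖a‖ = (p : ℝ) ^ (2 * j) := by
  refine ⟨fun ha => exists_norm_eq_zpow_two_mul h hK hram ha ha0, fun ⟨j, hj⟩ => ?_⟩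
  have hp0 := prime_cast_pos (p := p)
  set s : ℚ_[p] := (p : ℚ_[p]) ^ j with hs
  have hs0 : s ≠ 0 := zpow_ne_zero _ prime_cast_ne_zero
  have h1 : ‖a * s ^ 2‖ = 1 := by
    rw [norm_mul, hj, norm_pow, hs, norm_zpow, Padic.norm_p, inv_zpow', ← zpow_natCast,
      ← zpow_mul, ← zpow_add₀ hp0.ne']
    norm_num
    rw [show 2 * j + -(j * 2) = 0 by ring, zpow_zero]
  obtain ⟨u, hu, hu0⟩ := exists_padicInt_unit h1
  have := (isLocalNorm_unit_of_not_isRamified h hK hram hu0).div hK (isLocalNorm_sq hK s)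
  rwa [hu, mul_div_cancel_right₀ _ (pow_ne_zero 2 hs0)] at this

theorem isSquare_mul_of_not_isSquare {F : Type*} [Field F] [Finite F] {a b : F}
    (ha : ¬ IsSquare a) (hb : ¬ IsSquare b) : IsSquare (a * b) := by
  classical
  have := Fintype.ofFinite F
  have ha0 : a ≠ 0 := fun h => ha (h ▸ IsSquare.zero)
  have hb0 : b ≠ 0 := fun h => hb (h ▸ IsSquare.zero)
  rw [← quadraticChar_neg_one_iff_not_isSquare] at ha hb
  rw [← quadraticChar_one_iff_isSquare (mul_ne_zero ha0 hb0), map_mul, ha, hb]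
  norm_num

/-- The norm group has index two. -/
theorem isLocalNorm_or_mul (h : Anisotropic p K) (hK : Module.finrank ℚ K = 2)
    (hp2 : IsRamified K p → p ≠ 2) {κ : ℚ_[p]} (hκ : IsKappa K p κ) {a : ℚ_[p]} (ha : a ≠ 0) :
    IsLocalNorm p K a ∨ IsLocalNorm p K (a * κ) := by
  have hp0 := prime_cast_pos (p := p)
  have hp1 := one_lt_prime_cast (p := p)
  have hκN := Padic.norm_eq_zpow_neg_valuation hκ.ne_zero
  obtain ⟨k, hk⟩ := norm_eq_zpow ha
  by_cases hram : IsRamified K p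
  · rw [hκ.ord_ramified hram, neg_zero, zpow_zero] at hκN
    obtain ⟨-, α, -, hα⟩ := exists_mem_inv_different h hK hram (hp2 hram)
    set b : ℚ_[p] := ((Algebra.norm ℚ α : ℚ) : ℚ_[p]) with hb
    have hbn : IsLocalNorm p K b := ⟨toLocal p α, norm_toLocal α⟩
    have hb0 : b ≠ 0 := by
      rw [← norm_ne_zero_iff, hα]; exact hp0.ne'
    have hbk : IsLocalNorm p K (b ^ k) := by
      have hpow : ∀ n : ℕ, IsLocalNorm p K (b ^ n) := by
        intro n
        induction n with
        | zero => exact ⟨1, by rw [map_one, pow_zero]⟩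
        | succ n ih => rw [pow_succ]; exact ih.mul hbn
      rcases Int.eq_nat_or_neg k with ⟨n, rfl | rfl⟩
      · rw [zpow_natCast]; exact hpow n
      · rw [zpow_neg, zpow_natCast]; exact (hpow n).inv hK
    have hu : ‖a / b ^ k‖ = 1 := by
      rw [norm_div, norm_zpow, hk, hα, div_self (zpow_ne_zero _ hp0.ne')]
    obtain ⟨u, hu, hu0⟩ := exists_padicInt_unit hu
    obtain ⟨v, hv, hv0⟩ := exists_padicInt_unit hκN
    have hua : a = u * b ^ k := by rw [hu, div_mul_cancel₀ _ (zpow_ne_zero _ hb0)]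
    by_cases hus : IsSquare (PadicInt.toZMod u)
    · left
      rw [hua]
      exact (isLocalNorm_of_isSquare h hK hp2 hu0 hus).mul hbk
    · right
      -- Units with square residue are norms, so the non-norm `κ` has non-square residue, and a
      -- product of two non-squares in `𝔽_p` is a square.
      have hvs : ¬ IsSquare (PadicInt.toZMod v) := fun hvs => by
        have := isLocalNorm_of_isSquare h hK hp2 hv0 hvs
        rw [hv] at this
        exact not_isLocalNorm_of_isKappa hK hκ this
      have huv := isSquare_mul_of_not_isSquare hus hvs
      rw [← map_mul] at huv
      have := isLocalNorm_of_isSquare h hK hp2 (by rw [map_mul]; exact mul_ne_zero hu0 hv0) huv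
      push_cast at this
      rw [hua, ← hv, mul_right_comm]
      exact this.mul hbk
  · rw [hκ.ord_unramified hram] at hκN
    rw [isLocalNorm_iff_of_not_isRamified h hK hram ha,
      isLocalNorm_iff_of_not_isRamified h hK hram (mul_ne_zero ha hκ.ne_zero), norm_mul, hκN, hk]
    -- Without ramification, norms are the elements of even valuation, and `κ` shifts the parity.
    rcases Int.even_or_odd' k with ⟨j, rfl | rfl⟩
    · exact Or.inl ⟨j, rfl⟩
    · refine Or.inr ⟨j, ?_⟩
      rw [← zpow_add₀ hp0.ne']
      congr 1
      ring

end NormIndex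

/-! ### Haar measure on `k_p` and the image measure under the norm. -/

section NormDensity

variable {p : ℕ} [Fact p.Prime] {K : Type*} [Field K] [NumberField K]

variable (p K) in
/-- The coordinate space of `k_p`. -/
abbrev Coords : Type _ := Module.Free.ChooseBasisIndex ℤ (𝓞 K) → ℚ_[p]

variable (p K) in
/-- The coordinates with respect to the integral basis. -/
def coordEquiv : Coords p K ≃ₗ[ℚ_[p]] LocalAlg p K := (localBasis p K).equivFun.symm

theorem coordEquiv_apply (x : Coords p K) : coordEquiv p K x = ∑ i, x i • localBasis p K i :=
  Module.Basis.equivFun_symm_apply _ _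

instance : (volume : Measure (Coords p K)).IsAddHaarMeasure :=
  inferInstanceAs (Measure.pi fun _ => (volume : Measure ℚ_[p])).IsAddHaarMeasure

instance : (volume : Measure (Coords p K)).Regular :=
  Measure.Regular.of_sigmaCompactSpace_of_isLocallyFiniteMeasure _

/-- The norm form in coordinates. -/
def coordNorm (x : Coords p K) : ℚ_[p] := Algebra.norm ℚ_[p] (coordEquiv p K x)

theorem continuous_coordNorm : Continuous (coordNorm : Coords p K → ℚ_[p]) := by
  classical
  have h : ∀ x : Coords p K, coordNorm x =
      ((Algebra.leftMulMatrix (localBasis p K)).toLinearMap (coordEquiv p K x)).det := fun x =>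
    Algebra.norm_eq_matrix_det (localBasis p K) _
  have h2 : Continuous ((Algebra.leftMulMatrix (localBasis p K)).toLinearMap ∘ₗ
      (coordEquiv p K).toLinearMap) := LinearMap.continuous_of_finiteDimensional _
  rw [funext h]
  exact h2.matrix_det

@[fun_prop] theorem measurable_coordNorm : Measurable (coordNorm : Coords p K → ℚ_[p]) :=
  continuous_coordNorm.measurable

/-- Multiplication by an element of `k_p` in coordinates. -/
def mulCoords (v : LocalAlg p K) : Coords p K →ₗ[ℚ_[p]] Coords p K :=
  (coordEquiv p K).symm.toLinearMap ∘ₗ LinearMap.mulLeft ℚ_[p] v ∘ₗ (coordEquiv p K).toLinearMap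

theorem coordEquiv_mulCoords (v : LocalAlg p K) (x : Coords p K) :
    coordEquiv p K (mulCoords v x) = v * coordEquiv p K x :=
  (coordEquiv p K).apply_symm_apply _

theorem mulCoords_mulCoords {v w : LocalAlg p K} (h : v * w = 1) (x : Coords p K) :
    mulCoords v (mulCoords w x) = x := by
  apply (coordEquiv p K).injective
  rw [coordEquiv_mulCoords, coordEquiv_mulCoords, ← mul_assoc, h, one_mul]

/-- Multiplication by a unit of `k_p` in coordinates. -/
def unitMul (v : (LocalAlg p K)ˣ) : Coords p K ≃ₜ+ Coords p K where
  toFun := mulCoords (v : LocalAlg p K)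
  invFun := mulCoords (↑v⁻¹ : LocalAlg p K)
  left_inv := mulCoords_mulCoords v.inv_mul
  right_inv := mulCoords_mulCoords v.mul_inv
  map_add' := map_add _
  continuous_toFun := LinearMap.continuous_of_finiteDimensional _
  continuous_invFun := LinearMap.continuous_of_finiteDimensional _

theorem coordEquiv_unitMul (v : (LocalAlg p K)ˣ) (x : Coords p K) :
    coordEquiv p K (unitMul v x) = v * coordEquiv p K x :=
  coordEquiv_mulCoords _ _

theorem coordNorm_unitMul (v : (LocalAlg p K)ˣ) (x : Coords p K) :
    coordNorm (unitMul v x) = Algebra.norm ℚ_[p] (v : LocalAlg p K) * coordNorm x := by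
  rw [coordNorm, coordEquiv_unitMul, map_mul]; rfl

theorem Anisotropic.norm_coordNorm_le_one_iff (h : Anisotropic p K)
    (hK : Module.finrank ℚ K = 2) (x : Coords p K) :
    ‖coordNorm x‖ ≤ 1 ↔ x ∈ Metric.closedBall (0 : Coords p K) 1 := by
  rw [coordNorm, ← h.mem_localInt_iff hK, mem_localInt_iff_repr, mem_closedBall_zero_iff,
    pi_norm_le_iff_of_nonneg zero_le_one]
  have : ∀ i, (localBasis p K).repr (coordEquiv p K x) i = x i := by
    intro i
    rw [coordEquiv_apply, Module.Basis.repr_sum_self]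
  simp_rw [this]

theorem card_basisIndex (hK : Module.finrank ℚ K = 2) :
    Fintype.card (Module.Free.ChooseBasisIndex ℤ (𝓞 K)) = 2 := by
  rw [← Module.finrank_eq_card_basis (NumberField.integralBasis K), hK]

theorem volume_closedBall_coords (hK : Module.finrank ℚ K = 2) (a : ℚ_[p]) (ha : a ≠ 0) :
    volume (Metric.closedBall (0 : Coords p K) ‖a‖) = (‖a‖₊ : ENNReal) ^ 2 := by
  rw [volume_pi_closedBall _ (norm_nonneg a)]
  simp only [Pi.zero_apply, volume_closedBall_norm a ha, Finset.prod_const, Finset.card_univ,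
    card_basisIndex hK]

/-- The modulus of multiplication by `v`. -/
def modulus (v : (LocalAlg p K)ˣ) : NNReal := addEquivAddHaarChar (unitMul v)

theorem modulus_mul (v w : (LocalAlg p K)ˣ) : modulus (v * w) = modulus v * modulus w := by
  rw [modulus, modulus, modulus, mul_comm (addEquivAddHaarChar _), ← addEquivAddHaarChar_trans]
  congr 1
  ext x : 1
  apply (coordEquiv p K).injective
  rw [coordEquiv_unitMul, ContinuousAddEquiv.trans_apply, coordEquiv_unitMul, coordEquiv_unitMul,
    Units.val_mul, mul_assoc]

theorem modulus_of_norm_eq_one (h : Anisotropic p K) (hK : Module.finrank ℚ K = 2)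
    (v : (LocalAlg p K)ˣ) (hv : ‖Algebra.norm ℚ_[p] (v : LocalAlg p K)‖ = 1) : modulus v = 1 := by
  have := addEquivAddHaarChar_smul_preimage (volume : Measure (Coords p K))
    (X := Metric.closedBall 0 1) (unitMul v)
  have hpre : unitMul v ⁻¹' Metric.closedBall (0 : Coords p K) 1 = Metric.closedBall 0 1 := by
    ext x
    rw [Set.mem_preimage, ← h.norm_coordNorm_le_one_iff hK, ← h.norm_coordNorm_le_one_iff hK,
      coordNorm_unitMul, norm_mul, hv, one_mul]
  have hvol : volume (Metric.closedBall (0 : Coords p K) 1) = 1 := by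
    have := volume_closedBall_coords hK (1 : ℚ_[p]) one_ne_zero
    rw [norm_one] at this
    rw [this]; simp
  rw [hpre, hvol, ENNReal.smul_def, smul_eq_mul, mul_one] at this
  exact_mod_cast this

theorem modulus_algebraMap (hK : Module.finrank ℚ K = 2) (v : (LocalAlg p K)ˣ) (a : ℚ_[p])
    (hv : (v : LocalAlg p K) = algebraMap ℚ_[p] (LocalAlg p K) a) (ha : a ≠ 0) :
    modulus v = ‖a‖₊ ^ 2 := by
  have := addEquivAddHaarChar_smul_preimage (volume : Measure (Coords p K))
    (X := Metric.closedBall 0 ‖a‖) (unitMul v)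
  have hpre : unitMul v ⁻¹' Metric.closedBall (0 : Coords p K) ‖a‖ = Metric.closedBall 0 1 := by
    ext x
    have hx : unitMul v x = a • x := by
      apply (coordEquiv p K).injective
      rw [coordEquiv_unitMul, hv, map_smul, Algebra.smul_def]
    rw [Set.mem_preimage, hx, mem_closedBall_zero_iff, mem_closedBall_zero_iff, norm_smul,
      mul_le_iff_le_one_right (norm_pos_iff.2 ha)]
  have hvol : volume (Metric.closedBall (0 : Coords p K) 1) = 1 := by
    have := volume_closedBall_coords hK (1 : ℚ_[p]) one_ne_zero
    rw [norm_one] at this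
    rw [this]; simp
  rw [hpre, hvol, volume_closedBall_coords hK a ha, ENNReal.smul_def, smul_eq_mul, mul_one] at this
  exact_mod_cast this

theorem norm_unit_ne_zero (v : (LocalAlg p K)ˣ) : Algebra.norm ℚ_[p] (v : LocalAlg p K) ≠ 0 :=
  (v.isUnit.map (Algebra.norm ℚ_[p])).ne_zero

/-- The element `v² / N(v)` has norm of absolute value `1`, hence preserves `O_{k,p}` and its
volume. So the square of the modulus of `v` is the modulus of the scalar `N(v)`, namely `|N(v)|²`.
-/
theorem modulus_eq (h : Anisotropic p K) (hK : Module.finrank ℚ K = 2) (v : (LocalAlg p K)ˣ) :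
    modulus v = ‖Algebra.norm ℚ_[p] (v : LocalAlg p K)‖₊ := by
  have hF := finrank_localAlg (p := p) hK
  have : Module.Finite ℚ_[p] (LocalAlg p K) := Module.finite_of_finrank_pos (by omega)
  set a := Algebra.norm ℚ_[p] (v : LocalAlg p K) with ha
  have ha0 : a ≠ 0 := norm_unit_ne_zero v
  let s : (LocalAlg p K)ˣ := Units.map (algebraMap ℚ_[p] (LocalAlg p K)).toMonoidHom
    (Units.mk0 a ha0)
  have hs : (s : LocalAlg p K) = algebraMap ℚ_[p] (LocalAlg p K) a := rfl
  have hu : ‖Algebra.norm ℚ_[p] ((v * v * s⁻¹ : (LocalAlg p K)ˣ) : LocalAlg p K)‖ = 1 := by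
    have h1 : Algebra.norm ℚ_[p] ((v * v * s⁻¹ : (LocalAlg p K)ˣ) : LocalAlg p K) *
        Algebra.norm ℚ_[p] (s : LocalAlg p K) = a * a := by
      rw [← map_mul, ← Units.val_mul, inv_mul_cancel_right, Units.val_mul, map_mul]
    rw [hs, Algebra.norm_algebraMap, hF, pow_two a] at h1
    rw [mul_right_cancel₀ (mul_ne_zero ha0 ha0) (h1.trans (one_mul _).symm), norm_one]
  have h1 := modulus_of_norm_eq_one h hK _ hu
  have h2 : modulus (v * v) = modulus (v * v * s⁻¹) * modulus s := by
    rw [← modulus_mul, inv_mul_cancel_right]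
  rw [h1, modulus_mul, modulus_algebraMap hK s a hs ha0, one_mul, ← pow_two] at h2
  exact (pow_left_inj₀ (by positivity) (by positivity) two_ne_zero).1 h2

theorem map_unitMul_volume (h : Anisotropic p K) (hK : Module.finrank ℚ K = 2)
    (v : (LocalAlg p K)ˣ) : (volume : Measure (Coords p K)).map (unitMul v) =
      ‖Algebra.norm ℚ_[p] (v : LocalAlg p K)‖₊⁻¹ • volume := by
  have h1 := addEquivAddHaarChar_smul_map (volume : Measure (Coords p K)) (unitMul v)
  rw [show addEquivAddHaarChar (unitMul v) = _ from modulus_eq h hK v] at h1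
  conv_rhs => rw [← h1]
  rw [smul_smul, inv_mul_cancel₀ (by simpa using norm_unit_ne_zero v), one_smul]

theorem measurable_unitMul (v : (LocalAlg p K)ˣ) : Measurable (unitMul v) :=
  (unitMul v).continuous.measurable

/-- The distribution of the norm form on a set of finite volume. -/
def normDistribution (A : Set (Coords p K)) : Measure ℚ_[p] :=
  (volume.restrict A).map coordNorm

theorem map_mul_normDistribution (h : Anisotropic p K) (hK : Module.finrank ℚ K = 2)
    {A : Set (Coords p K)} (hA : MeasurableSet A) (v : (LocalAlg p K)ˣ)
    (hv : ‖Algebra.norm ℚ_[p] (v : LocalAlg p K)‖ = 1) (hvA : unitMul v ⁻¹' A = A) :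
    (normDistribution A).map (fun x => Algebra.norm ℚ_[p] (v : LocalAlg p K) * x) =
      normDistribution A := by
  have hv' : ‖Algebra.norm ℚ_[p] (v : LocalAlg p K)‖₊ = 1 := NNReal.eq hv
  have h1 : (volume.restrict A).map (unitMul v) = volume.restrict A := by
    have := Measure.restrict_map (μ := (volume : Measure (Coords p K))) (measurable_unitMul v) hA
    rw [hvA, map_unitMul_volume h hK, hv', inv_one, one_smul] at this
    exact this.symm
  rw [normDistribution, Measure.map_map (by fun_prop) measurable_coordNorm]
  conv_rhs => rw [← h1, Measure.map_map measurable_coordNorm (measurable_unitMul v)]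
  congr 1
  ext x
  rw [Function.comp_apply, Function.comp_apply, coordNorm_unitMul]

theorem normDistribution_zero (h : Anisotropic p K) (hK : Module.finrank ℚ K = 2)
    (A : Set (Coords p K)) : normDistribution A {0} = 0 := by
  have : Nonempty (Module.Free.ChooseBasisIndex ℤ (𝓞 K)) := by
    rw [← Fintype.card_pos_iff, card_basisIndex hK]; norm_num
  rw [normDistribution, Measure.map_apply measurable_coordNorm (measurableSet_singleton 0)]
  have h0 : coordNorm ⁻¹' {0} ⊆ ({0} : Set (Coords p K)) := by
    intro x hx
    have := h _ hx
    simpa using this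
  have hv : (volume : Measure (Coords p K)) {0} = 0 := by
    rw [← nonpos_iff_eq_zero, ← ENNReal.coe_zero]
    exact (Measure.pi_singleton _ _).le.trans (by
      obtain ⟨i⟩ := this
      rw [Finset.prod_eq_zero (Finset.mem_univ i) (measure_singleton _)]; simp)
  exact measure_mono_null h0 (le_antisymm ((Measure.restrict_apply_le _ _).trans hv.le) (zero_le))

theorem isFiniteMeasure_normDistribution {A : Set (Coords p K)} (hA : volume A ≠ ⊤) :
    IsFiniteMeasure (normDistribution A) := by
  have : IsFiniteMeasure (volume.restrict A) := ⟨by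
    rw [Measure.restrict_apply_univ]; exact hA.lt_top⟩
  exact Measure.isFiniteMeasure_map _ _

end NormDensity

/-! ### The density of the norm form is constant on norms and zero elsewhere. -/

section NormDensity

variable {p : ℕ} [Fact p.Prime] {K : Type*} [Field K] [NumberField K]

variable (p K) in
/-- The volume of the set of elements of `k_p` with norm in `1 + p ℤ_p`. -/
def normVolume : ENNReal := volume (coordNorm ⁻¹' Metric.ball 1 1 : Set (Coords p K))

theorem Anisotropic.exists_unit (h : Anisotropic p K) (hK : Module.finrank ℚ K = 2)
    (x : LocalAlg p K) (hx : Algebra.norm ℚ_[p] x ≠ 0) :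
    ∃ v : (LocalAlg p K)ˣ, (v : LocalAlg p K) = x := by
  obtain ⟨y, hy⟩ := h.exists_mul_eq_one hK (x := x) (by
    rintro rfl
    apply hx
    rw [← zero_smul ℚ_[p] (1 : LocalAlg p K), norm_smul_of_finrank_two (finrank_localAlg hK)]
    ring)
  exact ⟨⟨x, y, hy, by rw [mul_comm, hy]⟩, rfl⟩

/-- `A` has finite volume, and every element of `1 + p ℤ_p` is the norm of an element of `k_p` which
stabilizes `A`. -/
structure IsNormInvariant (A : Set (Coords p K)) (R : ℝ) : Prop where
  measurableSet : MeasurableSet A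
  volume_ne_top : volume A ≠ ⊤
  norm_le : ∀ x ∈ A, ‖coordNorm x‖ ≤ R
  exists_unit : ∀ w ∈ Metric.ball (1 : ℚ_[p]) 1, ∃ v : (LocalAlg p K)ˣ,
    Algebra.norm ℚ_[p] (v : LocalAlg p K) = w ∧ unitMul v ⁻¹' A = A

theorem norm_eq_one_of_mem_ball {w : ℚ_[p]} (hw : w ∈ Metric.ball (1 : ℚ_[p]) 1) : ‖w‖ = 1 := by
  have := norm_eq_of_mem_ball_norm (p := p) (y := w) (z := 1) (by simpa using hw)
  simpa using this

/-- The density of the distribution of the norm form on `A`. -/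
def normDensity (A : Set (Coords p K)) (z : ℚ_[p]) : ℂ :=
  ((shellDensity (normDistribution A) z).toReal : ℂ)

/-- Multiplication by `v⁻¹` carries the elements with norm in `z (1 + p ℤ_p)` to those with norm in
`1 + p ℤ_p`. The resulting factor `|z|` is what `shellDensity` divides out, so the density does not
depend on the norm class representative. -/
theorem volume_preimage_ball (h : Anisotropic p K) (hK : Module.finrank ℚ K = 2)
    (v : (LocalAlg p K)ˣ) {z : ℚ_[p]} (hz : Algebra.norm ℚ_[p] (v : LocalAlg p K) = z) :
    volume (coordNorm ⁻¹' Metric.ball z ‖z‖ : Set (Coords p K)) = ‖z‖₊ * normVolume p K := by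
  have hz0 : z ≠ 0 := hz ▸ norm_unit_ne_zero v
  have hinv : Algebra.norm ℚ_[p] ((v⁻¹ : (LocalAlg p K)ˣ) : LocalAlg p K) = z⁻¹ := by
    apply eq_inv_of_mul_eq_one_left
    rw [← hz, ← map_mul, Units.inv_mul, map_one]
  have hpre : (coordNorm ⁻¹' Metric.ball z ‖z‖ : Set (Coords p K)) =
      unitMul v⁻¹ ⁻¹' (coordNorm ⁻¹' Metric.ball 1 1) := by
    ext x
    simp only [Set.mem_preimage]
    rw [coordNorm_unitMul, hinv, ← mul_mem_ball_norm_iff hz0, mul_inv_cancel_left₀ hz0]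
  rw [hpre, ← Measure.map_apply (measurable_unitMul _)
    (measurable_coordNorm Metric.isOpen_ball.measurableSet), map_unitMul_volume h hK, hinv]
  rw [nnnorm_inv, inv_inv, Measure.smul_apply, ENNReal.smul_def, smul_eq_mul, normVolume]

/-- Since `1 + p ℤ_p` consists of norms, a coset of it contains only norms or none. -/
theorem preimage_ball_eq_empty (h : Anisotropic p K) (hK : Module.finrank ℚ K = 2)
    (hp2 : IsRamified K p → p ≠ 2) {z : ℚ_[p]} (hn : ¬ IsLocalNorm p K z) :
    (coordNorm ⁻¹' Metric.ball z ‖z‖ : Set (Coords p K)) = ∅ := by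
  rw [Set.eq_empty_iff_forall_notMem]
  intro x hx
  rw [Set.mem_preimage, mem_ball_norm_comm] at hx
  have hy0 : coordNorm x ≠ 0 := by
    rintro h0
    rw [h0] at hx
    simp at hx
  have hw : (coordNorm x)⁻¹ * z ∈ Metric.ball (1 : ℚ_[p]) 1 := by
    rwa [← mul_mem_ball_norm_iff hy0, mul_inv_cancel_left₀ hy0]
  apply hn
  have := IsLocalNorm.mul ⟨coordEquiv p K x, rfl⟩ (isLocalNorm_of_mem_ball_one h hK hp2 hw)
  rwa [show Algebra.norm ℚ_[p] (coordEquiv p K x) = coordNorm x from rfl,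
    mul_inv_cancel_left₀ hy0] at this

theorem exists_unit_of_isLocalNorm (h : Anisotropic p K) (hK : Module.finrank ℚ K = 2) {z : ℚ_[p]}
    (hz : z ≠ 0) (hn : IsLocalNorm p K z) :
    ∃ v : (LocalAlg p K)ˣ, Algebra.norm ℚ_[p] (v : LocalAlg p K) = z := by
  obtain ⟨x, hx⟩ := hn
  obtain ⟨v, rfl⟩ := h.exists_unit hK x (hx ▸ hz)
  exact ⟨v, hx⟩

theorem normVolume_ne_top (h : Anisotropic p K) (hK : Module.finrank ℚ K = 2) :
    normVolume p K ≠ ⊤ := by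
  have hvol : volume (Metric.closedBall (0 : Coords p K) 1) = 1 := by
    have := volume_closedBall_coords hK (1 : ℚ_[p]) one_ne_zero
    rw [norm_one] at this
    rw [this]; simp
  refine ne_top_of_le_ne_top (b := 1) ENNReal.one_ne_top (hvol ▸ measure_mono fun x hx => ?_)
  rw [← h.norm_coordNorm_le_one_iff hK, norm_eq_one_of_mem_ball hx]

theorem normVolume_ne_zero : normVolume p K ≠ 0 := by
  refine (Metric.isOpen_ball.preimage continuous_coordNorm).measure_ne_zero _
    ⟨(coordEquiv p K).symm 1, ?_⟩
  simp [coordNorm]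

variable (p K) in
/-- The value of the density of the distribution of the norm form. -/
def normConst : ℝ := (p * normVolume p K).toReal

theorem normConst_pos (h : Anisotropic p K) (hK : Module.finrank ℚ K = 2) :
    0 < normConst p K := by
  rw [normConst, ENNReal.toReal_mul, ENNReal.toReal_natCast]
  exact mul_pos prime_cast_pos (ENNReal.toReal_pos normVolume_ne_zero (normVolume_ne_top h hK))

theorem normDistribution_ball {A : Set (Coords p K)} (z : ℚ_[p]) :
    normDistribution A (Metric.ball z ‖z‖) = volume (coordNorm ⁻¹' Metric.ball z ‖z‖ ∩ A) := by
  have hm : MeasurableSet (Metric.ball z ‖z‖) := Metric.isOpen_ball.measurableSet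
  rw [normDistribution, Measure.map_apply measurable_coordNorm hm,
    Measure.restrict_apply (measurable_coordNorm hm)]

theorem normDensity_eq_of_subset (h : Anisotropic p K) (hK : Module.finrank ℚ K = 2)
    {A : Set (Coords p K)} {z : ℚ_[p]} (hz : z ≠ 0) (hn : IsLocalNorm p K z)
    (hA : coordNorm ⁻¹' Metric.ball z ‖z‖ ⊆ A) : normDensity A z = normConst p K := by
  obtain ⟨v, hv⟩ := exists_unit_of_isLocalNorm h hK hz hn
  have hz' : (‖z‖₊ : ENNReal) ≠ 0 := by simpa using hz
  rw [normDensity, shellDensity, normDistribution_ball, Set.inter_eq_left.2 hA,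
    volume_preimage_ball h hK v hv, normConst, mul_assoc, ← mul_assoc _ _ (normVolume p K),
    ENNReal.inv_mul_cancel hz' ENNReal.coe_ne_top, one_mul]

theorem normDensity_eq_zero {A : Set (Coords p K)} {z : ℚ_[p]}
    (hA : coordNorm ⁻¹' Metric.ball z ‖z‖ ∩ A = ∅) : normDensity A z = 0 := by
  rw [normDensity, shellDensity, normDistribution_ball, hA]
  simp

theorem norm_normDensity_le (h : Anisotropic p K) (hK : Module.finrank ℚ K = 2)
    (hp2 : IsRamified K p → p ≠ 2) (A : Set (Coords p K)) (z : ℚ_[p]) :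
    ‖normDensity A z‖ ≤ normConst p K := by
  by_cases hz : z ≠ 0 ∧ IsLocalNorm p K z
  · obtain ⟨hz, hn⟩ := hz
    obtain ⟨v, hv⟩ := exists_unit_of_isLocalNorm h hK hz hn
    have hz' : (‖z‖₊ : ENNReal) ≠ 0 := by simpa using hz
    rw [normDensity, shellDensity, normDistribution_ball, Complex.norm_real, Real.norm_of_nonneg
      ENNReal.toReal_nonneg, normConst]
    refine ENNReal.toReal_mono (ENNReal.mul_ne_top (ENNReal.natCast_ne_top p)
      (normVolume_ne_top h hK)) ?_
    calc _ ≤ (p : ENNReal) * (‖z‖₊ : ENNReal)⁻¹ * (‖z‖₊ * normVolume p K) := by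
            rw [← volume_preimage_ball h hK v hv]; gcongr; exact Set.inter_subset_left
      _ = _ := by rw [mul_assoc, ← mul_assoc _ _ (normVolume p K),
                    ENNReal.inv_mul_cancel hz' ENNReal.coe_ne_top, one_mul]
  · rw [normDensity_eq_zero, norm_zero]
    · exact (normConst_pos h hK).le
    · rw [not_and_or, not_not] at hz
      by_cases hz0 : z = 0
      · simp [hz0]
      · rw [preimage_ball_eq_empty h hK hp2 (hz.resolve_left hz0), Set.empty_inter]

namespace IsNormInvariant

variable {A : Set (Coords p K)} {R : ℝ}

theorem isShellConstant (H : IsNormInvariant A R) (h : Anisotropic p K)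
    (hK : Module.finrank ℚ K = 2) (hp2 : IsRamified K p → p ≠ 2) :
    IsShellConstant (normDensity A) R (normConst p K) where
  measurable := by
    have := isFiniteMeasure_normDistribution H.volume_ne_top
    exact Complex.measurable_ofReal.comp (measurable_shellDensity _).ennreal_toReal
  bound := norm_normDensity_le h hK hp2 A
  support := by
    intro z hz
    apply normDensity_eq_zero
    rw [Set.eq_empty_iff_forall_notMem]
    rintro x ⟨hx, hxA⟩
    exact absurd (H.norm_le x hxA) (by rw [norm_eq_of_mem_ball_norm hx]; exact hz.not_ge)
  add_eq := by
    intro z x hx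
    have h1 := norm_add_eq_of_lt hx
    have h2 : Metric.ball (z + x) ‖z + x‖ = Metric.ball z ‖z‖ := by
      rw [h1]
      exact IsUltrametricDist.ball_eq_of_mem (by simpa [dist_eq_norm] using hx) |>.symm
    have h3 : ‖z + x‖₊ = ‖z‖₊ := NNReal.eq h1
    rw [normDensity, shellDensity, h2, h3, normDensity, shellDensity]

theorem setIntegral_eq (H : IsNormInvariant A R) (h : Anisotropic p K)
    (hK : Module.finrank ℚ K = 2) {f : ℚ_[p] → ℂ} (hf : Measurable f) :
    ∫ x in A, f (coordNorm x) = ∫ z, normDensity A z * f z := by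
  have := isFiniteMeasure_normDistribution H.volume_ne_top
  have key := integral_eq_integral_shellDensity (normDistribution A) (normDistribution_zero h hK A)
    (fun w hw => by
      obtain ⟨v, rfl, hv⟩ := H.exists_unit w hw
      exact map_mul_normDistribution h hK H.measurableSet v (norm_eq_one_of_mem_ball hw) hv) f
  rw [← show _ = ∫ z, normDensity A z * f z from key, normDistribution,
    integral_map measurable_coordNorm.aemeasurable hf.aestronglyMeasurable]

end IsNormInvariant

/-- The set of `x` with `|t N(x)| ≤ R`. -/
def formBall (t : ℚ_[p]) (R : ℝ) : Set (Coords p K) := {x | ‖t * coordNorm x‖ ≤ R}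

theorem isNormInvariant_formBall (h : Anisotropic p K)
    (hK : Module.finrank ℚ K = 2) (hp2 : IsRamified K p → p ≠ 2) {t : ℚ_[p]} (ht : t ≠ 0) (R : ℝ) :
    IsNormInvariant (formBall t R : Set (Coords p K)) (‖t‖⁻¹ * R) where
  measurableSet := measurableSet_le (by fun_prop) measurable_const
  volume_ne_top := by
    obtain ⟨j, hj⟩ := pow_unbounded_of_one_lt (‖t‖⁻¹ * R) (one_lt_prime_cast (p := p))
    have hp0 := prime_cast_ne_zero (p := p)
    set a : ℚ_[p] := ((p : ℚ_[p]) ^ j)⁻¹ with ha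
    have ha0 : a ≠ 0 := inv_ne_zero (pow_ne_zero _ hp0)
    have hna : ‖a‖ = (p : ℝ) ^ j := by rw [ha, norm_inv, norm_pow, Padic.norm_p]; simp
    have hsub : (formBall t R : Set (Coords p K)) ⊆ Metric.closedBall 0 ‖a‖ := by
      intro x hx
      have hx : ‖t * coordNorm x‖ ≤ R := hx
      -- Bounded norm forces bounded coordinates: scaling by a large power of `p` moves `x` into
      -- `O_{k,p}`, the unit ball in coordinates.
      have h1 : ‖coordNorm (a⁻¹ • x)‖ ≤ 1 := by
        rw [coordNorm, map_smul, norm_smul_of_finrank_two (finrank_localAlg hK), norm_mul, norm_pow,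
          norm_inv, hna]
        have h2 : ‖coordNorm x‖ ≤ (p : ℝ) ^ j := by
          refine le_trans ?_ hj.le
          rw [norm_mul] at hx
          rwa [le_inv_mul_iff₀ (norm_pos_iff.2 ht)]
        have h3 : (1 : ℝ) ≤ (p : ℝ) ^ j := one_le_pow₀ one_lt_prime_cast.le
        rw [inv_pow, inv_mul_le_iff₀ (by positivity), mul_one]
        calc _ ≤ _ := h2
          _ ≤ _ := le_self_pow₀ h3 two_ne_zero
      rw [h.norm_coordNorm_le_one_iff hK, mem_closedBall_zero_iff, norm_smul, norm_inv,
        inv_mul_le_iff₀ (norm_pos_iff.2 ha0), mul_one] at h1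
      rwa [mem_closedBall_zero_iff]
    refine ne_top_of_le_ne_top ?_ (measure_mono hsub)
    rw [volume_closedBall_coords hK a ha0]
    exact ENNReal.pow_ne_top ENNReal.coe_ne_top
  norm_le := by
    intro x hx
    have hx : ‖t * coordNorm x‖ ≤ R := hx
    rwa [le_inv_mul_iff₀ (norm_pos_iff.2 ht), ← norm_mul]
  exists_unit := by
    intro w hw
    have hw1 := norm_eq_one_of_mem_ball hw
    obtain ⟨v, hv⟩ := exists_unit_of_isLocalNorm h hK (norm_ne_zero_iff.1 (by rw [hw1]; norm_num))
      (isLocalNorm_of_mem_ball_one h hK hp2 hw)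
    refine ⟨v, hv, ?_⟩
    ext x
    simp only [formBall, Set.mem_preimage, Set.mem_ofPred_eq]
    rw [coordNorm_unitMul, hv, norm_mul, norm_mul, norm_mul, hw1, one_mul]

/-- The density of the distribution of `t N(x)` on `A`. -/
def formDensity (t : ℚ_[p]) (A : Set (Coords p K)) (z : ℚ_[p]) : ℂ :=
  ((‖t‖⁻¹ : ℝ) : ℂ) * normDensity A (t⁻¹ * z)

theorem IsNormInvariant.isShellConstant_formDensity {A : Set (Coords p K)} {R : ℝ}
    (H : IsNormInvariant A R) (h : Anisotropic p K) (hK : Module.finrank ℚ K = 2)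
    (hp2 : IsRamified K p → p ≠ 2) {t : ℚ_[p]} (ht : t ≠ 0) :
    IsShellConstant (formDensity t A) (‖t‖ * R) (‖t‖⁻¹ * normConst p K) := by
  have ht' := norm_pos_iff.2 ht
  have S := H.isShellConstant h hK hp2
  refine ⟨(S.measurable.comp (by fun_prop)).const_mul _, fun z => ?_, fun z hz => ?_,
    fun z x hx => ?_⟩
  · rw [formDensity, norm_mul, Complex.norm_real, norm_inv, norm_norm]
    exact mul_le_mul_of_nonneg_left (S.bound _) (by positivity)
  · rw [formDensity, S.support, mul_zero]
    rwa [norm_mul, norm_inv, lt_inv_mul_iff₀ ht']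
  · rw [formDensity, formDensity, mul_add, S.add_eq]
    rw [norm_mul, norm_mul]
    exact mul_lt_mul_of_pos_left hx (by simpa using ht)

theorem IsNormInvariant.setIntegral_form {A : Set (Coords p K)} {R : ℝ}
    (H : IsNormInvariant A R) (h : Anisotropic p K) (hK : Module.finrank ℚ K = 2)
    {t : ℚ_[p]} (ht : t ≠ 0) {f : ℚ_[p] → ℂ} (hf : Measurable f) :
    ∫ x in A, f (t * coordNorm x) = ∫ z, formDensity t A z * f z := by
  rw [H.setIntegral_eq h hK (f := fun z => f (t * z)) (hf.comp (by fun_prop))]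
  have := integral_mul_left_eq (inv_ne_zero ht) (fun z => normDensity A z * f (t * z))
  have ht' : ((‖t‖ : ℝ) : ℂ) ≠ 0 := by simpa using ht
  simp only [formDensity, mul_assoc]
  rw [integral_const_mul]
  simp only [mul_inv_cancel_left₀ ht] at this
  rw [this, norm_inv, inv_inv, ← mul_assoc, Complex.ofReal_inv, inv_mul_cancel₀ ht', one_mul]

theorem formDensity_formBall (h : Anisotropic p K) (hK : Module.finrank ℚ K = 2)
    {t : ℚ_[p]} (ht : t ≠ 0) {R : ℝ} {z : ℚ_[p]} (hz : z ≠ 0) (hn : IsLocalNorm p K (t⁻¹ * z))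
    (hR : ‖z‖ ≤ R) :
    formDensity t (formBall t R : Set (Coords p K)) z = ((‖t‖⁻¹ * normConst p K : ℝ) : ℂ) := by
  rw [formDensity, normDensity_eq_of_subset h hK (mul_ne_zero (inv_ne_zero ht) hz) hn,
    Complex.ofReal_mul]
  intro x hx
  have := norm_eq_of_mem_ball_norm hx
  change ‖t * coordNorm x‖ ≤ R
  rwa [norm_mul, this, ← norm_mul, mul_inv_cancel_left₀ ht]

theorem formDensity_eq_zero (h : Anisotropic p K) (hK : Module.finrank ℚ K = 2)
    (hp2 : IsRamified K p → p ≠ 2) {t : ℚ_[p]} (A : Set (Coords p K)) {z : ℚ_[p]}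
    (hn : ¬ IsLocalNorm p K (t⁻¹ * z)) :
    formDensity t A z = 0 := by
  rw [formDensity, normDensity_eq_zero, mul_zero]
  rw [preimage_ball_eq_empty h hK hp2 hn, Set.empty_inter]

end NormDensity

/-! ### Whittaker functions of indicators of norm-invariant sets. -/

section Whittaker

variable {p : ℕ} [Fact p.Prime] {K : Type*} [Field K] [NumberField K]

theorem IsShellConstant.ballMean_eq {h : ℚ_[p] → ℂ} {R C : ℝ} (H : IsShellConstant h R C)
    {n : ℚ_[p]} {k : ℕ} (hk : (p : ℝ) ^ (-(k : ℤ)) < ‖n‖) : ballMean h n k = h n :=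
  H.setIntegral_closedBall_eq hk

variable (K) in
/-- The normalizing factor of the self-dual Haar measure. -/
def selfDualConst (t : ℚ_[p]) : ℝ :=
  Real.sqrt ‖(Matrix.of fun i j => bilin t (localBasis p K i) (localBasis p K j)).det‖

theorem selfDualIntegral_eq (t : ℚ_[p]) (f : LocalAlg p K → ℂ) :
    selfDualIntegral t f = selfDualConst K t * ∫ x : Coords p K, f (coordEquiv p K x) := by
  simp only [coordEquiv_apply]
  rfl

theorem chi_one : chi K (1 : ℚ_[p]) = 1 := by
  rw [chi, hilbertSymbol, if_pos]
  exact ⟨0, 1, 1, by simp, by simp⟩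

theorem norm_zero_localAlg (hK : Module.finrank ℚ K = 2) :
    Algebra.norm ℚ_[p] (0 : LocalAlg p K) = 0 := by
  rw [← zero_smul ℚ_[p] (1 : LocalAlg p K), norm_smul_of_finrank_two (finrank_localAlg hK)]
  ring

theorem bilin_zero_left (hK : Module.finrank ℚ K = 2) (t : ℚ_[p]) (y : LocalAlg p K) :
    bilin t 0 y = 0 := by
  simp [bilin, quadForm, norm_zero_localAlg hK]

theorem coe_wMat_inv_mul_nMat (b : ℚ_[p]) :
    ((wMat⁻¹ * nMat b : SL(2, ℚ_[p])) : Matrix (Fin 2) (Fin 2) ℚ_[p]) = !![0, -1; 1, b] := by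
  rw [Matrix.SpecialLinearGroup.coe_mul, Matrix.SpecialLinearGroup.coe_inv]
  simp [wMat, nMat, Matrix.adjugate_fin_two]

/-- The matrix `w⁻¹ n(b)` has bottom row `(1, b)`, which gives both the factor `max(1, |b|) ^ (-s)`
and the Weil action `w⁻¹` after `n(b)`. Evaluation at `0` removes the bilinear phase. -/
theorem whittakerIntegrand_eq (hK : Module.finrank ℚ K = 2) (t : ℚ_[p]) (φ : LocalAlg p K → ℂ)
    (n : ℚ) (s : ℂ) (b : ℚ_[p]) : whittakerIntegrand t φ n s b =
      weilIndex K t * selfDualConst K t *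
        ((∫ x : Coords p K, psi (b * (t * coordNorm x)) * φ (coordEquiv p K x)) *
          psi (-((n : ℚ_[p]) * b)) * ((max 1 ‖b‖ : ℝ) : ℂ) ^ (-s)) := by
  have h10 : (wMat⁻¹ * nMat b : SL(2, ℚ_[p])) 1 0 = 1 :=
    congrFun₂ (coe_wMat_inv_mul_nMat b) 1 0
  have h11 : (wMat⁻¹ * nMat b : SL(2, ℚ_[p])) 1 1 = b :=
    congrFun₂ (coe_wMat_inv_mul_nMat b) 1 1
  rw [whittakerIntegrand, standardSection, weil, h10, h11, if_neg one_ne_zero, inv_one, div_one,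
    div_one]
  rw [weilN, weilM, weilWInv, selfDualIntegral_eq]
  simp only [quadForm, norm_zero_localAlg hK, smul_zero, mul_zero, psi_zero, chi_one, norm_one,
    bilin_zero_left hK, neg_zero, mul_one, Int.cast_one, Complex.ofReal_one, one_mul]
  simp only [weilN, quadForm, coordNorm]
  ring

theorem setIntegral_eq_integral_mul_indicator {A : Set (Coords p K)} (hA : MeasurableSet A)
    (f : Coords p K → ℂ) : ∫ x, f x * A.indicator 1 x = ∫ x in A, f x := by
  rw [← integral_indicator hA]
  congr 1
  ext x
  by_cases hx : x ∈ A <;> simp [hx]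

/-- The integral over `A` in the integrand is the Fourier transform of the density of `t N(x)`, and
the condition on `M` makes the ball means about `n` stationary from `M` on. -/
theorem IsNormInvariant.isWhittaker {A : Set (Coords p K)} {R : ℝ}
    (H : IsNormInvariant A R) (h : Anisotropic p K) (hK : Module.finrank ℚ K = 2)
    (hp2 : IsRamified K p → p ≠ 2) {t : ℚ_[p]} (ht : t ≠ 0) {φ : LocalAlg p K → ℂ}
    (hφ : ∀ x, φ (coordEquiv p K x) = A.indicator 1 x) {n : ℚ} {M : ℕ}
    (hM : (p : ℝ) ^ (-(M : ℤ)) < ‖(n : ℚ_[p])‖) :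
    IsWhittaker t φ n fun s =>
      weilIndex K t * selfDualConst K t * whittakerSum (formDensity t A) n M s := by
  have S := H.isShellConstant_formDensity h hK hp2 ht
  have hst : ∀ k, M ≤ k →
      ballMean (formDensity t A) n k = ballMean (formDensity t A) n M := by
    intro k hk
    rw [S.ballMean_eq hM, S.ballMean_eq]
    refine lt_of_le_of_lt (zpow_le_zpow_right₀ one_lt_prime_cast.le ?_) hM
    omega
  have hI : ∀ s b, whittakerIntegrand t φ n s b = weilIndex K t * selfDualConst K t *
      (fourier (formDensity t A) b * psi (-((n : ℚ_[p]) * b)) *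
        ((max 1 ‖b‖ : ℝ) : ℂ) ^ (-s)) := by
    intro s b
    rw [whittakerIntegrand_eq hK]
    simp only [hφ]
    rw [setIntegral_eq_integral_mul_indicator H.measurableSet,
      H.setIntegral_form h hK ht (f := fun z => psi (b * z)) (measurable_psi.comp (by fun_prop))]
    rfl
  refine ⟨(differentiable_whittakerSum _ _ _).const_mul _, fun s hs => ?_, fun s hs => ?_⟩
  · rw [funext (hI s)]
    exact (S.integral_whittaker n hst hs).1.const_mul _
  · rw [funext (hI s), integral_const_mul, (S.integral_whittaker n hst hs).2]

theorem IsWhittaker.whittaker_eq {t : ℚ_[p]} {φ : LocalAlg p K → ℂ} {n : ℚ} {W : ℂ → ℂ}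
    (h : IsWhittaker t φ n W) : whittaker t φ n = W :=
  IsWhittaker.unique (Classical.epsilon_spec (p := fun W => IsWhittaker t φ n W) ⟨W, h⟩) h

variable (p K) in
/-- The factor by which the normalized Whittaker function differs from the Whittaker function. -/
def normalization (s : ℂ) : ℂ :=
  (‖(NumberField.discr K : ℚ_[p])‖ : ℂ) ^ (-(s + 1) / 2) * localL p K (s + 1)

theorem IsWhittaker.normalizedWhittaker_eq {t : ℚ_[p]} {φ : LocalAlg p K → ℂ} {n : ℚ} {W : ℂ → ℂ}
    (h : IsWhittaker t φ n W) (s : ℂ) :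
    normalizedWhittaker t φ n s = normalization p K s * W s := by
  rw [normalizedWhittaker, h.whittaker_eq, normalization]

theorem norm_discr_ne_zero : ((‖(NumberField.discr K : ℚ_[p])‖ : ℝ) : ℂ) ≠ 0 := by
  have := NumberField.discr_ne_zero K
  simpa using this

theorem one_sub_chi_ne_zero : 1 - (chi K (p : ℚ_[p]) : ℂ) * (p : ℂ) ^ (-((0 : ℂ) + 1)) ≠ 0 := by
  have hp := one_lt_prime_cast (p := p)
  intro h0
  rw [zero_add, Complex.cpow_neg_one] at h0
  have h1 : (p : ℂ) = chi K (p : ℚ_[p]) := by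
    have hp0 : (p : ℂ) ≠ 0 := by exact_mod_cast (prime_cast_pos (p := p)).ne'
    field_simp at h0
    linear_combination h0
  have h2 : (p : ℤ) = chi K (p : ℚ_[p]) := by exact_mod_cast h1
  have h3 : chi K (p : ℚ_[p]) ≤ 1 := by
    rw [chi, hilbertSymbol]; split_ifs <;> norm_num
  have h4 : 1 < (p : ℤ) := by exact_mod_cast hp
  omega

theorem normalization_zero_ne_zero : normalization p K 0 ≠ 0 := by
  refine mul_ne_zero ?_ ?_
  · rw [Complex.cpow_ne_zero_iff]
    exact Or.inl norm_discr_ne_zero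
  · rw [localL]
    split_ifs
    · exact one_ne_zero
    · exact inv_ne_zero one_sub_chi_ne_zero

theorem differentiableAt_normalization : DifferentiableAt ℂ (normalization p K) 0 := by
  have hp0 : (p : ℂ) ≠ 0 := by exact_mod_cast (prime_cast_pos (p := p)).ne'
  refine DifferentiableAt.mul ?_ ?_
  · exact DifferentiableAt.const_cpow (by fun_prop) (Or.inl norm_discr_ne_zero)
  · unfold localL
    split_ifs
    · fun_prop
    · refine DifferentiableAt.inv ?_ one_sub_chi_ne_zero
      refine (differentiableAt_const _).sub ((differentiableAt_const _).mul ?_)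
      exact DifferentiableAt.const_cpow (by fun_prop) (Or.inl hp0)

end Whittaker

/-! ### The Weil index in terms of norm classes. -/

section WeilIndex

variable {p : ℕ} [Fact p.Prime] {K : Type*} [Field K] [NumberField K]

theorem bilin_eq (hK : Module.finrank ℚ K = 2) (t : ℚ_[p]) (x y : LocalAlg p K) :
    bilin t x y = t * (Algebra.trace ℚ_[p] (LocalAlg p K) x * Algebra.trace ℚ_[p] (LocalAlg p K) y -
      Algebra.trace ℚ_[p] (LocalAlg p K) (x * y)) := by
  simp only [bilin, quadForm]
  rw [norm_add_of_finrank_two (finrank_localAlg hK) two_ne_zero]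
  ring

theorem bilin_sum_right (hK : Module.finrank ℚ K = 2) (t : ℚ_[p]) (x : LocalAlg p K)
    (v : Coords p K) :
    ∑ j, bilin t x (localBasis p K j) * v j = bilin t x (coordEquiv p K v) := by
  simp only [bilin_eq hK, coordEquiv_apply, map_sum, map_smul, Finset.mul_sum, mul_smul_comm,
    smul_eq_mul]
  rw [← Finset.sum_sub_distrib, Finset.mul_sum]
  exact Finset.sum_congr rfl fun j _ => by ring

theorem bilin_comm (t : ℚ_[p]) (x y : LocalAlg p K) : bilin t x y = bilin t y x := by
  simp only [bilin, add_comm x y]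
  ring

theorem bilin_self (hK : Module.finrank ℚ K = 2) (t : ℚ_[p]) (x : LocalAlg p K) :
    bilin t x x = 2 * (t * Algebra.norm ℚ_[p] x) := by
  simp only [bilin, quadForm]
  rw [← two_smul ℚ_[p] x, norm_smul_of_finrank_two (finrank_localAlg hK)]
  ring

/-- The Gram determinant is of size two, so it scales by `t²`, and its square root by `|t|`. -/
theorem selfDualConst_eq (hK : Module.finrank ℚ K = 2) (t : ℚ_[p]) :
    selfDualConst K t = ‖t‖ * selfDualConst K (1 : ℚ_[p]) := by
  have : (Matrix.of fun i j => bilin t (localBasis p K i) (localBasis p K j)) =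
      t • Matrix.of fun i j => bilin (1 : ℚ_[p]) (localBasis p K i) (localBasis p K j) := by
    ext i j
    simp [bilin_eq hK]
  rw [selfDualConst, this, Matrix.det_smul, card_basisIndex hK, norm_mul, norm_pow,
    Real.sqrt_mul (by positivity), Real.sqrt_sq (norm_nonneg _), selfDualConst]

theorem selfDualConst_pos (h : Anisotropic p K) (hK : Module.finrank ℚ K = 2) {t : ℚ_[p]}
    (ht : t ≠ 0) : 0 < selfDualConst K t := by
  refine Real.sqrt_pos.2 (norm_pos_iff.2 fun h0 => ?_)
  obtain ⟨v, hv, hMv⟩ := Matrix.exists_mulVec_eq_zero_iff.2 h0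
  have h1 : ∀ i, bilin t (coordEquiv p K v) (localBasis p K i) = 0 := fun i => by
    rw [bilin_comm, ← bilin_sum_right hK]
    exact congrFun hMv i
  have h2 := bilin_sum_right hK t (coordEquiv p K v) v
  simp only [h1, zero_mul, Finset.sum_const_zero, bilin_self hK] at h2
  have h3 : coordEquiv p K v = 0 := h _ (by
    have : (2 : ℚ_[p]) ≠ 0 := two_ne_zero
    simpa [ht] using h2.symm)
  exact hv (by simpa using h3)

open Classical in
variable (K) in
/-- The integral of `ψ_p(-z)` over the `z ∈ p⁻¹ ℤ_p` in the norm class of `t`. -/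
def classIntegral (t : ℚ_[p]) : ℂ :=
  ∫ z in Metric.closedBall (0 : ℚ_[p]) p, (if IsLocalNorm p K (t⁻¹ * z) then 1 else 0) * psi (-z)

theorem ae_ne_zero : ∀ᵐ z : ℚ_[p], z ≠ 0 := by
  simp [ae_iff, measure_singleton]

/-- At frequency `-1` only `|z| ≤ p` contributes, by `fourier_eq_setIntegral`, and there the density
is a constant times the indicator of the norm class. -/
theorem fourier_formDensity (h : Anisotropic p K) (hK : Module.finrank ℚ K = 2)
    (hp2 : IsRamified K p → p ≠ 2) {t : ℚ_[p]} (ht : t ≠ 0) {R : ℝ} (hR : p ≤ R) :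
    fourier (formDensity t (formBall t R : Set (Coords p K))) (-1) =
      ((‖t‖⁻¹ * normConst p K : ℝ) : ℂ) * classIntegral K t := by
  classical
  have S := (isNormInvariant_formBall h hK hp2 ht R).isShellConstant_formDensity h hK hp2 ht
  rw [S.fourier_eq_setIntegral (neg_ne_zero.2 one_ne_zero), classIntegral, ← integral_const_mul]
  have e : ‖(p : ℚ_[p])⁻¹ * (-1)⁻¹‖ = p := by simp [inv_neg]
  rw [e]
  refine setIntegral_congr_ae Metric.isClosed_closedBall.measurableSet ?_
  filter_upwards [ae_ne_zero] with z hz hzp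
  rw [mem_closedBall_zero_iff] at hzp
  by_cases hn : IsLocalNorm p K (t⁻¹ * z)
  · rw [formDensity_formBall h hK ht hz hn (hzp.trans hR), if_pos hn, one_mul, neg_one_mul]
  · rw [formDensity_eq_zero h hK hp2 _ hn, if_neg hn]
    simp

/-- The integral over `p ^ (-n) O_{k,p}` is a Fourier value at `-1`, independent of `n` as soon as
the values `|t N(x)|` allowed by the lattice reach up to `p`. The scaling of the self-dual measure
cancels the factor `|t|⁻¹` of the density. -/
theorem weilIndex_eq (h : Anisotropic p K) (hK : Module.finrank ℚ K = 2)
    (hp2 : IsRamified K p → p ≠ 2) {t : ℚ_[p]} (ht : t ≠ 0) :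
    weilIndex K t = ((selfDualConst K (1 : ℚ_[p]) * normConst p K : ℝ) : ℂ) * classIntegral K t := by
  classical
  have hp1 := one_lt_prime_cast (p := p)
  have ht' := norm_pos_iff.2 ht
  refine Tendsto.limUnder_eq (tendsto_const_nhds.congr' ?_)
  obtain ⟨j, hj⟩ := pow_unbounded_of_one_lt (‖t‖⁻¹ * p) hp1
  filter_upwards [eventually_ge_atTop j] with n hn
  have hR : (p : ℝ) ≤ ‖t‖ * (p : ℝ) ^ (2 * n) := by
    rw [← inv_mul_le_iff₀ ht']
    exact hj.le.trans (pow_le_pow_right₀ hp1.le (by omega))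
  have H := isNormInvariant_formBall h hK hp2 ht (‖t‖ * (p : ℝ) ^ (2 * n))
  have e : ∀ x : Coords p K,
      (if (p : ℚ_[p]) ^ n • coordEquiv p K x ∈ localInt p K then
        psi (-quadForm t (coordEquiv p K x)) else 0) = psi (-(t * coordNorm x)) *
        (formBall t (‖t‖ * (p : ℝ) ^ (2 * n)) : Set (Coords p K)).indicator 1 x := by
    intro x
    have : (p : ℚ_[p]) ^ n • coordEquiv p K x ∈ localInt p K ↔
        x ∈ (formBall t (‖t‖ * (p : ℝ) ^ (2 * n)) : Set (Coords p K)) := by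
      rw [h.mem_localInt_iff hK, norm_smul_of_finrank_two (finrank_localAlg hK), norm_mul, ← pow_mul,
        norm_pow, Padic.norm_p, inv_pow, inv_mul_le_iff₀ (by positivity), mul_one, mul_comm n]
      change _ ↔ ‖t * coordNorm x‖ ≤ _
      rw [norm_mul, mul_le_mul_iff_right₀ ht']
      rfl
    by_cases hx : x ∈ (formBall t (‖t‖ * (p : ℝ) ^ (2 * n)) : Set (Coords p K))
    · rw [if_pos (this.2 hx), Set.indicator_of_mem hx, Pi.one_apply, mul_one]
      rfl
    · rw [if_neg (mt this.1 hx), Set.indicator_of_notMem hx, mul_zero]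
  rw [selfDualIntegral_eq, selfDualConst_eq hK t]
  simp only [e]
  rw [setIntegral_eq_integral_mul_indicator H.measurableSet,
    H.setIntegral_form h hK ht (f := fun z => psi (-z)) (measurable_psi.comp (by fun_prop))]
  have := fourier_formDensity h hK hp2 ht hR
  simp only [fourier, neg_one_mul] at this
  rw [this]
  have ht'' : ((‖t‖ : ℝ) : ℂ) ≠ 0 := by simpa using ht
  push_cast
  field_simp

open Classical in
-- Measurability of the norm class is inherited from the density, of which the indicator is almost
-- everywhere a multiple on this ball.
theorem integrableOn_classIndicator (h : Anisotropic p K) (hK : Module.finrank ℚ K = 2)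
    (hp2 : IsRamified K p → p ≠ 2) {t : ℚ_[p]} (ht : t ≠ 0) :
    IntegrableOn (fun z => (if IsLocalNorm p K (t⁻¹ * z) then 1 else 0) * psi (-z))
      (Metric.closedBall (0 : ℚ_[p]) p) := by
  have S := (isNormInvariant_formBall h hK hp2 ht (p : ℝ)).isShellConstant_formDensity h hK hp2 ht
  have hC : ((‖t‖⁻¹ * normConst p K : ℝ) : ℂ) ≠ 0 := by
    have := normConst_pos h hK
    have := norm_pos_iff.2 ht
    exact_mod_cast (by positivity : 0 < ‖t‖⁻¹ * normConst p K).ne'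
  have h1 : Integrable fun z => ((‖t‖⁻¹ * normConst p K : ℝ) : ℂ)⁻¹ *
      (formDensity t (formBall t p : Set (Coords p K)) z * psi (-z)) :=
    (S.integrable.mul_bdd (c := 1) ((measurable_psi.comp (by fun_prop)).aestronglyMeasurable)
      (Filter.Eventually.of_forall fun z => (norm_psi _).le)).const_mul _
  refine (h1.integrableOn (s := Metric.closedBall (0 : ℚ_[p]) p)).congr ?_
  filter_upwards [ae_restrict_of_ae ae_ne_zero,
    ae_restrict_mem Metric.isClosed_closedBall.measurableSet] with z hz hzp
  rw [mem_closedBall_zero_iff] at hzp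
  by_cases hn : IsLocalNorm p K (t⁻¹ * z)
  · rw [formDensity_formBall h hK ht hz hn hzp, if_pos hn, one_mul, inv_mul_cancel_left₀ hC]
  · rw [formDensity_eq_zero h hK hp2 _ hn, if_neg hn]
    simp

theorem integral_psi_neg_closedBall :
    ∫ z in Metric.closedBall (0 : ℚ_[p]) p, psi (-z) = 0 := by
  have := integral_psi_closedBall (p := p) 1 (-1)
  have hp := one_lt_prime_cast (p := p)
  simp only [zpow_one, mul_neg_one] at this
  rw [this, if_neg]
  rw [norm_neg, norm_one, zpow_neg, zpow_one, not_le]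
  exact inv_lt_one_of_one_lt₀ hp

/-- The norm classes of `t` and `κ t` partition the nonzero elements, so the two integrals add up to
that of `ψ_p(-z)` over `p⁻¹ ℤ_p`, which is zero. -/
theorem classIntegral_kappa (h : Anisotropic p K) (hK : Module.finrank ℚ K = 2)
    (hp2 : IsRamified K p → p ≠ 2) {κ : ℚ_[p]} (hκ : IsKappa K p κ) {t : ℚ_[p]} (ht : t ≠ 0) :
    classIntegral K (κ * t) = -classIntegral K t := by
  classical
  have hκ0 := hκ.ne_zero
  rw [eq_neg_iff_add_eq_zero, ← integral_psi_neg_closedBall (p := p), classIntegral, classIntegral,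
    ← integral_add (integrableOn_classIndicator h hK hp2 (mul_ne_zero hκ0 ht))
      (integrableOn_classIndicator h hK hp2 ht)]
  refine integral_congr_ae (ae_restrict_of_ae ?_)
  filter_upwards [ae_ne_zero] with z hz
  have e : t⁻¹ * z = (κ * t)⁻¹ * z * κ := by field_simp
  have hy0 : (κ * t)⁻¹ * z ≠ 0 := mul_ne_zero (inv_ne_zero (mul_ne_zero hκ0 ht)) hz
  rw [e, ← add_mul]
  rcases isLocalNorm_or_mul h hK hp2 hκ hy0 with h1 | h1
  · have h2 : ¬ IsLocalNorm p K ((κ * t)⁻¹ * z * κ) := fun h2 =>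
      not_isLocalNorm_of_isKappa hK hκ (by
        have := h2.div hK h1
        rwa [mul_div_cancel_left₀ _ hy0] at this)
    rw [if_pos h1, if_neg h2]
    simp
  · have h2 : ¬ IsLocalNorm p K ((κ * t)⁻¹ * z) := fun h2 =>
      not_isLocalNorm_of_isKappa hK hκ (by
        have := h1.div hK h2
        rwa [mul_div_cancel_left₀ _ hy0] at this)
    rw [if_pos h1, if_neg h2]
    simp

theorem classIntegral_mul (hK : Module.finrank ℚ K = 2) {a : ℚ_[p]} (ha0 : a ≠ 0)
    (ha : IsLocalNorm p K a) (t : ℚ_[p]) : classIntegral K (a * t) = classIntegral K t := by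
  classical
  have : ∀ z, IsLocalNorm p K ((a * t)⁻¹ * z) ↔ IsLocalNorm p K (t⁻¹ * z) := by
    intro z
    constructor
    · intro h1
      have := ha.mul h1
      rwa [mul_inv, mul_assoc, mul_inv_cancel_left₀ ha0] at this
    · intro h1
      have := (ha.inv hK).mul h1
      rwa [← mul_assoc, ← mul_inv] at this
  simp only [classIntegral, this]

/-- Writing `b N(x) = -(-b N(x))` turns the frequency `b` into the scale of the form, which reduces
to `fourier_formDensity` for the form `-b N`. -/
theorem fourier_formDensity_one (h : Anisotropic p K) (hK : Module.finrank ℚ K = 2)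
    (hp2 : IsRamified K p → p ≠ 2) {b : ℚ_[p]} (hb : p ≤ ‖b‖) :
    fourier (formDensity 1 (formBall 1 1 : Set (Coords p K))) b =
      ((‖b‖⁻¹ * normConst p K : ℝ) : ℂ) * classIntegral K (-b) := by
  have hb0 : -b ≠ 0 := by
    rw [← norm_pos_iff, norm_neg]
    exact prime_cast_pos.trans_le hb
  have h1 := fourier_formDensity h hK hp2 hb0 hb
  rw [norm_neg] at h1
  rw [← h1, fourier, fourier,
    ← (isNormInvariant_formBall h hK hp2 one_ne_zero 1).setIntegral_form h hK one_ne_zero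
      (f := fun z => psi (b * z)) (measurable_psi.comp (by fun_prop)),
    ← (isNormInvariant_formBall h hK hp2 hb0 ‖b‖).setIntegral_form h hK hb0
      (f := fun z => psi (-1 * z)) (measurable_psi.comp (by fun_prop))]
  have e : (formBall (-b) ‖b‖ : Set (Coords p K)) = formBall 1 1 := by
    ext x
    change ‖-b * coordNorm x‖ ≤ ‖b‖ ↔ ‖1 * coordNorm x‖ ≤ 1
    rw [norm_mul, norm_neg, one_mul, mul_le_iff_le_one_right (by rwa [← norm_neg, norm_pos_iff])]
  rw [e]
  simp only [one_mul, neg_mul, neg_neg]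

/-- If one class integral vanished, so would all. The Fourier transform of the density of `N` on
`O_{k,p}` would then be supported on `ℤ_p`, and its ball means would not depend on the radius. So
the density would agree at `1` and at `κ`, although only `1` is a norm. -/
theorem classIntegral_ne_zero (h : Anisotropic p K) (hK : Module.finrank ℚ K = 2)
    (hp2 : IsRamified K p → p ≠ 2) {κ : ℚ_[p]} (hκ : IsKappa K p κ) {t : ℚ_[p]} (ht : t ≠ 0) :
    classIntegral K t ≠ 0 := by
  classical
  intro h0
  have hp := prime_cast_pos (p := p)
  have hp1 := one_lt_prime_cast (p := p)
  have hκ0 := hκ.ne_zero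
  have hκ1 : ‖κ‖ ≤ 1 := by
    rw [Padic.norm_le_one_iff_val_nonneg]
    by_cases hr : IsRamified K p
    · rw [hκ.ord_ramified hr]
    · rw [hκ.ord_unramified hr]; exact zero_le_one
  have hall : ∀ s : ℚ_[p], s ≠ 0 → classIntegral K s = 0 := by
    intro s hs
    have ha : s * t⁻¹ ≠ 0 := mul_ne_zero hs (inv_ne_zero ht)
    rcases isLocalNorm_or_mul h hK hp2 hκ ha with h1 | h1
    · rw [← h0, ← classIntegral_mul hK ha h1 t, inv_mul_cancel_right₀ ht]
    · have h2 := classIntegral_mul hK (mul_ne_zero ha hκ0) h1 t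
      rw [h0, show s * t⁻¹ * κ * t = κ * s by field_simp, classIntegral_kappa h hK hp2 hκ hs] at h2
      simpa using h2
  have S := (isNormInvariant_formBall h hK hp2 one_ne_zero 1).isShellConstant_formDensity h hK hp2
    one_ne_zero
  set f := formDensity 1 (formBall 1 1 : Set (Coords p K)) with hf
  have hconst : ∀ n k, ballMean f n k = ballMean f n 0 := by
    intro n k
    rw [ballMean, ballMean, ← S.integral_fourier_closedBall, ← S.integral_fourier_closedBall]
    refine setIntegral_eq_of_subset_of_forall_sdiff_eq_zero
      Metric.isClosed_closedBall.measurableSet ?_ fun b hb => ?_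
    · exact Metric.closedBall_subset_closedBall (zpow_le_zpow_right₀ hp1.le (by simp))
    · have hb2 : ¬ ‖b‖ ≤ (p : ℝ) ^ ((1 : ℤ) - 1) := by simpa using hb.2
      rw [← norm_lt_iff_le_zpow, not_lt, zpow_one] at hb2
      rw [hf, fourier_formDensity_one h hK hp2 hb2, hall, mul_zero, zero_mul]
      rw [neg_ne_zero, ← norm_pos_iff]
      exact hp.trans_le hb2
  have hone : f 1 = normConst p K := by
    rw [hf, formDensity_formBall h hK one_ne_zero one_ne_zero ?_ (by simp)]
    · simp
    · rw [mul_one]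
      simpa using isLocalNorm_sq hK (1 : ℚ_[p])⁻¹
  have hkap : f κ = 0 := by
    rw [hf, formDensity_eq_zero h hK hp2]
    rw [inv_one, one_mul]
    exact not_isLocalNorm_of_isKappa hK hκ
  obtain ⟨j, hj⟩ := exists_pow_lt_of_lt_one (norm_pos_iff.2 hκ0) (inv_lt_one_of_one_lt₀ hp1)
  have h1 : ballMean f 1 1 = f 1 := S.ballMean_eq (by
    rw [norm_one, zpow_neg, Nat.cast_one, zpow_one]; exact inv_lt_one_of_one_lt₀ hp1)
  have h2 : ballMean f κ j = f κ := S.ballMean_eq (by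
    rwa [zpow_neg, zpow_natCast, ← inv_pow])
  have h3 : ballMean f 1 0 = ballMean f κ 0 := by
    have e : ∀ n : ℚ_[p], ‖n‖ ≤ 1 → Metric.closedBall n ((p : ℝ) ^ (-((0 : ℕ) : ℤ))) =
        Metric.closedBall 0 1 := fun n hn => by
      have : (p : ℝ) ^ (-((0 : ℕ) : ℤ)) = 1 := by simp
      rw [this]
      exact (IsUltrametricDist.closedBall_eq_of_mem (by simpa using hn)).symm
    rw [ballMean, ballMean, e 1 (by simp), e κ hκ1]
  rw [hconst, hone] at h1
  rw [hconst, hkap] at h2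
  have := normConst_pos h hK
  rw [h1, h2] at h3
  exact this.ne' (by exact_mod_cast h3)

theorem weilIndex_kappa (h : Anisotropic p K) (hK : Module.finrank ℚ K = 2)
    (hp2 : IsRamified K p → p ≠ 2) {κ : ℚ_[p]} (hκ : IsKappa K p κ) {t : ℚ_[p]} (ht : t ≠ 0) :
    weilIndex K (κ * t) = -weilIndex K t := by
  rw [weilIndex_eq h hK hp2 (mul_ne_zero hκ.ne_zero ht), weilIndex_eq h hK hp2 ht,
    classIntegral_kappa h hK hp2 hκ ht, mul_neg]

theorem weilIndex_ne_zero (h : Anisotropic p K) (hK : Module.finrank ℚ K = 2)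
    (hp2 : IsRamified K p → p ≠ 2) {κ : ℚ_[p]} (hκ : IsKappa K p κ) {t : ℚ_[p]} (ht : t ≠ 0) :
    weilIndex K t ≠ 0 := by
  have := selfDualConst_pos h hK (one_ne_zero (α := ℚ_[p]))
  have := normConst_pos h hK
  rw [weilIndex_eq h hK hp2 ht]
  refine mul_ne_zero ?_ (classIntegral_ne_zero h hK hp2 hκ ht)
  exact_mod_cast (by positivity : 0 < selfDualConst K (1 : ℚ_[p]) * normConst p K).ne'

end WeilIndex

/-! ### Comparison of the forms `t N` and `κ t N`. -/

section Pair

variable {p : ℕ} [Fact p.Prime] {K : Type*} [Field K] [NumberField K]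

theorem formBall_mul {a t : ℚ_[p]} (ha : a ≠ 0) (R : ℝ) :
    (formBall (a * t) (‖a‖ * R) : Set (Coords p K)) = formBall t R := by
  ext x
  change ‖a * t * coordNorm x‖ ≤ ‖a‖ * R ↔ ‖t * coordNorm x‖ ≤ R
  rw [mul_assoc, norm_mul, mul_le_mul_iff_right₀ (norm_pos_iff.2 ha)]

theorem isLocalNorm_mul_kappa_iff (h : Anisotropic p K) (hK : Module.finrank ℚ K = 2)
    (hp2 : IsRamified K p → p ≠ 2) {κ : ℚ_[p]} (hκ : IsKappa K p κ) {a : ℚ_[p]} (ha : a ≠ 0) :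
    IsLocalNorm p K (a * κ) ↔ ¬ IsLocalNorm p K a := by
  refine ⟨fun h1 h2 => not_isLocalNorm_of_isKappa hK hκ ?_,
    (isLocalNorm_or_mul h hK hp2 hκ ha).resolve_left⟩
  have := h1.div hK h2
  rwa [mul_div_cancel_left₀ _ ha] at this

theorem norm_kappa {κ : ℚ_[p]} (hκ : IsKappa K p κ) :
    (IsRamified K p ∧ ‖κ‖ = 1) ∨ (¬ IsRamified K p ∧ ‖κ‖ = (p : ℝ)⁻¹) := by
  rw [Padic.norm_eq_zpow_neg_valuation hκ.ne_zero]
  by_cases hr : IsRamified K p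
  · exact Or.inl ⟨hr, by rw [hκ.ord_ramified hr, neg_zero, zpow_zero]⟩
  · exact Or.inr ⟨hr, by rw [hκ.ord_unramified hr, zpow_neg_one]⟩

/-- Exactly one of `z` and `κ⁻¹ z` is in the norm class of `t`, and `|z| ≤ |κ| ≤ 1` keeps both
within the range of values on the lattice. -/
theorem formDensity_add (h : Anisotropic p K) (hK : Module.finrank ℚ K = 2)
    (hp2 : IsRamified K p → p ≠ 2) {κ : ℚ_[p]} (hκ : IsKappa K p κ) (hκ1 : ‖κ‖ ≤ 1) {t : ℚ_[p]}
    (ht : t ≠ 0) {z : ℚ_[p]} (hz : z ≠ 0) (hzκ : ‖z‖ ≤ ‖κ‖) :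
    formDensity t (formBall t 1 : Set (Coords p K)) z +
      formDensity t (formBall t 1 : Set (Coords p K)) (κ⁻¹ * z) =
        ((‖t‖⁻¹ * normConst p K : ℝ) : ℂ) := by
  have hκ0 := hκ.ne_zero
  have hy0 : t⁻¹ * (κ⁻¹ * z) ≠ 0 :=
    mul_ne_zero (inv_ne_zero ht) (mul_ne_zero (inv_ne_zero hκ0) hz)
  have hkey := isLocalNorm_mul_kappa_iff h hK hp2 hκ hy0
  rw [show t⁻¹ * (κ⁻¹ * z) * κ = t⁻¹ * z by field_simp] at hkey
  by_cases hn : IsLocalNorm p K (t⁻¹ * z)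
  · rw [formDensity_formBall h hK ht hz hn (hzκ.trans hκ1),
      formDensity_eq_zero h hK hp2 _ (hkey.1 hn), add_zero]
  · rw [formDensity_eq_zero h hK hp2 _ hn, zero_add,
      formDensity_formBall h hK ht (mul_ne_zero (inv_ne_zero hκ0) hz) (not_not.1 (mt hkey.2 hn))]
    rwa [norm_mul, norm_inv, inv_mul_le_iff₀ (norm_pos_iff.2 hκ0), mul_one]

theorem closedBall_eq_zero_of_norm_le {n : ℚ_[p]} {R : ℝ} (h : ‖n‖ ≤ R) :
    Metric.closedBall n R = Metric.closedBall 0 R :=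
  (IsUltrametricDist.closedBall_eq_of_mem (by simpa using h)).symm

/-- By the bound on `n` both balls are centred at `0`. Integrate `formDensity_add` over `p ^ (k + e)
ℤ_p`; the substitution `z ↦ κ⁻¹ z` carries this ball onto `p ^ k ℤ_p`. -/
theorem ballMean_add (h : Anisotropic p K) (hK : Module.finrank ℚ K = 2)
    (hp2 : IsRamified K p → p ≠ 2) {κ : ℚ_[p]} (hκ : IsKappa K p κ) {t : ℚ_[p]} (ht : t ≠ 0)
    {n : ℚ_[p]} {e k : ℕ} (he : ‖κ‖ = (p : ℝ) ^ (-(e : ℤ)))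
    (hk : ‖n‖ ≤ (p : ℝ) ^ (-((k + e : ℕ) : ℤ))) :
    ballMean (formDensity t (formBall t 1 : Set (Coords p K))) n k +
      ballMean (formDensity t (formBall t 1 : Set (Coords p K))) n (k + e) =
        ((‖t‖⁻¹ * normConst p K : ℝ) : ℂ) := by
  have hp := prime_cast_pos (p := p)
  have hp1 := one_lt_prime_cast (p := p)
  have hpc : (p : ℂ) ≠ 0 := by exact_mod_cast hp.ne'
  have hκ0 := hκ.ne_zero
  have hκ1 : ‖κ‖ ≤ 1 := by rw [he]; exact zpow_le_one_of_nonpos₀ hp1.le (by omega)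
  have S := (isNormInvariant_formBall h hK hp2 ht 1).isShellConstant_formDensity h hK hp2 ht
  set f := formDensity t (formBall t 1 : Set (Coords p K)) with hf
  set B := Metric.closedBall (0 : ℚ_[p]) ((p : ℝ) ^ (-((k + e : ℕ) : ℤ))) with hB
  have hBm : MeasurableSet B := Metric.isClosed_closedBall.measurableSet
  set B' := Metric.closedBall (0 : ℚ_[p]) ((p : ℝ) ^ (-(k : ℤ))) with hB'
  have hBB' : ∀ z, κ⁻¹ * z ∈ B' ↔ z ∈ B := by
    intro z
    rw [hB, hB', mem_closedBall_zero_iff, mem_closedBall_zero_iff, norm_mul, norm_inv,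
      inv_mul_le_iff₀ (norm_pos_iff.2 hκ0), he, ← zpow_add₀ hp.ne']
    push_cast
    rw [neg_add_rev]
  have hn' : ‖n‖ ≤ (p : ℝ) ^ (-(k : ℤ)) :=
    hk.trans (zpow_le_zpow_right₀ hp1.le (by push_cast; omega))
  have hscale : ∫ z in B, f (κ⁻¹ * z) = (‖κ‖ : ℂ) * ∫ z in B', f z := by
    have := integral_mul_left_eq (inv_ne_zero hκ0) (B'.indicator f)
    rw [integral_indicator Metric.isClosed_closedBall.measurableSet, norm_inv, inv_inv] at this
    rw [← this, ← integral_indicator hBm]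
    congr 1
    ext z
    by_cases hz : z ∈ B
    · rw [Set.indicator_of_mem hz, Set.indicator_of_mem ((hBB' z).2 hz)]
    · rw [Set.indicator_of_notMem hz, Set.indicator_of_notMem (mt (hBB' z).1 hz)]
  have hsum : (∫ z in B, f z) + ∫ z in B, f (κ⁻¹ * z) =
      ((p : ℂ) ^ ((k + e : ℕ) : ℤ))⁻¹ * ((‖t‖⁻¹ * normConst p K : ℝ) : ℂ) := by
    have hint : Integrable fun z => f (κ⁻¹ * z) := by
      have e : MeasurableEmbedding (fun x : ℚ_[p] => κ⁻¹ * x) :=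
        (Homeomorph.mulLeft₀ κ⁻¹ (inv_ne_zero hκ0)).measurableEmbedding
      refine (e.integrable_map_iff (g := f)).1 ?_
      rw [map_mul_volume _ (inv_ne_zero hκ0)]
      exact S.integrable.smul_measure_nnreal
    rw [← integral_add S.integrable.integrableOn hint.integrableOn]
    have : ∀ᵐ z, z ∈ B → f z + f (κ⁻¹ * z) = ((‖t‖⁻¹ * normConst p K : ℝ) : ℂ) := by
      filter_upwards [ae_ne_zero] with z hz hzB
      refine formDensity_add h hK hp2 hκ hκ1 ht hz ?_
      rw [hB, mem_closedBall_zero_iff] at hzB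
      exact hzB.trans (by rw [he]; exact zpow_le_zpow_right₀ hp1.le (by push_cast; omega))
    rw [setIntegral_congr_ae hBm this, setIntegral_const, volume_real_closedBall_zpow,
      Complex.real_smul]
    push_cast
    rw [zpow_neg]
  rw [ballMean, ballMean, closedBall_eq_zero_of_norm_le hk, closedBall_eq_zero_of_norm_le hn',
    ← hB, ← hB']
  have hκc : (‖κ‖ : ℂ) = ((p : ℂ) ^ (e : ℤ))⁻¹ := by rw [he]; push_cast; rw [zpow_neg]
  rw [hscale, hκc] at hsum
  have hpe : (p : ℂ) ^ ((k + e : ℕ) : ℤ) ≠ 0 := zpow_ne_zero _ hpc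
  have hpe' : (p : ℂ) ^ (e : ℤ) ≠ 0 := zpow_ne_zero _ hpc
  have hsplit : (p : ℂ) ^ ((k + e : ℕ) : ℤ) = (p : ℂ) ^ (k : ℤ) * (p : ℂ) ^ (e : ℤ) := by
    rw [← zpow_add₀ hpc]; push_cast; rfl
  calc _ = (p : ℂ) ^ ((k + e : ℕ) : ℤ) *
        ((∫ z in B, f z) + ((p : ℂ) ^ (e : ℤ))⁻¹ * ∫ z in B', f z) := by
          rw [mul_add, ← mul_assoc ((p : ℂ) ^ ((k + e : ℕ) : ℤ)) _⁻¹, hsplit,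
            mul_inv_cancel_right₀ hpe', add_comm]
    _ = _ := by rw [hsum, mul_inv_cancel_left₀ hpe]

/-- For `e = 0` each term is `c / 2`. For `e = 1` the `ν + 1` terms, even in number, group into
consecutive pairs of sum `c`. -/
theorem sum_range_of_add_eq {D : ℕ → ℂ} {c : ℂ} {e ν : ℕ} (he : e ≤ 1) (hν : e = 1 → Odd ν)
    (hD : ∀ k, k + e ≤ ν → D k + D (k + e) = c) :
    ∑ k ∈ Finset.range (ν + 1), D k = ((ν : ℂ) + 1) / 2 * c := by
  interval_cases e
  · have : ∀ k ∈ Finset.range (ν + 1), D k = c / 2 := fun k hk => by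
      have := hD k (by simpa [Nat.lt_succ_iff] using hk)
      linear_combination this / 2
    rw [Finset.sum_congr rfl this]
    simp
    ring
  · obtain ⟨l, rfl⟩ := hν rfl
    have : ∀ j, j ≤ l → ∑ k ∈ Finset.range (2 * j + 1 + 1), D k = ((j : ℂ) + 1) * c := by
      intro j
      induction j with
      | zero => intro _; simpa [Finset.sum_range_succ] using hD 0 (by omega)
      | succ j ih =>
        intro hj
        rw [show 2 * (j + 1) + 1 + 1 = 2 * j + 1 + 1 + 1 + 1 by ring, Finset.sum_range_succ,
          Finset.sum_range_succ, ih (by omega)]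
        have := hD (2 * j + 1 + 1) (by omega)
        push_cast
        linear_combination this
    rw [this l le_rfl]
    push_cast
    ring

theorem IsShellConstant.ballMean_eq_zero {f : ℚ_[p] → ℂ} {R C : ℝ} (H : IsShellConstant f R C)
    {n : ℚ_[p]} (hR : R ≤ 1) (hn : 1 < ‖n‖) (k : ℕ) : ballMean f n k = 0 := by
  have hk : (p : ℝ) ^ (-(k : ℤ)) ≤ 1 :=
    zpow_le_one_of_nonpos₀ one_lt_prime_cast.le (by omega)
  rw [H.ballMean_eq (hk.trans_lt hn), H.support _ (hR.trans_lt hn)]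

theorem whittakerSum_eq_zero {f : ℚ_[p] → ℂ} {n : ℚ_[p]} (hf : ∀ k, ballMean f n k = 0) (M : ℕ)
    (s : ℂ) : whittakerSum f n M s = 0 := by
  simp [whittakerSum, hf]

/-- The Whittaker functions of the characteristic functions of the set `|t N(x)| ≤ 1` for the forms
`t N(x)` and `κ t N(x)`, at a number `n` not represented by `t N(x)`. -/
theorem exists_isWhittaker_pair (h : Anisotropic p K) (hK : Module.finrank ℚ K = 2)
    (hp2 : IsRamified K p → p ≠ 2) {κ : ℚ_[p]} (hκ : IsKappa K p κ) {t : ℚ_[p]} (ht : t ≠ 0)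
    (htN : ¬ IsRamified K p → ∃ j : ℤ, ‖t‖ = (p : ℝ) ^ (2 * j)) {n : ℚ} (hn0 : n ≠ 0)
    (hn : ¬ IsLocalNorm p K (t⁻¹ * n)) {φ φ' : LocalAlg p K → ℂ}
    (hφ : ∀ x, φ (coordEquiv p K x) = (formBall t 1).indicator 1 x)
    (hφ' : ∀ x, φ' (coordEquiv p K x) = (formBall t 1).indicator 1 x) :
    ∃ W W' : ℂ → ℂ, IsWhittaker t φ n W ∧ IsWhittaker (κ * t) φ' n W' ∧
      (1 < ‖(n : ℚ_[p])‖ → (∀ s, W s = 0) ∧ ∀ s, W' s = 0) ∧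
      (‖(n : ℚ_[p])‖ ≤ 1 → W 0 = 0 ∧ W' 0 ≠ 0 ∧
        deriv W 0 = -(1 / 2) * ((padicValRat p n : ℂ) + 1) * (Real.log p : ℂ) * W' 0) := by
  have hp := prime_cast_pos (p := p)
  have hp1 := one_lt_prime_cast (p := p)
  have hκ0 := hκ.ne_zero
  have hκt := mul_ne_zero hκ0 ht
  have hC := normConst_pos h hK
  have hnc : (n : ℚ_[p]) ≠ 0 := by exact_mod_cast hn0
  have hnv : ‖(n : ℚ_[p])‖ = (p : ℝ) ^ (-padicValRat p n) := by
    rw [Padic.eq_padicNorm, padicNorm.eq_zpow_of_nonzero hn0]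
    push_cast
    rfl
  obtain ⟨e, he1, he, heR⟩ : ∃ e : ℕ, e ≤ 1 ∧ ‖κ‖ = (p : ℝ) ^ (-(e : ℤ)) ∧
      (e = 1 → ¬ IsRamified K p) := by
    rcases norm_kappa hκ with ⟨_, h1⟩ | ⟨h2, h1⟩
    · exact ⟨0, by norm_num, by simpa using h1, by norm_num⟩
    · exact ⟨1, le_rfl, by simpa using h1, fun _ => h2⟩
  have hκ1 : ‖κ‖ ≤ 1 := by rw [he]; exact zpow_le_one_of_nonpos₀ hp1.le (by omega)
  have H := isNormInvariant_formBall h hK hp2 ht 1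
  have S := H.isShellConstant_formDensity h hK hp2 ht
  have S' := H.isShellConstant_formDensity h hK hp2 hκt
  have ht' := norm_pos_iff.2 ht
  set M : ℕ := (padicValRat p n).toNat + 1 with hMdef
  have hM : (p : ℝ) ^ (-(M : ℤ)) < ‖(n : ℚ_[p])‖ := by
    rw [hnv]
    exact zpow_lt_zpow_right₀ hp1 (by omega)
  refine ⟨_, _, H.isWhittaker h hK hp2 ht hφ hM, H.isWhittaker h hK hp2 hκt hφ' hM, fun hn1 => ?_,
    fun hn1 => ?_⟩
  · refine ⟨fun s => ?_, fun s => ?_⟩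
    · rw [whittakerSum_eq_zero (S.ballMean_eq_zero _ hn1), mul_zero]
      rw [mul_one, mul_inv_cancel₀ ht'.ne']
    · rw [whittakerSum_eq_zero (S'.ballMean_eq_zero _ hn1), mul_zero]
      rwa [mul_one, norm_mul, mul_assoc, mul_inv_cancel₀ ht'.ne', mul_one]
  obtain ⟨ν, hν⟩ : ∃ ν : ℕ, padicValRat p n = ν := by
    refine Int.eq_ofNat_of_zero_le (not_lt.1 fun hlt => hn1.not_gt ?_)
    rw [hnv]
    exact one_lt_zpow₀ hp1 (by omega)
  have hMν : M = ν + 1 := by rw [hMdef, hν]; simp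
  -- Here `p` is unramified, `t` has even valuation and `t⁻¹ n` is not a norm, so `ord n` is odd.
  have hνodd : e = 1 → Odd ν := by
    intro he'
    obtain ⟨j, hj⟩ := htN (heR he')
    rw [isLocalNorm_iff_of_not_isRamified h hK (heR he') (mul_ne_zero (inv_ne_zero ht) hnc)] at hn
    by_contra hodd
    rw [Nat.not_odd_iff_even] at hodd
    obtain ⟨l, hl⟩ := hodd
    refine hn ⟨-l - j, ?_⟩
    rw [norm_mul, norm_inv, hnv, hν, hj, ← zpow_neg, ← zpow_add₀ hp.ne']
    congr 1
    omega
  have hnκ : ‖(n : ℚ_[p])‖ ≤ ‖κ‖ := by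
    rw [hnv, hν, he]
    refine zpow_le_zpow_right₀ hp1.le ?_
    rcases Nat.le_one_iff_eq_zero_or_eq_one.1 he1 with h0 | h0
    · omega
    · have := (hνodd h0).pos
      omega
  have hW0 : ballMean (formDensity t (formBall t 1 : Set (Coords p K))) n M = 0 := by
    rw [S.ballMean_eq hM, formDensity_eq_zero h hK hp2 _ hn]
  have hsum : ∑ k ∈ Finset.range M, ballMean (formDensity t (formBall t 1 : Set (Coords p K))) n k =
      ((ν : ℂ) + 1) / 2 * ((‖t‖⁻¹ * normConst p K : ℝ) : ℂ) := by
    rw [hMν]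
    refine sum_range_of_add_eq he1 hνodd fun k hk => ballMean_add h hK hp2 hκ ht he ?_
    rw [hnv, hν]
    exact zpow_le_zpow_right₀ hp1.le (by omega)
  -- As `n` is not in the norm class of `t`, it is in that of `κ t`, where the density attains its
  -- full value.
  have hW' : ballMean (formDensity (κ * t) (formBall t 1 : Set (Coords p K))) n M =
      ((‖κ * t‖⁻¹ * normConst p K : ℝ) : ℂ) := by
    rw [S'.ballMean_eq hM, ← formBall_mul hκ0 1]
    refine formDensity_formBall h hK hκt hnc ?_ (by rwa [mul_one])
    have hy0 : (κ * t)⁻¹ * (n : ℚ_[p]) ≠ 0 := mul_ne_zero (inv_ne_zero hκt) hnc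
    have := isLocalNorm_mul_kappa_iff h hK hp2 hκ hy0
    rw [show (κ * t)⁻¹ * (n : ℚ_[p]) * κ = t⁻¹ * n by field_simp] at this
    exact not_not.1 (mt this.2 hn)
  have hγ := weilIndex_ne_zero h hK hp2 hκ hκt
  have hDt := selfDualConst_pos h hK hκt
  refine ⟨?_, ?_, ?_⟩
  · rw [whittakerSum_zero, hW0, mul_zero]
  · rw [whittakerSum_zero, hW']
    have := norm_pos_iff.2 hκt
    refine mul_ne_zero (mul_ne_zero hγ (by exact_mod_cast hDt.ne')) ?_
    exact_mod_cast (by positivity : 0 < ‖κ * t‖⁻¹ * normConst p K).ne'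
  -- The factors `|t|` and `|κ t|` of the self-dual measures cancel those of the densities; the
  -- minus sign is the ratio of the Weil indices.
  · rw [deriv_const_mul _ (differentiable_whittakerSum _ _ _ _), deriv_whittakerSum _ _ _ hW0,
      hsum, whittakerSum_zero, hW', weilIndex_kappa h hK hp2 hκ ht, hν, selfDualConst_eq hK t,
      selfDualConst_eq hK (κ * t)]
    have h1 : ((‖t‖ : ℝ) : ℂ) ≠ 0 := by exact_mod_cast ht'.ne'
    have h2 : ((‖κ * t‖ : ℝ) : ℂ) ≠ 0 := by exact_mod_cast (norm_pos_iff.2 hκt).ne'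
    push_cast
    field_simp

end Pair

/-! ### The test functions as lattice indicators. -/

section LocalData

variable {p : ℕ} [Fact p.Prime] {K : Type*} [Field K] [NumberField K]

theorem inv_differentAt_mul {𝔞 : FractionalIdeal (𝓞 K)⁰ K} (h𝔞 : 𝔞 ≠ 0) (lam : K) :
    (differentAt 𝔞 lam)⁻¹ * 𝔞 = 𝔞 + FractionalIdeal.spanSingleton (𝓞 K)⁰ lam := by
  rw [differentAt, inv_inv, inv_mul_cancel_right₀ h𝔞]

theorem add_spanSingleton_ne_zero {𝔞 : FractionalIdeal (𝓞 K)⁰ K} (h𝔞 : 𝔞 ≠ 0) (lam : K) :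
    𝔞 + FractionalIdeal.spanSingleton (𝓞 K)⁰ lam ≠ 0 := fun h0 =>
  h𝔞 (le_antisymm (h0 ▸ le_self_add) zero_le)

theorem norm_absNorm_pos {I : FractionalIdeal (𝓞 K)⁰ K} (hI : I ≠ 0) :
    0 < ‖((FractionalIdeal.absNorm I : ℚ) : ℚ_[p])‖ := by
  rw [norm_pos_iff]
  exact_mod_cast mt FractionalIdeal.absNorm_eq_zero_iff.1 hI

theorem formCoeff_ne_zero {𝔞 : FractionalIdeal (𝓞 K)⁰ K} (h𝔞 : 𝔞 ≠ 0) (lam : K) :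
    formCoeff 𝔞 lam ≠ 0 := by
  rw [formCoeff, inv_differentAt_mul h𝔞, neg_ne_zero]
  exact mt FractionalIdeal.absNorm_eq_zero_iff.1 (add_spanSingleton_ne_zero h𝔞 lam)

theorem norm_formCoeff (h : Anisotropic p K) (hK : Module.finrank ℚ K = 2)
    {𝔞 : FractionalIdeal (𝓞 K)⁰ K} (h𝔞 : 𝔞 ≠ 0) (lam : K) :
    ‖(formCoeff 𝔞 lam : ℚ_[p])‖ = max ‖((FractionalIdeal.absNorm 𝔞 : ℚ) : ℚ_[p])‖
      ‖Algebra.norm ℚ_[p] (toLocal p lam)‖ := by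
  rw [formCoeff, inv_differentAt_mul h𝔞, Rat.cast_neg, norm_neg,
    norm_absNorm_add_spanSingleton h hK h𝔞, norm_toLocal]

/-- Up to a unit, the coefficient is the norm of an element of `𝔞 + (λ)`, and norms have even
valuation when `p` is unramified. -/
theorem exists_norm_formCoeff {𝔞 : FractionalIdeal (𝓞 K)⁰ K} (h𝔞 : 𝔞 ≠ 0) (lam : K)
    (h : Anisotropic p K) (hK : Module.finrank ℚ K = 2) (hram : ¬ IsRamified K p) :
    ∃ j : ℤ, ‖(formCoeff 𝔞 lam : ℚ_[p])‖ = (p : ℝ) ^ (2 * j) := by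
  obtain ⟨x, -, hx⟩ := exists_mem_norm_norm_eq (p := p) (add_spanSingleton_ne_zero h𝔞 lam)
  have hx' : ‖Algebra.norm ℚ_[p] (toLocal p x)‖ = ‖(formCoeff 𝔞 lam : ℚ_[p])‖ := by
    rw [norm_toLocal, hx, formCoeff, inv_differentAt_mul h𝔞, Rat.cast_neg, norm_neg]
  rw [← hx']
  refine exists_norm_eq_zpow_two_mul h hK hram ⟨_, rfl⟩ ?_
  rw [← norm_pos_iff, hx', norm_pos_iff]
  exact_mod_cast formCoeff_ne_zero h𝔞 lam

theorem discrAt_mul_formCoeff {𝔞 : FractionalIdeal (𝓞 K)⁰ K} (h𝔞 : 𝔞 ≠ 0) (lam : K) :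
    discrAt 𝔞 lam * formCoeff 𝔞 lam = -FractionalIdeal.absNorm 𝔞 := by
  have h0 : differentAt 𝔞 lam ≠ 0 :=
    inv_ne_zero (mul_ne_zero (add_spanSingleton_ne_zero h𝔞 lam) (inv_ne_zero h𝔞))
  rw [discrAt, formCoeff, mul_neg, ← map_mul, mul_inv_cancel_left₀ h0]

theorem discrAt_ne_zero {𝔞 : FractionalIdeal (𝓞 K)⁰ K} (h𝔞 : 𝔞 ≠ 0) (lam : K) :
    discrAt 𝔞 lam ≠ 0 :=
  left_ne_zero_of_mul (a := discrAt 𝔞 lam) (b := formCoeff 𝔞 lam) (by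
    rw [discrAt_mul_formCoeff h𝔞, neg_ne_zero]
    exact mt FractionalIdeal.absNorm_eq_zero_iff.1 h𝔞)

theorem Anisotropic.mem_localIdeal_inv_iff (h : Anisotropic p K) (hK : Module.finrank ℚ K = 2)
    {I : FractionalIdeal (𝓞 K)⁰ K} (hI : I ≠ 0) (x : LocalAlg p K) :
    x ∈ localIdeal p I⁻¹ ↔
      ‖((FractionalIdeal.absNorm I : ℚ) : ℚ_[p])‖ * ‖Algebra.norm ℚ_[p] x‖ ≤ 1 := by
  rw [h.mem_localIdeal_iff hK (inv_ne_zero hI), map_inv₀, Rat.cast_inv, norm_inv, ← one_div,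
    le_div_iff₀' (norm_absNorm_pos hI)]

theorem norm_norm_toLocal_le {𝔞 : FractionalIdeal (𝓞 K)⁰ K} (h𝔞 : 𝔞 ≠ 0) {lam : K}
    (hlam : lam ∈ (different K)⁻¹ * 𝔞) :
    ‖Algebra.norm ℚ_[p] (toLocal p lam)‖ ≤ ‖(NumberField.discr K : ℚ_[p])‖⁻¹ *
      ‖((FractionalIdeal.absNorm 𝔞 : ℚ) : ℚ_[p])‖ := by
  have := norm_norm_le_absNorm (p := p) (mul_ne_zero (inv_ne_zero different_ne_zero) h𝔞) hlam
  rwa [map_mul, Rat.cast_mul, norm_mul, norm_absNorm_inv_different, ← norm_toLocal] at this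

theorem conj_mem_localInt_iff (h : Anisotropic p K) (hK : Module.finrank ℚ K = 2)
    (x : LocalAlg p K) : conj x ∈ localInt p K ↔ x ∈ localInt p K := by
  rw [h.mem_localInt_iff hK, h.mem_localInt_iff hK, norm_conj hK]

theorem mul_mem_localInt (h : Anisotropic p K) (hK : Module.finrank ℚ K = 2) {x y : LocalAlg p K}
    (hx : x ∈ localInt p K) (hy : y ∈ localInt p K) : x * y ∈ localInt p K := by
  rw [h.mem_localInt_iff hK] at *
  rw [map_mul, norm_mul]
  exact mul_le_one₀ hx (norm_nonneg _) hy

/-- The set `|t N(x)| ≤ 1`, for `t` the coefficient of the form, is the lattice `(𝔞 + (λ))⁻¹`. -/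
theorem mem_formBall_iff (h : Anisotropic p K) (hK : Module.finrank ℚ K = 2)
    {𝔞 : FractionalIdeal (𝓞 K)⁰ K} (h𝔞 : 𝔞 ≠ 0) (lam : K) (x : Coords p K) :
    x ∈ formBall (formCoeff 𝔞 lam : ℚ_[p]) 1 ↔
      coordEquiv p K x ∈ localIdeal p 𝔞⁻¹ ∧ coordEquiv p K x * toLocal p lam ∈ localInt p K := by
  change ‖(formCoeff 𝔞 lam : ℚ_[p]) * coordNorm x‖ ≤ 1 ↔ _
  rw [h.mem_localIdeal_inv_iff hK h𝔞, h.mem_localInt_iff hK, norm_mul, norm_formCoeff h hK h𝔞,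
    max_mul_of_nonneg _ _ (norm_nonneg _), max_le_iff, map_mul, norm_mul,
    mul_comm ‖Algebra.norm ℚ_[p] (coordEquiv p K x)‖ ‖Algebra.norm ℚ_[p] (toLocal p lam)‖]
  rfl

theorem mul_toLocal_mem_localInt (h : Anisotropic p K) (hK : Module.finrank ℚ K = 2)
    {𝔞 : FractionalIdeal (𝓞 K)⁰ K} (h𝔞 : 𝔞 ≠ 0) {lam : K} (hlam : lam ∈ (different K)⁻¹ * 𝔞)
    (hram : ¬ IsRamified K p) {x : LocalAlg p K} (hx : x ∈ localIdeal p 𝔞⁻¹) :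
    x * toLocal p lam ∈ localInt p K := by
  have h1 := norm_norm_toLocal_le (p := p) h𝔞 hlam
  rw [norm_discr_eq_one hram, inv_one, one_mul] at h1
  rw [h.mem_localIdeal_inv_iff hK h𝔞] at hx
  rw [h.mem_localInt_iff hK, map_mul, norm_mul, mul_comm]
  exact (mul_le_mul_of_nonneg_right h1 (norm_nonneg _)).trans hx

/-- The inverse of the element `α` of the different's inverse is an integral non-unit, hence a
multiple of `ϖ`, which gives `|N ϖ| ≥ 1 / p`. As `ϖ` is itself a non-unit, `|N ϖ| < 1`. -/
theorem norm_norm_uniformizer (h : Anisotropic p K) (hK : Module.finrank ℚ K = 2)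
    (hram : IsRamified K p) (hp2 : p ≠ 2) {ϖ : LocalAlg p K} (hϖ : IsUniformizer ϖ) :
    ‖Algebra.norm ℚ_[p] ϖ‖ = (p : ℝ)⁻¹ := by
  have hp := prime_cast_pos (p := p)
  have hp1 := one_lt_prime_cast (p := p)
  have := prime_cast_ne_zero (p := p)
  obtain ⟨-, α, -, hα⟩ := exists_mem_inv_different h hK hram hp2
  rw [← norm_toLocal] at hα
  have hα0 : Algebra.norm ℚ_[p] (toLocal p α) ≠ 0 := by
    rw [← norm_pos_iff, hα]; exact hp
  obtain ⟨v, hv⟩ := h.exists_unit hK _ hα0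
  obtain ⟨hϖO, hϖ⟩ := hϖ
  have hβ := Anisotropic.norm_mul_norm_eq_one v.inv_mul
  rw [hv, hα] at hβ
  have hβ' : ‖Algebra.norm ℚ_[p] ((v⁻¹ : (LocalAlg p K)ˣ) : LocalAlg p K)‖ = (p : ℝ)⁻¹ :=
    eq_inv_of_mul_eq_one_left hβ
  have hβO : ((v⁻¹ : (LocalAlg p K)ˣ) : LocalAlg p K) ∈ localInt p K := by
    rw [h.mem_localInt_iff hK, hβ']
    exact inv_le_one_of_one_le₀ hp1.le
  obtain ⟨y, hy, hβy⟩ := (hϖ _ hβO).2 (by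
    rintro ⟨y, hy, hvy⟩
    have h1 := Anisotropic.norm_mul_norm_eq_one hvy
    rw [h.mem_localInt_iff hK] at hy
    rw [hβ', inv_mul_eq_one₀ hp.ne'] at h1
    linarith)
  rw [h.mem_localInt_iff hK] at hy
  have hge : (p : ℝ)⁻¹ ≤ ‖Algebra.norm ℚ_[p] ϖ‖ := by
    rw [← hβ', hβy, map_mul, norm_mul]
    exact mul_le_of_le_one_right (norm_nonneg _) hy
  refine le_antisymm ?_ hge
  have h1 : (1 : LocalAlg p K) ∈ localInt p K := by
    rw [h.mem_localInt_iff hK, map_one, norm_one]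
  have hnu := (hϖ ϖ hϖO).1 ⟨1, h1, (mul_one ϖ).symm⟩
  have hlt : ‖Algebra.norm ℚ_[p] ϖ‖ < (p : ℝ) ^ (0 : ℤ) := by
    rw [zpow_zero]
    refine lt_of_le_of_ne ((h.mem_localInt_iff hK _).1 hϖO) fun h2 => hnu ?_
    obtain ⟨u, hu⟩ := h.exists_unit hK ϖ (by rw [← norm_pos_iff, h2]; exact one_pos)
    have h3 := Anisotropic.norm_mul_norm_eq_one u.mul_inv
    rw [hu, h2, one_mul] at h3
    exact ⟨↑u⁻¹, (h.mem_localInt_iff hK _).2 h3.le, by rw [← hu, Units.mul_inv]⟩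
  rw [norm_lt_iff_le_zpow] at hlt
  simpa using hlt

/-- At an odd ramified prime `|N ϖ| = |N ∂| = 1 / p`, so `ϖ ∂⁻¹ = O` locally. -/
theorem exists_eq_uniformizer_mul_iff (h : Anisotropic p K) (hK : Module.finrank ℚ K = 2)
    (hram : IsRamified K p) (hp2 : p ≠ 2) {ϖ : LocalAlg p K} (hϖ : IsUniformizer ϖ)
    (x : LocalAlg p K) :
    (∃ y ∈ localIdeal p (different K)⁻¹, x = ϖ * y) ↔ x ∈ localInt p K := by
  have hp := prime_cast_pos (p := p)
  have hN := norm_norm_uniformizer h hK hram hp2 hϖ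
  have hD := (exists_mem_inv_different h hK hram hp2).1
  have hmem : ∀ y, y ∈ localIdeal p (different K)⁻¹ ↔ ϖ * y ∈ localInt p K := fun y => by
    rw [h.mem_localIdeal_inv_iff hK different_ne_zero, norm_absNorm_different, hD,
      h.mem_localInt_iff hK, map_mul, norm_mul, hN]
  obtain ⟨u, rfl⟩ := h.exists_unit hK ϖ (by rw [← norm_pos_iff, hN]; positivity)
  constructor
  · rintro ⟨y, hy, rfl⟩
    exact (hmem y).1 hy
  · intro hx
    refine ⟨↑u⁻¹ * x, (hmem _).2 ?_, ?_⟩ <;> rw [Units.mul_inv_cancel_left]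
    exact hx

theorem phi_eq_indicator (h : Anisotropic p K) (hK : Module.finrank ℚ K = 2)
    {𝔞 : FractionalIdeal (𝓞 K)⁰ K} (h𝔞 : 𝔞 ≠ 0) {lam : K} (hlam : lam ∈ (different K)⁻¹ * 𝔞)
    {r : K} (hr : IsRamified K p → toLocal p r ∈ localInt p K) (x : Coords p K) :
    phi p 𝔞 lam r (coordEquiv p K x) =
      (formBall (formCoeff 𝔞 lam : ℚ_[p]) 1).indicator 1 x := by
  classical
  rw [Set.indicator_apply, phi]
  refine if_congr ?_ rfl rfl
  rw [mem_formBall_iff h hK h𝔞]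
  refine and_congr_right fun hx => ?_
  by_cases hram : IsRamified K p
  · have hr' := (conj_mem_localInt_iff h hK _).2 (hr hram)
    simp only [hram, forall_const]
    exact Submodule.add_mem_iff_left _ hr'
  · exact ⟨fun _ => mul_toLocal_mem_localInt h hK h𝔞 hlam hram hx, fun _ hram' => (hram hram').elim⟩

/-- For ramified `p` the factor with `ϖ ∂⁻¹` says that `x λ` is integral, and then the one with `μ`
is automatic. For unramified `p`, `λ ∈ 𝔞_p`, so `x ∈ 𝔞_p⁻¹` already makes `x λ` integral. -/
theorem phiCoh_eq_indicator (h : Anisotropic p K) (hK : Module.finrank ℚ K = 2)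
    (hp2 : IsRamified K p → p ≠ 2)
    {𝔞 : FractionalIdeal (𝓞 K)⁰ K} (h𝔞 : 𝔞 ≠ 0) {lam : K} (hlam : lam ∈ (different K)⁻¹ * 𝔞)
    {r : K} (hr : IsRamified K p → toLocal p r ∈ localInt p K) {ϖ μ : LocalAlg p K}
    (hϖ : IsRamified K p → IsUniformizer ϖ) (hμ : IsRamified K p → μ ∈ localInt p K)
    (x : Coords p K) :
    phiCoh p 𝔞 lam r ϖ μ (coordEquiv p K x) =
      (formBall (formCoeff 𝔞 lam : ℚ_[p]) 1).indicator 1 x := by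
  classical
  rw [Set.indicator_apply, phiCoh]
  refine if_congr ?_ rfl rfl
  rw [mem_formBall_iff h hK h𝔞]
  refine and_congr_right fun hx => ?_
  by_cases hram : IsRamified K p
  · have hr' := (conj_mem_localInt_iff h hK _).2 (hr hram)
    simp only [hram, forall_const]
    rw [exists_eq_uniformizer_mul_iff h hK hram (hp2 hram) (hϖ hram)]
    refine ⟨fun H => H.1, fun H => ⟨H, Submodule.add_mem _ ?_ hr'⟩⟩
    rw [mul_assoc]
    exact mul_mem_localInt h hK (hμ hram) H
  · exact ⟨fun _ => mul_toLocal_mem_localInt h hK h𝔞 hlam hram hx, fun _ hram' => (hram hram').elim⟩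

/-- On the support `μ x λ` is integral, so the last condition would make `r` integral. -/
theorem phiCoh_eq_zero (h : Anisotropic p K) (hK : Module.finrank ℚ K = 2)
    (hp2 : p ≠ 2) (hram : IsRamified K p) (𝔞 : FractionalIdeal (𝓞 K)⁰ K) (lam : K)
    {r : K} (hr : toLocal p r ∉ localInt p K) {ϖ μ : LocalAlg p K}
    (hϖ : IsUniformizer ϖ) (hμ : μ ∈ localInt p K) (x : LocalAlg p K) :
    phiCoh p 𝔞 lam r ϖ μ x = 0 := by
  rw [phiCoh, if_neg]
  rintro ⟨-, H⟩
  obtain ⟨h1, h2⟩ := H hram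
  rw [exists_eq_uniformizer_mul_iff h hK hram hp2 hϖ] at h1
  rw [mul_assoc, Submodule.add_mem_iff_right _ (mul_mem_localInt h hK hμ h1),
    conj_mem_localInt_iff h hK] at h2
  exact hr h2

theorem isWhittaker_of_forall_eq_zero (hK : Module.finrank ℚ K = 2) (t : ℚ_[p])
    {φ : LocalAlg p K → ℂ} (hφ : ∀ x, φ x = 0) (n : ℚ) : IsWhittaker t φ n fun _ => 0 := by
  have h0 : ∀ s, whittakerIntegrand t φ n s = fun _ => 0 := fun s => by
    ext b
    rw [whittakerIntegrand_eq hK]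
    simp [hφ]
  exact ⟨differentiable_const _, fun s _ => by rw [h0]; exact integrable_zero _ _ _,
    fun s _ => by rw [h0, integral_zero]⟩

end LocalData

/-! ### The case of a non-integral `r` at a ramified prime. -/

section Translate

variable {p : ℕ} [Fact p.Prime] {K : Type*} [Field K] [NumberField K]

theorem exists_sq_eq_of_mem_ball (hp2 : p ≠ 2) {w : ℚ_[p]} (hw : w ∈ Metric.ball (1 : ℚ_[p]) 1) :
    ∃ a : ℚ_[p], a ^ 2 = w ∧ ‖a - 1‖ < 1 := by
  obtain ⟨a, ha⟩ := exists_sq_eq hp2 hw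
  rw [Metric.mem_ball, dist_eq_norm, ← ha, show a ^ 2 - 1 = (a - 1) * (a + 1) by ring,
    norm_mul] at hw
  by_cases h1 : ‖a - 1‖ < 1
  · exact ⟨a, ha, h1⟩
  · refine ⟨-a, by rw [neg_sq, ha], ?_⟩
    rw [show -a - 1 = -(a + 1) by ring, norm_neg]
    by_contra h2
    exact hw.not_ge (one_le_mul_of_one_le_of_one_le (not_lt.1 h1) (not_lt.1 h2))

/-- The set of `x` with `|N(x)| ≤ R` and `x l + c` integral. -/
def translateSet (R : ℝ) (l c : LocalAlg p K) : Set (Coords p K) :=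
  {x | ‖coordNorm x‖ ≤ R ∧ ‖Algebra.norm ℚ_[p] (coordEquiv p K x * l + c)‖ ≤ 1}

/-- The multipliers are scalars `a ≡ 1` modulo `p` with `a² = w`. They change `x l` by `(a - 1) x
l`, whose norm has absolute value at most `p⁻² · p`, so the integrality of `x l + c` is not
affected. -/
theorem isNormInvariant_translateSet (h : Anisotropic p K) (hK : Module.finrank ℚ K = 2)
    (hp2 : p ≠ 2) {R : ℝ} {l c : LocalAlg p K}
    (hl : ∀ x : LocalAlg p K, ‖Algebra.norm ℚ_[p] x‖ ≤ R → ‖Algebra.norm ℚ_[p] (x * l)‖ ≤ p) :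
    IsNormInvariant (translateSet R l c) R where
  measurableSet := by
    have e : ∀ x : Coords p K, Algebra.norm ℚ_[p] (coordEquiv p K x * l + c) =
        coordNorm (mulCoords l x + (coordEquiv p K).symm c) := fun x => by
      rw [coordNorm, map_add (coordEquiv p K), coordEquiv_mulCoords, LinearEquiv.apply_symm_apply,
        mul_comm]
    have hc : Continuous (mulCoords l : Coords p K → Coords p K) :=
      LinearMap.continuous_of_finiteDimensional _
    refine (measurableSet_le (f := fun x : Coords p K => ‖coordNorm x‖) (by fun_prop)
      measurable_const).inter
      (measurableSet_le (f := fun x : Coords p K =>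
        ‖Algebra.norm ℚ_[p] (coordEquiv p K x * l + c)‖) ?_ measurable_const)
    simp only [e]
    exact (continuous_coordNorm.comp (hc.add continuous_const)).norm.measurable
  volume_ne_top := by
    refine ne_top_of_le_ne_top (isNormInvariant_formBall h hK (fun _ => hp2)
      (one_ne_zero (α := ℚ_[p])) R).volume_ne_top (measure_mono fun x hx => ?_)
    change ‖1 * coordNorm x‖ ≤ R
    rw [one_mul]
    exact hx.1
  norm_le := fun x hx => hx.1
  exists_unit := by
    intro w hw
    have hp := prime_cast_pos (p := p)
    have hw1 := norm_eq_one_of_mem_ball hw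
    obtain ⟨a, ha, ha1⟩ := exists_sq_eq_of_mem_ball hp2 hw
    have hF := finrank_localAlg (p := p) hK
    have : Module.Finite ℚ_[p] (LocalAlg p K) := Module.finite_of_finrank_pos (by omega)
    have hN : Algebra.norm ℚ_[p] (algebraMap ℚ_[p] (LocalAlg p K) a) = w := by
      rw [Algebra.norm_algebraMap, hF, ha]
    obtain ⟨v, hv⟩ := h.exists_unit hK (algebraMap ℚ_[p] (LocalAlg p K) a) (by
      rw [hN, ← norm_pos_iff, hw1]; exact one_pos)
    refine ⟨v, by rw [hv, hN], ?_⟩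
    ext x
    simp only [Set.mem_preimage, translateSet, Set.mem_ofPred_eq]
    rw [coordNorm_unitMul, coordEquiv_unitMul, hv, hN, norm_mul, hw1, one_mul]
    refine and_congr_right fun hx => ?_
    rw [← h.mem_localInt_iff hK, ← h.mem_localInt_iff hK,
      show algebraMap ℚ_[p] (LocalAlg p K) a * coordEquiv p K x * l + c =
        (a - 1) • (coordEquiv p K x * l) + (coordEquiv p K x * l + c) by
          rw [Algebra.smul_def, map_sub, map_one]; ring]
    refine Submodule.add_mem_iff_right _ ?_
    rw [h.mem_localInt_iff hK, norm_smul_of_finrank_two hF, norm_mul, norm_pow]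
    have h1 : ‖a - 1‖ ≤ (p : ℝ)⁻¹ := by
      have : ‖a - 1‖ < (p : ℝ) ^ (0 : ℤ) := by simpa using ha1
      rw [norm_lt_iff_le_zpow] at this
      simpa using this
    have hp1 := one_lt_prime_cast (p := p)
    calc ‖a - 1‖ ^ 2 * _ ≤ ((p : ℝ)⁻¹) ^ 2 * p := by gcongr; exact hl _ hx
      _ = (p : ℝ)⁻¹ := by field_simp
      _ ≤ 1 := inv_le_one_of_one_le₀ hp1.le

/-- If `c` is not integral, the Whittaker function of `translateSet R l c` vanishes at the numbers
that are not represented by the form. -/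
theorem isWhittaker_zero_of_translateSet (h : Anisotropic p K) (hK : Module.finrank ℚ K = 2)
    (hp2 : p ≠ 2) {R : ℝ} {l c : LocalAlg p K}
    (hl : ∀ x : LocalAlg p K, ‖Algebra.norm ℚ_[p] x‖ ≤ R → ‖Algebra.norm ℚ_[p] (x * l)‖ ≤ p)
    (hc : c ∉ localInt p K) {t : ℚ_[p]} (hlt : ‖Algebra.norm ℚ_[p] l‖ ≤ ‖t‖) (ht : t ≠ 0)
    {n : ℚ} (hn0 : n ≠ 0) (hn : ¬ IsLocalNorm p K (t⁻¹ * n)) {φ : LocalAlg p K → ℂ}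
    (hφ : ∀ x, φ (coordEquiv p K x) = (translateSet R l c).indicator 1 x) :
    IsWhittaker t φ n fun _ => 0 := by
  have hp1 := one_lt_prime_cast (p := p)
  have H := isNormInvariant_translateSet h hK hp2 (c := c) hl
  have hnc : (n : ℚ_[p]) ≠ 0 := by exact_mod_cast hn0
  -- As `c` is not integral, neither is `x l`, and `|N l| ≤ |t|`.
  have hlarge : ∀ x ∈ translateSet R l c, 1 < ‖t * coordNorm x‖ := by
    rintro x ⟨-, hx⟩
    rw [← h.mem_localInt_iff hK] at hx
    have : coordEquiv p K x * l ∉ localInt p K := fun h1 =>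
      hc ((Submodule.add_mem_iff_right _ h1).1 hx)
    rw [h.mem_localInt_iff hK, not_le, map_mul, norm_mul, mul_comm] at this
    rw [norm_mul]
    exact this.trans_le (mul_le_mul_of_nonneg_right hlt (norm_nonneg _))
  have hzero : ∀ z ∈ Metric.closedBall (n : ℚ_[p]) 1,
      formDensity t (translateSet R l c) z = 0 := by
    intro z hz
    by_cases hN : IsLocalNorm p K (t⁻¹ * z)
    · rw [formDensity, normDensity_eq_zero, mul_zero]
      rw [Set.eq_empty_iff_forall_notMem]
      rintro x ⟨hx, hxA⟩
      have h1 := hlarge x hxA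
      rw [norm_mul, norm_eq_of_mem_ball_norm hx, ← norm_mul, mul_inv_cancel_left₀ ht] at h1
      have hz0 : z ≠ 0 := norm_pos_iff.1 (one_pos.trans h1)
      apply hn
      -- Since `|z| > 1 ≥ |z - n|`, the quotient `n / z` lies in `1 + p ℤ_p` and is a norm; then `n`
      -- would be represented along with `z`.
      have hw : z⁻¹ * n ∈ Metric.ball (1 : ℚ_[p]) 1 := by
        rw [← mul_mem_ball_norm_iff hz0, mul_inv_cancel_left₀ hz0, Metric.mem_ball, dist_comm]
        exact (Metric.mem_closedBall.1 hz).trans_lt h1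
      have := hN.mul (isLocalNorm_of_mem_ball_one h hK (fun _ => hp2) hw)
      rwa [mul_assoc, mul_inv_cancel_left₀ hz0] at this
    · exact formDensity_eq_zero h hK (fun _ => hp2) _ hN
  obtain ⟨M, hM⟩ := exists_pow_lt_of_lt_one (norm_pos_iff.2 hnc) (inv_lt_one_of_one_lt₀ hp1)
  have := H.isWhittaker h hK (fun _ => hp2) ht hφ (n := n) (M := M) (by
    rwa [zpow_neg, zpow_natCast, ← inv_pow])
  have hW : ∀ s, whittakerSum (formDensity t (translateSet R l c)) (n : ℚ_[p]) M s = 0 :=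
    whittakerSum_eq_zero (fun k => by
      rw [ballMean, setIntegral_eq_zero_of_forall_eq_zero, mul_zero]
      intro z hz
      refine hzero z (Metric.closedBall_subset_closedBall ?_ hz)
      exact zpow_le_one_of_nonpos₀ hp1.le (by omega)) M
  simpa only [hW, mul_zero] using this

theorem phi_eq_indicator_translateSet (h : Anisotropic p K) (hK : Module.finrank ℚ K = 2)
    (hram : IsRamified K p) {𝔞 : FractionalIdeal (𝓞 K)⁰ K} (h𝔞 : 𝔞 ≠ 0) (lam r : K)
    (x : Coords p K) : phi p 𝔞 lam r (coordEquiv p K x) =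
      (translateSet ‖((FractionalIdeal.absNorm 𝔞 : ℚ) : ℚ_[p])‖⁻¹ (toLocal p lam)
        (conj (toLocal p r))).indicator 1 x := by
  classical
  rw [Set.indicator_apply, phi]
  refine if_congr ?_ rfl rfl
  rw [h.mem_localIdeal_inv_iff hK h𝔞, ← le_inv_mul_iff₀ (norm_absNorm_pos h𝔞), mul_one,
    h.mem_localInt_iff hK]
  simp only [hram, forall_const]
  rfl

theorem isWhittaker_phi_zero (h : Anisotropic p K) (hK : Module.finrank ℚ K = 2) (hp2 : p ≠ 2)
    (hram : IsRamified K p) {𝔞 : FractionalIdeal (𝓞 K)⁰ K} (h𝔞 : 𝔞 ≠ 0) {lam : K}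
    (hlam : lam ∈ (different K)⁻¹ * 𝔞) {r : K} (hr : toLocal p r ∉ localInt p K)
    {n : ℚ} (hn0 : n ≠ 0) (hn : ¬ IsLocalNorm p K ((formCoeff 𝔞 lam : ℚ_[p])⁻¹ * n)) :
    IsWhittaker (formCoeff 𝔞 lam : ℚ_[p]) (phi p 𝔞 lam r) n fun _ => 0 := by
  have hA := norm_absNorm_pos (p := p) h𝔞
  refine isWhittaker_zero_of_translateSet h hK hp2 (fun x hx => ?_)
    (mt (conj_mem_localInt_iff h hK _).1 hr) ?_ (by exact_mod_cast formCoeff_ne_zero h𝔞 lam) hn0 hn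
    (phi_eq_indicator_translateSet h hK hram h𝔞 lam r)
  · have h1 := norm_norm_toLocal_le (p := p) h𝔞 hlam
    rw [(exists_mem_inv_different h hK hram hp2).1, inv_inv] at h1
    rw [map_mul, norm_mul]
    calc _ ≤ ‖((FractionalIdeal.absNorm 𝔞 : ℚ) : ℚ_[p])‖⁻¹ *
          (p * ‖((FractionalIdeal.absNorm 𝔞 : ℚ) : ℚ_[p])‖) := by gcongr
      _ = p := by field_simp
  · rw [norm_formCoeff h hK h𝔞]
    exact le_max_right _ _

theorem padicValRat_eq_of_norm_eq {q : ℚ} (hq : q ≠ 0) {k : ℤ}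
    (h : ‖(q : ℚ_[p])‖ = (p : ℝ) ^ (-k)) : padicValRat p q = k := by
  have hp1 := one_lt_prime_cast (p := p)
  rw [Padic.eq_padicNorm, padicNorm.eq_zpow_of_nonzero hq] at h
  push_cast at h
  have := zpow_right_injective₀ (zero_lt_one.trans hp1) hp1.ne' h
  omega

theorem IsWhittaker.differentiableAt_normalizedWhittaker {t : ℚ_[p]} {φ : LocalAlg p K → ℂ} {n : ℚ}
    {W : ℂ → ℂ} (h : IsWhittaker t φ n W) : DifferentiableAt ℂ (normalizedWhittaker t φ n) 0 := by
  rw [funext h.normalizedWhittaker_eq]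
  exact differentiableAt_normalization.mul (h.differentiable 0)

theorem IsWhittaker.deriv_normalizedWhittaker {t : ℚ_[p]} {φ : LocalAlg p K → ℂ} {n : ℚ}
    {W : ℂ → ℂ} (h : IsWhittaker t φ n W) (h0 : W 0 = 0) :
    deriv (normalizedWhittaker t φ n) 0 = normalization p K 0 * deriv W 0 := by
  rw [funext h.normalizedWhittaker_eq,
    deriv_fun_mul differentiableAt_normalization (h.differentiable 0), h0, mul_zero, zero_add]

end Translate

end LocalWhittaker

end

/-! ### Assembly of the proposition. -/

open LocalWhittaker in
theorem proposition5p5 {K : Type*} [Field K] [NumberField K] [NumberField.IsTotallyComplex K]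
    (hK : Module.finrank ℚ K = 2)
    (𝔞 : FractionalIdeal (𝓞 K)⁰ K) (h𝔞 : 𝔞 ≠ 0)
    (lam : K) (hlam : lam ∈ (different K)⁻¹ * 𝔞) (r : K) (hr : r ∈ (different K)⁻¹)
    (m : ℚ) (hm : 0 < m) (bm : ℚ) (hbm : bm = m / discrAt 𝔞 lam)
    (p : ℕ) [Fact p.Prime] (hDiff : MemDiff p 𝔞 lam bm) (hp2 : IsRamified K p → p ≠ 2)
    (κ : ℚ_[p]) (hκ : IsKappa K p κ) (ϖ μ : LocalAlg p K)
    (hϖ : IsRamified K p → IsUniformizer ϖ) (hμ : IsRamified K p → IsMu κ μ) :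
    -- Both Whittaker functions exist as entire functions, and the normalized ones are
    -- differentiable at `0`.
    ((∃ W, IsWhittaker (formCoeff 𝔞 lam : ℚ_[p]) (phi p 𝔞 lam r) bm W) ∧
      (∃ W, IsWhittaker (κ * (formCoeff 𝔞 lam : ℚ_[p])) (phiCoh p 𝔞 lam r ϖ μ) bm W) ∧
      DifferentiableAt ℂ (incoherentW p 𝔞 lam r bm) 0 ∧
      DifferentiableAt ℂ (coherentW p 𝔞 lam r κ ϖ μ bm) 0) ∧
    -- (1)
    (IsInert K p →
      (¬ ‖(m : ℚ_[p])‖ ≤ 1 → ∀ s, coherentW p 𝔞 lam r κ ϖ μ bm s = 0) ∧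
      (‖(m : ℚ_[p])‖ ≤ 1 → coherentW p 𝔞 lam r κ ϖ μ bm 0 ≠ 0 ∧
        deriv (incoherentW p 𝔞 lam r bm) 0 / coherentW p 𝔞 lam r κ ϖ μ bm 0 =
          -(1 / 2) * (1 + (padicValRat p m : ℂ)) * (Real.log p : ℂ))) ∧
    -- (2)
    (IsRamified K p → toLocal p r ∉ localInt p K →
      (∀ s, coherentW p 𝔞 lam r κ ϖ μ bm s = 0) ∧ (∀ s, incoherentW p 𝔞 lam r bm s = 0)) ∧
    -- (3)
    (IsRamified K p → toLocal p r ∈ localInt p K →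
      (¬ ‖(bm : ℚ_[p])‖ ≤ 1 → ∀ s, coherentW p 𝔞 lam r κ ϖ μ bm s = 0) ∧
      (‖(bm : ℚ_[p])‖ ≤ 1 → coherentW p 𝔞 lam r κ ϖ μ bm 0 ≠ 0 ∧
        deriv (incoherentW p 𝔞 lam r bm) 0 / coherentW p 𝔞 lam r κ ϖ μ bm 0 =
          -(1 / 2) * (padicValRat p (m * FractionalIdeal.absNorm
            (different K * (differentAt 𝔞 lam)⁻¹)) : ℂ) * (Real.log p : ℂ))) ∧
    -- (4)
    deriv (incoherentW p 𝔞 lam r bm) 0 =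
      -(1 / 2) * (cCoeff p 𝔞 lam m : ℂ) * (Real.log p : ℂ) *
        coherentW p 𝔞 lam r κ ϖ μ bm 0 := by
  classical
  have hp := prime_cast_pos (p := p)
  have hp1 := one_lt_prime_cast (p := p)
  set t : ℚ_[p] := (formCoeff 𝔞 lam : ℚ_[p]) with ht_def
  have ht : t ≠ 0 := by rw [ht_def]; exact_mod_cast formCoeff_ne_zero h𝔞 lam
  have hd0 := discrAt_ne_zero h𝔞 lam
  have hm0 : m ≠ 0 := hm.ne'
  have hbm0 : bm ≠ 0 := by rw [hbm]; exact div_ne_zero hm0 hd0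
  have hn : ¬ IsLocalNorm p K (t⁻¹ * bm) := by
    rintro ⟨x, hx⟩
    exact hDiff ⟨x, by rw [quadForm, hx, mul_inv_cancel_left₀ ht]⟩
  have h : Anisotropic p K := fun x hx => eq_zero_of_norm_eq_zero hK hn x hx
  have hval : padicValRat p bm = padicValRat p m - padicValRat p (discrAt 𝔞 lam) := by
    rw [hbm, padicValRat.div hm0 hd0]
  -- At an unramified prime `|N λ| ≤ |N 𝔞|`, so the form coefficient has the absolute value of `N
  -- 𝔞`. The relation `discrAt_mul_formCoeff` then makes `Δ(λ)` a unit.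
  have hval_unram : ¬ IsRamified K p → padicValRat p (discrAt 𝔞 lam) = 0 := by
    intro hram
    apply padicValRat_eq_of_norm_eq hd0
    have h1 := congrArg (fun q : ℚ => ‖(q : ℚ_[p])‖) (discrAt_mul_formCoeff h𝔞 lam)
    have h2 := norm_norm_toLocal_le (p := p) h𝔞 hlam
    rw [norm_discr_eq_one hram, inv_one, one_mul] at h2
    simp only [Rat.cast_mul, Rat.cast_neg, norm_mul, norm_neg] at h1
    rw [norm_formCoeff h hK h𝔞, max_eq_left h2] at h1
    rw [neg_zero, zpow_zero]
    exact mul_right_cancel₀ (norm_absNorm_pos h𝔞).ne' (h1.trans (one_mul _).symm)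
  have hval_discr : IsRamified K p → padicValRat p (NumberField.discr K : ℚ) = 1 := by
    intro hram
    apply padicValRat_eq_of_norm_eq (by exact_mod_cast NumberField.discr_ne_zero K)
    rw [zpow_neg_one, ← (exists_mem_inv_different h hK hram (hp2 hram)).1, Rat.cast_intCast]
  -- The `1` is `ord_p Δ` in the ramified case and the explicit summand in the other.
  have hc : cCoeff p 𝔞 lam m = padicValRat p bm + 1 := by
    rw [cCoeff]
    split_ifs with hram
    · have hD : (NumberField.discr K : ℚ) ≠ 0 := by exact_mod_cast NumberField.discr_ne_zero K
      rw [padicValRat.mul (mul_ne_zero hm0 hD) (inv_ne_zero hd0), padicValRat.mul hm0 hD,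
        padicValRat.inv, hval_discr hram, hval]
      ring
    · rw [hval, hval_unram hram, sub_zero]
  by_cases hr : IsRamified K p ∧ toLocal p r ∉ localInt p K
  · obtain ⟨hram, hr⟩ := hr
    have hW := isWhittaker_phi_zero h hK (hp2 hram) hram h𝔞 hlam hr hbm0 hn
    have hW' := isWhittaker_of_forall_eq_zero hK (κ * t)
      (phiCoh_eq_zero h hK (hp2 hram) hram 𝔞 lam hr (hϖ hram) (hμ hram).1) bm
    have hI : ∀ s, incoherentW p 𝔞 lam r bm s = 0 := fun s => by
      rw [incoherentW, hW.normalizedWhittaker_eq, mul_zero]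
    have hC : ∀ s, coherentW p 𝔞 lam r κ ϖ μ bm s = 0 := fun s => by
      rw [coherentW, hW'.normalizedWhittaker_eq, mul_zero]
    refine ⟨⟨⟨_, hW⟩, ⟨_, hW'⟩, hW.differentiableAt_normalizedWhittaker,
      hW'.differentiableAt_normalizedWhittaker⟩,
      fun hin => absurd hram (not_isRamified_of_isInert h hK hp2 hin), fun _ _ => ⟨hC, hI⟩,
      fun _ hr' => absurd hr' hr, ?_⟩
    rw [hC, mul_zero, funext hI, deriv_const]
  have hr' : IsRamified K p → toLocal p r ∈ localInt p K := by
    intro hram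
    by_contra hr'
    exact hr ⟨hram, hr'⟩
  obtain ⟨W, W', hW, hW', hlarge, hsmall⟩ := exists_isWhittaker_pair h hK hp2 hκ ht
    (exists_norm_formCoeff h𝔞 lam h hK) hbm0 hn (phi_eq_indicator h hK h𝔞 hlam hr')
    (phiCoh_eq_indicator h hK hp2 h𝔞 hlam hr' hϖ fun hram => (hμ hram).1)
  have hI : ∀ s, incoherentW p 𝔞 lam r bm s = normalization p K s * W s :=
    hW.normalizedWhittaker_eq
  have hC : ∀ s, coherentW p 𝔞 lam r κ ϖ μ bm s = normalization p K s * W' s :=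
    hW'.normalizedWhittaker_eq
  have hbig : ¬ ‖(bm : ℚ_[p])‖ ≤ 1 → (∀ s, incoherentW p 𝔞 lam r bm s = 0) ∧
      ∀ s, coherentW p 𝔞 lam r κ ϖ μ bm s = 0 := by
    intro hlt
    obtain ⟨h1, h2⟩ := hlarge (not_le.1 hlt)
    exact ⟨fun s => by rw [hI, h1, mul_zero], fun s => by rw [hC, h2, mul_zero]⟩
  have hint : ‖(bm : ℚ_[p])‖ ≤ 1 → coherentW p 𝔞 lam r κ ϖ μ bm 0 ≠ 0 ∧
      deriv (incoherentW p 𝔞 lam r bm) 0 = -(1 / 2) * ((padicValRat p bm : ℂ) + 1) *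
        (Real.log p : ℂ) * coherentW p 𝔞 lam r κ ϖ μ bm 0 := by
    intro hle
    obtain ⟨h0, h1, h2⟩ := hsmall hle
    refine ⟨by rw [hC]; exact mul_ne_zero normalization_zero_ne_zero h1, ?_⟩
    rw [incoherentW, hW.deriv_normalizedWhittaker h0, h2, hC]
    ring
  refine ⟨⟨⟨_, hW⟩, ⟨_, hW'⟩, hW.differentiableAt_normalizedWhittaker,
    hW'.differentiableAt_normalizedWhittaker⟩, fun hin => ?_, fun hram hr'' => absurd (hr' hram) hr'',
    fun hram _ => ⟨fun hlt => (hbig hlt).2, fun hle => ?_⟩, ?_⟩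
  · have hram := not_isRamified_of_isInert h hK hp2 hin
    have hval' : padicValRat p bm = padicValRat p m := by rw [hval, hval_unram hram, sub_zero]
    have hnorm : ‖(m : ℚ_[p])‖ = ‖(bm : ℚ_[p])‖ := by
      rw [Padic.eq_padicNorm, Padic.eq_padicNorm, padicNorm.eq_zpow_of_nonzero hm0,
        padicNorm.eq_zpow_of_nonzero hbm0, hval']
    rw [hnorm]
    refine ⟨fun hlt => (hbig hlt).2, fun hle => ?_⟩
    obtain ⟨h1, h2⟩ := hint hle
    refine ⟨h1, ?_⟩
    rw [h2, mul_div_cancel_right₀ _ h1, hval', add_comm (1 : ℂ)]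
  · obtain ⟨h1, h2⟩ := hint hle
    refine ⟨h1, ?_⟩
    have hD : FractionalIdeal.absNorm (different K) ≠ 0 :=
      mt FractionalIdeal.absNorm_eq_zero_iff.1 different_ne_zero
    have hDval : padicValRat p (FractionalIdeal.absNorm (different K)) = 1 := by
      apply padicValRat_eq_of_norm_eq hD
      rw [zpow_neg_one, ← (exists_mem_inv_different h hK hram (hp2 hram)).1, norm_absNorm_different]
    have hv : padicValRat p (m * FractionalIdeal.absNorm
        (different K * (differentAt 𝔞 lam)⁻¹)) = padicValRat p bm + 1 := by
      rw [map_mul, map_inv₀, ← discrAt, padicValRat.mul hm0 (mul_ne_zero hD (inv_ne_zero hd0)),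
        padicValRat.mul hD (inv_ne_zero hd0), padicValRat.inv, hDval, hval]
      ring
    rw [h2, mul_div_cancel_right₀ _ h1, hv]
    push_cast
    rfl
  · by_cases hle : ‖(bm : ℚ_[p])‖ ≤ 1
    · rw [(hint hle).2, hc]
      push_cast
      rfl
    -- For non-integral `bm` both functions vanish identically, so (4) reads `0 = 0`.
    · obtain ⟨h1, h2⟩ := hbig hle
      rw [h2, mul_zero, funext h1, deriv_const]
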